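/- Let $p,q\ge 0$, $n=p+q$, $I_{p,q}=\mathrm{diag}(1,\dots,1,-1,\dots,-1)$, and let $\langle x,y\rangle = x^t I_{p,q}\,y$ on $V=\mathbb R^n$. Put $SO(p,q)=\{g\in SL_n(\mathbb R): g^tI_{p,q}g=I_{p,q}\}$, with Lie algebra $\mathfrak{so}(p,q)$. Let $X\in\mathfrak{so}(p,q)$ be nilpotent and let $\{X,H,Y\}\subset\mathfrak{so}(p,q)$ be an $\mathfrak{sl}_2(\mathbb R)$-triple ($X\ne0$, $[H,X]=2X$, $[H,Y]=-2Y$, $[X,Y]=H$). **Notation.** For $d\ge1$ let $M(d-1)$ be the sum of all $d$-dimensional irreducible $\mathrm{Span}\{X,H,Y\}$-submodules of $V$, $L(d-1)=M(d-1)\cap\ker Y$, $t_d=\dim L(d-1)$. Let $\mathbb N$ be the set of dimensions of irreducible submodules of $V$, and let $\mathbb E,\mathbb O^1,\mathbb O^3\subset\mathbb N$ be the subsets of those $d$ that are even, $\equiv1$, $\equiv3\pmod 4$; put $\mathbb O=\mathbb O^1\cup\mathbb O^3$. On $L(d-1)$ consider $(v,u)_d=\langle v,X^{d-1}u\rangle$,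 which is symmetric for $d$ odd and symplectic for $d$ even. For $\theta\in\mathbb O$ let $(p_\theta,q_\theta)$ be the signature of $(\cdot,\cdot)_\theta$, and let $(v^\theta_j)$ be an orthogonal basis of $L(\theta-1)$ with $(v^\theta_j,v^\theta_j)_\theta=1$ for $j\le p_\theta$ and $=-1$ for $j>p_\theta$. For $\eta\in\mathbb E$ let $(v^\eta_j)$ be a symplectic basis of $L(\eta-1)$: $(v^\eta_j,v^\eta_{t_\eta/2+j})_\eta=1$ for $1\le j\le t_\eta/2$, all other pairings being $0$ up to antisymmetry. *Odd $\theta$.* For $1\le j\le t_\theta$, $0\le l\le\theta-1$ let $w^\theta_{jl}$ be $(X^lv^\theta_j+X^{\theta-1-l}v^\theta_j)/\sqrt2$ if $l<\frac{\theta-1}2$, $X^lv^\theta_j$ if $l=\frac{\theta-1}2$, and $(X^{\theta-1-l}v^\theta_j-X^lv^\theta_j)/\sqrt2$ if $l>\frac{\theta-1}2$. Let $\mathcal C^l_+(\theta)$ (resp. $\mathcal C^l_-(\theta)$) be the ordered set of those $w^\theta_{jl}$ with $\langle w^\theta_{jl},w^\theta_{jl}\rangle>0$ (resp. $<0$), with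 increasing $j$, and let $V^l_\pm(\theta)$ be its span. *Even $\eta$.* For $0\le l<\eta/2$ put $t=t_\eta$, $l'=\eta-1-l$, $s=(-1)^l$, $W^l(\eta)=X^lL(\eta-1)+X^{l'}L(\eta-1)$, and $$\sqrt2\,w^\eta_{jl}=\begin{cases}X^lv^\eta_j+sX^{l'}v^\eta_{j+t/2}&1\le j\le t/2\\ X^lv^\eta_j-sX^{l'}v^\eta_{j-t/2}&t/2<j\le t\\ X^lv^\eta_{j-t}-sX^{l'}v^\eta_{j-t/2}&t<j\le 3t/2\\ X^lv^\eta_{j-t}+sX^{l'}v^\eta_{j-3t/2}&3t/2<j\le2t.\end{cases}$$ Let $\mathcal D^l(\eta)=(w^\eta_{1l},\dots,w^\eta_{2t\,l})$, let $\mathcal D^l_+(\eta)$ be its first $t$ members and $\mathcal D^l_-(\eta)$ its last $t$ members. *The basis $\mathcal H$.* $\mathcal H=\mathcal H_+\vee\mathcal H_-$ (juxtaposition), where $\mathcal H_\pm$ juxtaposes first the $\mathcal D^l_\pm(\eta)$ ($\eta\in\mathbb E$), then the $\mathcal C^l_\pm(\theta)$ ($\theta\in\mathbb O^1$), then the $\mathcal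 C^l_\pm(\zeta)$ ($\zeta\in\mathbb O^3$), in each part in order of increasing $\eta,\theta,\zeta$ and, for each of these, of increasing $l$. *The group $K$.* Write $\wp(S+\sqrt{-1}\,T)=\begin{pmatrix}S&-T\\T&S\end{pmatrix}$. Let $Z=\mathcal Z_{SO(p,q)}(X,H,Y)$ be the centralizer, and let $K$ be the set of $g\in Z$ such that: (1) $g$ preserves $V^l_+(\theta)$ and $V^l_-(\theta)$ for $\theta\in\mathbb O$, $0\le l\le\theta-1$; (2) for $\theta\in\mathbb O$ and $0\le l\le\theta-1$, the matrix of $g$ on $V^0_+(\theta)$ equals the one on $V^l_{\varepsilon}(\theta)$ and the matrix of $g$ on $V^0_-(\theta)$ equals the one on $V^l_{-\varepsilon}(\theta)$, in the bases $\mathcal C^l_\pm(\theta)$, where $\varepsilon=(-1)^l$ if $l<\frac{\theta-1}2$, $\varepsilon=(-1)^{l+1}$ if $l>\frac{\theta-1}2$, and for $l=\frac{\theta-1}2$, $\varepsilon=+$ if $\theta\in\mathbb O^1$, $\varepsilon=-$ if $\theta\in\mathbb O^3$; (3) $g$ preserves $W^l(\eta)$ for $\eta\in\mathbb E$, $0\le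 l<\eta/2$; (4) for each $\eta\in\mathbb E$ there is $U\in U(t_\eta/2)$ such that for all $0\le l<\eta/2$ the matrix of $g$ on $W^l(\eta)$ in the basis $\mathcal D^l(\eta)$ is $\wp(U)\oplus\wp(U)$. *The maps.* Let $B_\blacktriangle^s=B\oplus\cdots\oplus B$ ($s$ blocks). For $g=\big((A_\eta)_{\eta\in\mathbb E};(C_\theta,D_\theta)_{\theta\in\mathbb O^1};(E_\zeta,F_\zeta)_{\zeta\in\mathbb O^3}\big)$ with $A_\eta\in M_{t_\eta/2}(\mathbb C)$, $C_\theta\in M_{p_\theta}(\mathbb R)$, $D_\theta\in M_{q_\theta}(\mathbb R)$, $E_\zeta\in M_{p_\zeta}(\mathbb R)$, $F_\zeta\in M_{q_\zeta}(\mathbb R)$ put $$\mathbf D_p(g)=\bigoplus_\eta\wp(A_\eta)_\blacktriangle^{\eta/2}\oplus\bigoplus_\theta\Big((C_\theta\oplus D_\theta)_\blacktriangle^{\frac{\theta-1}4}\oplus C_\theta\oplus(C_\theta\oplus D_\theta)_\blacktriangle^{\frac{\theta-1}4}\Big)\oplus\bigoplus_\zeta\Big((E_\zeta\oplus F_\zeta)_\blacktriangle^{\frac{\zeta+1}4}\oplus(F_\zeta\oplus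 E_\zeta)_\blacktriangle^{\frac{\zeta-3}4}\oplus F_\zeta\Big),$$ let $\mathbf D_q(g)$ be given by the same formula with $C_\theta,D_\theta$ interchanged and $E_\zeta,F_\zeta$ interchanged, and let $$\chi_p(g)=\prod_\eta\det\wp(A_\eta)^{\eta/2}\prod_\theta\det C_\theta\prod_\zeta\det E_\zeta,\qquad \chi_q(g)=\prod_\eta\det\wp(A_\eta)^{\eta/2}\prod_\theta\det D_\theta\prod_\zeta\det F_\zeta .$$ **Theorem.** $K$ is a maximal compact subgroup of $\mathcal Z_{SO(p,q)}(X,H,Y)$; $\mathcal H$ is an ordered basis of $V$ with $\#\mathcal H_+=p$ and $\#\mathcal H_-=q$; $\mathbf D_p(g)$ and $\mathbf D_q(g)$ have sizes $p$ and $q$; and, $\Lambda_{\mathcal H}$ denoting the matrix in the ordered basis $\mathcal H$, one has $\Lambda_{\mathcal H}(K)\subset S(O(p)\times O(q))$ and $$\Lambda_{\mathcal H}(K)=\Big\{\mathbf D_p(g)\oplus\mathbf D_q(g)\ \Big|\ g\in\prod_{\eta\in\mathbb E}U(t_\eta/2)\times\prod_{\theta\in\mathbb O^1}(O_{p_\theta}\times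 O_{q_\theta})\times\prod_{\zeta\in\mathbb O^3}(O_{p_\zeta}\times O_{q_\zeta}),\ \chi_p(g)\chi_q(g)=1\Big\}.$$ -/

import Mathlib

open scoped Matrix

attribute [local instance] LieRing.ofAssociativeRing

noncomputable section

namespace SOpq

/-- The index set of `ℝ^(p+q)`: first `p` coordinates, then `q` coordinates. -/
abbrev Idx (p q : ℕ) : Type := Fin p ⊕ Fin q

/-- The space `V = ℝ^(p+q)` of column vectors. -/
abbrev Vec (p q : ℕ) : Type := Idx p q → ℝ

/-- The Lie algebra `𝔰𝔬(p,q)` of real matrices `Z` with `Zᵗ I_{p,q} + I_{p,q} Z = 0`. -/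
abbrev so (p q : ℕ) : LieSubalgebra ℝ (Matrix (Idx p q) (Idx p q) ℝ) :=
  LieAlgebra.Orthogonal.so' (Fin p) (Fin q) ℝ

/-- The matrix `I_{p,q}`. -/
abbrev Ipq (p q : ℕ) : Matrix (Idx p q) (Idx p q) ℝ :=
  LieAlgebra.Orthogonal.indefiniteDiagonal (Fin p) (Fin q) ℝ

/-- `SL_{p+q}(ℝ)`. -/
abbrev SL (p q : ℕ) : Type := Matrix.SpecialLinearGroup (Idx p q) ℝ

/-- The group `SO(p,q)` of real matrices `g` with `det g = 1` and `gᵗ I_{p,q} g = I_{p,q}`. -/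
def SO (p q : ℕ) : Subgroup (SL p q) where
  carrier := {g | (g : Matrix (Idx p q) (Idx p q) ℝ)ᵀ * Ipq p q * g = Ipq p q}
  one_mem' := by simp
  mul_mem' := by
    intro a b ha hb
    simp only [Set.mem_ofPred_eq, Matrix.SpecialLinearGroup.coe_mul, Matrix.transpose_mul] at *
    calc _ = (b : Matrix (Idx p q) (Idx p q) ℝ)ᵀ *
          ((a : Matrix (Idx p q) (Idx p q) ℝ)ᵀ * Ipq p q * a) * b := by
            simp only [Matrix.mul_assoc]
      _ = _ := by rw [ha, hb]
  inv_mem' := by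
    intro a ha
    simp only [Set.mem_ofPred_eq] at *
    have h1 : (a : Matrix (Idx p q) (Idx p q) ℝ) *
        ((a⁻¹ : SL p q) : Matrix (Idx p q) (Idx p q) ℝ) = 1 := by
      rw [← Matrix.SpecialLinearGroup.coe_mul]; simp
    have h2 : ((a⁻¹ : SL p q) : Matrix (Idx p q) (Idx p q) ℝ)ᵀ *
        (a : Matrix (Idx p q) (Idx p q) ℝ)ᵀ = 1 := by
      rw [← Matrix.transpose_mul, h1, Matrix.transpose_one]
    calc _ = ((a⁻¹ : SL p q) : Matrix (Idx p q) (Idx p q) ℝ)ᵀ *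
          ((a : Matrix (Idx p q) (Idx p q) ℝ)ᵀ * Ipq p q * a) *
          ((a⁻¹ : SL p q) : Matrix (Idx p q) (Idx p q) ℝ) := by rw [ha]
      _ = (((a⁻¹ : SL p q) : Matrix (Idx p q) (Idx p q) ℝ)ᵀ *
          (a : Matrix (Idx p q) (Idx p q) ℝ)ᵀ) * Ipq p q * (a *
          ((a⁻¹ : SL p q) : Matrix (Idx p q) (Idx p q) ℝ)) := by
            simp only [Matrix.mul_assoc]
      _ = _ := by rw [h1, h2]; simp

/-- The form `⟨x, y⟩ = xᵗ I_{p,q} y`. -/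
def form {p q : ℕ} (x y : Vec p q) : ℝ := x ⬝ᵥ (Ipq p q *ᵥ y)

/-! ### Block matrices -/

/-- A real square matrix together with its size. -/
abbrev SqBlock : Type := Σ m : ℕ, Matrix (Fin m) (Fin m) ℝ

/-- The block diagonal matrix `A₁ ⊕ ⋯ ⊕ A_r`. -/
def directSum : List SqBlock → SqBlock
  | [] => ⟨0, 0⟩
  | ⟨m, A⟩ :: L => ⟨m + (directSum L).1,
      Matrix.reindex finSumFinEquiv finSumFinEquiv (Matrix.fromBlocks A 0 0 (directSum L).2)⟩

/-- A square matrix of size `n`, seen in `M_n(ℝ)`; used only for matrices of size `n`. -/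
def toSize (n : ℕ) (S : SqBlock) : Matrix (Fin n) (Fin n) ℝ :=
  if h : S.1 = n then S.2.submatrix (Fin.cast h.symm) (Fin.cast h.symm) else 0

/-- The embedding `S + iT ↦ (S, -T; T, S)` of `M_m(ℂ)` into `M_{2m}(ℝ)`. -/
def wp {m : ℕ} (U : Matrix (Fin m) (Fin m) ℂ) : Matrix (Fin (m + m)) (Fin (m + m)) ℝ :=
  Matrix.reindex finSumFinEquiv finSumFinEquiv
    (Matrix.fromBlocks (U.map Complex.re) (-(U.map Complex.im))
      (U.map Complex.im) (U.map Complex.re))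

/-- `g` leaves the span of the ordered independent set `L` invariant and its restriction has the
matrix `M` in the ordered basis `L`. -/
def HasMatrix {p q m : ℕ} (g : SL p q) (L : List (Vec p q)) (M : Matrix (Fin m) (Fin m) ℝ) :
    Prop :=
  ∃ u : Fin m → Vec p q, List.ofFn u = L ∧
    ∀ j, (g : Matrix (Idx p q) (Idx p q) ℝ) *ᵥ u j = ∑ i, M i j • u i

/-- The span of the members of an ordered set. -/
def spanList {p q : ℕ} (L : List (Vec p q)) : Submodule ℝ (Vec p q) :=
  Submodule.span ℝ {v | v ∈ L}

/-- `g(W) ⊆ W`. -/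
def Preserves {p q : ℕ} (g : SL p q) (W : Submodule ℝ (Vec p q)) : Prop :=
  ∀ w ∈ W, (g : Matrix (Idx p q) (Idx p q) ℝ) *ᵥ w ∈ W

/-! ### The module `V` over the span of `X, H, Y` -/

section Triple

variable {p q : ℕ} (X H Y : so p q)

/-- The centralizer of `{X, H, Y}` in `SO(p,q)`: all `g` with `Ad(g) Z = g Z g⁻¹ = Z` for
`Z = X, H, Y`. -/
def centralizer : Subgroup (SL p q) where
  carrier := {g | g ∈ SO p q ∧ ∀ Z ∈ ({X, H, Y} : Set (so p q)),
    (g : Matrix (Idx p q) (Idx p q) ℝ) * (Z : Matrix (Idx p q) (Idx p q) ℝ) *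
      ((g⁻¹ : SL p q) : Matrix (Idx p q) (Idx p q) ℝ) = Z}
  one_mem' := ⟨one_mem _, by simp⟩
  mul_mem' := by
    rintro a b ⟨ha, ha'⟩ ⟨hb, hb'⟩
    refine ⟨mul_mem ha hb, fun Z hZ => ?_⟩
    rw [mul_inv_rev, Matrix.SpecialLinearGroup.coe_mul, Matrix.SpecialLinearGroup.coe_mul]
    conv_rhs => rw [← ha' Z hZ, ← hb' Z hZ]
    simp only [Matrix.mul_assoc]
  inv_mem' := by
    rintro a ⟨ha, ha'⟩
    refine ⟨inv_mem ha, fun Z hZ => ?_⟩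
    have h1 : ((a⁻¹ : SL p q) : Matrix (Idx p q) (Idx p q) ℝ) *
        (a : Matrix (Idx p q) (Idx p q) ℝ) = 1 := by
      rw [← Matrix.SpecialLinearGroup.coe_mul]; simp
    conv_lhs => rw [← ha' Z hZ]
    rw [inv_inv]
    calc _ = (((a⁻¹ : SL p q) : Matrix (Idx p q) (Idx p q) ℝ) *
          (a : Matrix (Idx p q) (Idx p q) ℝ)) * (Z : Matrix (Idx p q) (Idx p q) ℝ) *
          (((a⁻¹ : SL p q) : Matrix (Idx p q) (Idx p q) ℝ) *
          (a : Matrix (Idx p q) (Idx p q) ℝ)) := by simp only [Matrix.mul_assoc]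
      _ = _ := by rw [h1]; simp

/-- `A` is a submodule of `V` for the span of `X, H, Y`. -/
def IsSubmod (A : Submodule ℝ (Vec p q)) : Prop :=
  ∀ Z ∈ ({X, H, Y} : Set (so p q)), ∀ v ∈ A, (Z : Matrix (Idx p q) (Idx p q) ℝ) *ᵥ v ∈ A

/-- `A` is a non-zero irreducible submodule of `V` for the span of `X, H, Y`. -/
def IsIrred (A : Submodule ℝ (Vec p q)) : Prop :=
  IsSubmod X H Y A ∧ A ≠ ⊥ ∧ ∀ B, IsSubmod X H Y B → B ≤ A → B = ⊥ ∨ B = A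

/-- `M(d-1)`: the sum of all irreducible submodules of `V` of dimension `d`. -/
def isotypic (d : ℕ) : Submodule ℝ (Vec p q) :=
  sSup {A | IsIrred X H Y A ∧ Module.finrank ℝ A = d}

/-- `L(d-1)`: the kernel of `Y` in `M(d-1)`. -/
def lowest (d : ℕ) : Submodule ℝ (Vec p q) :=
  LinearMap.ker (Y : Matrix (Idx p q) (Idx p q) ℝ).mulVecLin ⊓ isotypic X H Y d

/-- `t_d = dim L(d-1)`. -/
def mult (d : ℕ) : ℕ := Module.finrank ℝ (lowest X H Y d)

open Classical in
/-- `ℕ_𝐝`: the dimensions of the irreducible submodules of `V`. -/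
def parts : Finset ℕ :=
  (Finset.range (p + q + 1)).filter fun d => ∃ A, IsIrred X H Y A ∧ Module.finrank ℝ A = d

/-- `𝔼_𝐝`. -/
def evenParts : Finset ℕ := (parts X H Y).filter fun d => d % 2 = 0

/-- `𝕆¹_𝐝`. -/
def oddParts1 : Finset ℕ := (parts X H Y).filter fun d => d % 4 = 1

/-- `𝕆³_𝐝`. -/
def oddParts3 : Finset ℕ := (parts X H Y).filter fun d => d % 4 = 3

/-- `X^l v`. -/
def powApply (l : ℕ) (v : Vec p q) : Vec p q :=
  ((X : Matrix (Idx p q) (Idx p q) ℝ) ^ l) *ᵥ v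

/-- The form `(v, u)_d = ⟨v, X^(d-1) u⟩`, used on `L(d-1)`. -/
def formL (d : ℕ) (v u : Vec p q) : ℝ := form v (powApply X (d - 1) u)

/-- `W^l(η) = X^l L(η-1) + X^(η-1-l) L(η-1)`. -/
def spaceW (η l : ℕ) : Submodule ℝ (Vec p q) :=
  (lowest X H Y η).map ((X : Matrix (Idx p q) (Idx p q) ℝ) ^ l).mulVecLin ⊔
    (lowest X H Y η).map ((X : Matrix (Idx p q) (Idx p q) ℝ) ^ (η - 1 - l)).mulVecLin

/-- A choice of ordered bases `(v^d_1, …, v^d_{t_d})` of the spaces `L(d-1)`: for odd `d` a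
standard orthogonal basis for `(·,·)_d`, the vectors of positive square coming first, and for
even `d` a symplectic basis for `(·,·)_d`. Indices start at `0`. -/
structure AdaptedBasis where
  /-- the basis of `L(d-1)` -/
  v : ∀ d : ℕ, Module.Basis (Fin (mult X H Y d)) ℝ (lowest X H Y d)
  /-- the number `p_d` of basis vectors of positive square -/
  pos : ℕ → ℕ
  pos_le : ∀ d, Odd d → pos d ≤ mult X H Y d
  odd_form : ∀ d, Odd d → ∀ i j, formL X d (v d i) (v d j) =
    if i = j then (if (j : ℕ) < pos d then 1 else -1) else 0
  even_form : ∀ d, Even d → ∀ i j, formL X d (v d i) (v d j) =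
    if (j : ℕ) = i + mult X H Y d / 2 then 1
    else if (i : ℕ) = j + mult X H Y d / 2 then -1 else 0

end Triple

namespace AdaptedBasis

variable {p q : ℕ} {X H Y : so p q} (B : AdaptedBasis X H Y)

/-- `(p_d, q_d)`, for `d` odd, is the signature of `(·,·)_d`; this is `q_d`. -/
def neg (d : ℕ) : ℕ := mult X H Y d - B.pos d

/-- `v^d_j` as a vector of `V`, for `0 ≤ j < t_d`. -/
def vec (d j : ℕ) : Vec p q :=
  if h : j < mult X H Y d then (B.v d ⟨j, h⟩ : Vec p q) else 0

/-- `X^l v^d_j`. -/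
def xv (d l j : ℕ) : Vec p q := powApply X l (B.vec d j)

/-- The vectors `w^θ_{jl}`, for `θ` odd, `0 ≤ j < t_θ` and `0 ≤ l < θ`. -/
def wOdd (θ j l : ℕ) : Vec p q :=
  if l < (θ - 1) / 2 then (√2)⁻¹ • (B.xv θ l j + B.xv θ (θ - 1 - l) j)
  else if l = (θ - 1) / 2 then B.xv θ l j
  else (√2)⁻¹ • (B.xv θ (θ - 1 - l) j - B.xv θ l j)

/-- `𝒞^l(θ) = (w^θ_{1l}, …, w^θ_{t_θ l})`. -/
def setC (θ l : ℕ) : List (Vec p q) :=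
  (List.range (mult X H Y θ)).map fun j => B.wOdd θ j l

/-- `𝒞^l_+(θ)` for `ε = 1` and `𝒞^l_-(θ)` for `ε = -1`: the members `v` of `𝒞^l(θ)` with
`⟨v, v⟩` of sign `ε`, in the order of `𝒞^l(θ)`. -/
def setCsgn (ε : ℝ) (θ l : ℕ) : List (Vec p q) :=
  (B.setC θ l).filter fun v => decide (0 < ε * form v v)

/-- The vectors `w^η_{jl}`, for `η` even, `0 ≤ j < 2 t_η` and `0 ≤ l < η/2`. -/
def wEven (η j l : ℕ) : Vec p q :=
  let t := mult X H Y η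
  let l' := η - 1 - l
  let s : ℝ := (-1) ^ l
  (√2)⁻¹ •
    (if j < t / 2 then B.xv η l j + s • B.xv η l' (j + t / 2)
    else if j < t then B.xv η l j - s • B.xv η l' (j - t / 2)
    else if j < 3 * t / 2 then B.xv η l (j - t) - s • B.xv η l' (j - t / 2)
    else B.xv η l (j - t) + s • B.xv η l' (j - 3 * t / 2))

/-- `𝒟^l_+(η) = (w^η_{1l}, …, w^η_{t_η l})`. -/
def setDpos (η l : ℕ) : List (Vec p q) :=
  (List.range (mult X H Y η)).map fun j => B.wEven η j l

/-- `𝒟^l_-(η) = (w^η_{(t_η+1)l}, …, w^η_{(2t_η)l})`. -/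
def setDneg (η l : ℕ) : List (Vec p q) :=
  (List.range (mult X H Y η)).map fun j => B.wEven η (mult X H Y η + j) l

/-- `𝒟^l(η) = (w^η_{1l}, …, w^η_{(2t_η)l})`. -/
def setD (η l : ℕ) : List (Vec p q) :=
  (List.range (2 * mult X H Y η)).map fun j => B.wEven η j l

/-! ### The subgroup `K` -/

/-- The sign `ε` for which the matrix of `g` on `V^l_ε(θ)` is compared with that on `V^0_+(θ)`. -/
def cmpSign (θ l : ℕ) : ℝ :=
  if l < (θ - 1) / 2 then (-1) ^ l
  else if l = (θ - 1) / 2 then (if θ % 4 = 1 then 1 else -1)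
  else (-1) ^ (l + 1)

/-- The set `K` of those `g` in the centralizer of `{X, H, Y}` in `SO(p,q)` such that
* `g` preserves `V^l_+(θ)` and `V^l_-(θ)` for `θ` odd and `0 ≤ l < θ`;
* the matrices of `g` on the `V^l_±(θ)` in the bases `𝒞^l_±(θ)` agree with that on `V^0_+(θ)`,
  respectively `V^0_-(θ)`, according to the sign pattern;
* `g` preserves `W^l(η)` for `η` even and `0 ≤ l < η/2`;
* the matrix of `g` on each `W^l(η)` in the basis `𝒟^l(η)` consists of two copies of `℘(U)` for
  one unitary matrix `U` of size `t_η/2`. -/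
def setK : Set (SL p q) :=
  {g | g ∈ centralizer X H Y ∧
    (∀ θ ∈ oddParts1 X H Y ∪ oddParts3 X H Y,
      (∀ l < θ, Preserves g (spanList (B.setCsgn 1 θ l)) ∧
        Preserves g (spanList (B.setCsgn (-1) θ l))) ∧
      (∃ M : Matrix (Fin (B.pos θ)) (Fin (B.pos θ)) ℝ, HasMatrix g (B.setCsgn 1 θ 0) M ∧
        ∀ l < θ, HasMatrix g (B.setCsgn (cmpSign θ l) θ l) M) ∧
      (∃ M : Matrix (Fin (B.neg θ)) (Fin (B.neg θ)) ℝ, HasMatrix g (B.setCsgn (-1) θ 0) M ∧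
        ∀ l < θ, HasMatrix g (B.setCsgn (-cmpSign θ l) θ l) M)) ∧
    (∀ η ∈ evenParts X H Y,
      (∀ l < η / 2, Preserves g (spaceW X H Y η l)) ∧
      ∃ U ∈ Matrix.unitaryGroup (Fin (mult X H Y η / 2)) ℂ, ∀ l < η / 2,
        HasMatrix g (B.setD η l) (directSum [⟨_, wp U⟩, ⟨_, wp U⟩]).2)}

/-! ### The ordered basis `ℋ` -/

/-- `ℋ_+ = ℰ_+ ∨ 𝒪¹_+ ∨ 𝒪³_+`, each part running through increasing `d`, then increasing `l`. -/
def basisPos : List (Vec p q) :=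
  ((evenParts X H Y).sort.flatMap fun η =>
      (List.range (η / 2)).flatMap fun l => B.setDpos η l) ++
    ((oddParts1 X H Y).sort.flatMap fun θ =>
      (List.range θ).flatMap fun l => B.setCsgn 1 θ l) ++
    ((oddParts3 X H Y).sort.flatMap fun ζ =>
      (List.range ζ).flatMap fun l => B.setCsgn 1 ζ l)

/-- `ℋ_- = ℰ_- ∨ 𝒪¹_- ∨ 𝒪³_-`. -/
def basisNeg : List (Vec p q) :=
  ((evenParts X H Y).sort.flatMap fun η =>
      (List.range (η / 2)).flatMap fun l => B.setDneg η l) ++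
    ((oddParts1 X H Y).sort.flatMap fun θ =>
      (List.range θ).flatMap fun l => B.setCsgn (-1) θ l) ++
    ((oddParts3 X H Y).sort.flatMap fun ζ =>
      (List.range ζ).flatMap fun l => B.setCsgn (-1) ζ l)

/-! ### The maps `𝐃_p`, `𝐃_q` and the characters `χ_p`, `χ_q` -/

/-- The algebra `∏ M_{t_η/2}(ℂ) × ∏ (M_{p_θ}(ℝ) × M_{q_θ}(ℝ)) × ∏ (M_{p_ζ}(ℝ) × M_{q_ζ}(ℝ))`,
the products over `η ∈ 𝔼_𝐝`, `θ ∈ 𝕆¹_𝐝`, `ζ ∈ 𝕆³_𝐝`. -/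
structure BlockData where
  A : ∀ η : evenParts X H Y,
    Matrix (Fin (mult X H Y η / 2)) (Fin (mult X H Y η / 2)) ℂ
  C : ∀ θ : oddParts1 X H Y, Matrix (Fin (B.pos θ)) (Fin (B.pos θ)) ℝ
  D : ∀ θ : oddParts1 X H Y, Matrix (Fin (B.neg θ)) (Fin (B.neg θ)) ℝ
  E : ∀ ζ : oddParts3 X H Y, Matrix (Fin (B.pos ζ)) (Fin (B.pos ζ)) ℝ
  F : ∀ ζ : oddParts3 X H Y, Matrix (Fin (B.neg ζ)) (Fin (B.neg ζ)) ℝ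

variable {B}

/-- Membership in `∏ U(t_η/2) × ∏ (O_{p_θ} × O_{q_θ}) × ∏ (O_{p_ζ} × O_{q_ζ})`. -/
def BlockData.IsCompactType (g : B.BlockData) : Prop :=
  (∀ η, g.A η ∈ Matrix.unitaryGroup _ ℂ) ∧
  (∀ θ, g.C θ ∈ Matrix.orthogonalGroup _ ℝ ∧ g.D θ ∈ Matrix.orthogonalGroup _ ℝ) ∧
  (∀ ζ, g.E ζ ∈ Matrix.orthogonalGroup _ ℝ ∧ g.F ζ ∈ Matrix.orthogonalGroup _ ℝ)

/-- The list of blocks `L ∨ ⋯ ∨ L` (`s` times). -/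
def rep (s : ℕ) (L : List SqBlock) : List SqBlock := (List.replicate s L).flatten

/-- `𝐃_p(g)`, with its size. -/
def BlockData.sumP (g : B.BlockData) : SqBlock :=
  directSum <|
    ((Finset.univ : Finset (evenParts X H Y)).sort.flatMap fun (η : evenParts X H Y) =>
      rep (η / 2) [⟨_, wp (g.A η)⟩]) ++
    ((Finset.univ : Finset (oddParts1 X H Y)).sort.flatMap fun (θ : oddParts1 X H Y) =>
      rep ((θ - 1) / 4) [⟨_, g.C θ⟩, ⟨_, g.D θ⟩] ++ [⟨_, g.C θ⟩] ++
        rep ((θ - 1) / 4) [⟨_, g.C θ⟩, ⟨_, g.D θ⟩]) ++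
    ((Finset.univ : Finset (oddParts3 X H Y)).sort.flatMap fun (ζ : oddParts3 X H Y) =>
      rep ((ζ + 1) / 4) [⟨_, g.E ζ⟩, ⟨_, g.F ζ⟩] ++
        rep ((ζ - 3) / 4) [⟨_, g.F ζ⟩, ⟨_, g.E ζ⟩] ++ [⟨_, g.F ζ⟩])

/-- `𝐃_q(g)`, with its size. -/
def BlockData.sumQ (g : B.BlockData) : SqBlock :=
  directSum <|
    ((Finset.univ : Finset (evenParts X H Y)).sort.flatMap fun (η : evenParts X H Y) =>
      rep (η / 2) [⟨_, wp (g.A η)⟩]) ++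
    ((Finset.univ : Finset (oddParts1 X H Y)).sort.flatMap fun (θ : oddParts1 X H Y) =>
      rep ((θ - 1) / 4) [⟨_, g.D θ⟩, ⟨_, g.C θ⟩] ++ [⟨_, g.D θ⟩] ++
        rep ((θ - 1) / 4) [⟨_, g.D θ⟩, ⟨_, g.C θ⟩]) ++
    ((Finset.univ : Finset (oddParts3 X H Y)).sort.flatMap fun (ζ : oddParts3 X H Y) =>
      rep ((ζ + 1) / 4) [⟨_, g.F ζ⟩, ⟨_, g.E ζ⟩] ++
        rep ((ζ - 3) / 4) [⟨_, g.E ζ⟩, ⟨_, g.F ζ⟩] ++ [⟨_, g.E ζ⟩])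

/-- `𝐃_p(g)` in `M_p(ℝ)`. -/
def BlockData.Dp (g : B.BlockData) : Matrix (Fin p) (Fin p) ℝ := toSize p g.sumP

/-- `𝐃_q(g)` in `M_q(ℝ)`. -/
def BlockData.Dq (g : B.BlockData) : Matrix (Fin q) (Fin q) ℝ := toSize q g.sumQ

/-- `χ_p(g) = ∏ (det ℘(A_η))^(η/2) ∏ det C_θ ∏ det E_ζ`. -/
def BlockData.chiP (g : B.BlockData) : ℝ :=
  (∏ η : evenParts X H Y, (wp (g.A η)).det ^ ((η : ℕ) / 2)) * (∏ θ, (g.C θ).det) *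
    ∏ ζ, (g.E ζ).det

/-- `χ_q(g) = ∏ (det ℘(A_η))^(η/2) ∏ det D_θ ∏ det F_ζ`. -/
def BlockData.chiQ (g : B.BlockData) : ℝ :=
  (∏ η : evenParts X H Y, (wp (g.A η)).det ^ ((η : ℕ) / 2)) * (∏ θ, (g.D θ).det) *
    ∏ ζ, (g.F ζ).det

end AdaptedBasis

/-- `S(O(p) × O(q))`, as a set of block diagonal matrices. -/
def SOxO (p q : ℕ) : Set (Matrix (Idx p q) (Idx p q) ℝ) :=
  {M | ∃ A ∈ Matrix.orthogonalGroup (Fin p) ℝ, ∃ D ∈ Matrix.orthogonalGroup (Fin q) ℝ,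
    A.det * D.det = 1 ∧ M = Matrix.fromBlocks A 0 0 D}

/-- `Λ_b(g)`: the matrix of `g` in the ordered basis `b`. -/
def Lam {p q : ℕ} (b : Module.Basis (Idx p q) ℝ (Vec p q)) (g : SL p q) :
    Matrix (Idx p q) (Idx p q) ℝ :=
  LinearMap.toMatrix b b (g : Matrix (Idx p q) (Idx p q) ℝ).mulVecLin

end SOpq

end

/-! By complete reducibility `V` is the direct sum of the layers `X^l L(d-1)` with `0 ≤ l < d`,
where `L(d-1)` consists of the vectors of weight `1-d` killed by `Y`. An endomorphism commuting with
`X, H, Y` preserves each `L(d-1)`, acts there by a matrix `A_d`, and acts by the same matrix on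
every `X^l L(d-1)`. Since `X` and `H` are skew for the form, `X^l u` and `X^l' v` with `u ∈ L(d-1)`,
`v ∈ L(d'-1)` are orthogonal unless `d = d'` and `l + l' = d - 1`, and then they pair to `(-1)^l
(u,v)_d`. So the centralizer consists of the families `(A_d)` of isometries of the forms `(·,·)_d`,
subject to `∏ det(A_d)^d = 1` (`mem_centralizer_iff`, `det_act`).

In an adapted basis the Gram matrix `J` of `(·,·)_d` is orthogonal. Let `K'` (`orthogonalSubgroup`)
be the group of those families in which every `A_d` is also an orthogonal matrix. It is compact. It
is maximal because each isometry factors as `A = KP` with `K` orthogonal, `P` positive definite, and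
both isometries (`exists_polar`). A compact group containing `K'` and `A` then contains all powers
of the element given by `P`, so these are bounded; as `J` carries the eigenvalue `μ` of `P` to
`μ⁻¹`, every eigenvalue is `1` and `P = 1`.

An orthogonal isometry of `J` is an orthogonal matrix commuting with `J`. For `d` odd this means
block diagonal in `O(p_d) × O(q_d)`, for `d` even the image under `℘` of a unitary matrix. The
vectors `w` combine `X^l v` and `X^(d-1-l) v` with coefficients chosen to diagonalise the form and
to be compatible with `A_d` when `A_d` commutes with `J`. Hence the elements of `K'` satisfy the
conditions defining `K`; conversely those conditions at `l = 0` already force `A_d` to commute with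
`J`. So `K = K'` (`coe_orthogonalSubgroup`).

The vectors of `ℋ` are pairwise orthogonal of square `±1`, and there are `p + q` of them, so
positive definiteness bounds the two halves by `p` and `q` and makes both bounds equalities. On each
layer the positive and negative vectors carry either the block of `O(p_d)` or that of `O(q_d)`,
according to a sign alternating with `l`; reading the signs in order gives `𝐃_p` and `𝐃_q`, and `χ_p
χ_q` is the determinant. -/

noncomputable section

namespace SOpq
/-! ### Finite-dimensional representations of `𝔰𝔩₂` -/

section Sl2

variable {V : Type*} [AddCommGroup V] [Module ℝ V]

/-- The commutation relations of an `𝔰𝔩₂`-triple of endomorphisms. -/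
structure IsSl2Rel (e h f : Module.End ℝ V) : Prop where
  he : ∀ v, h (e v) = e (h v) + (2 : ℝ) • e v
  hf : ∀ v, h (f v) = f (h v) - (2 : ℝ) • f v
  ef : ∀ v, e (f v) = f (e v) + h v

variable {e h f : Module.End ℝ V}

namespace IsSl2Rel

theorem symm (t : IsSl2Rel e h f) : IsSl2Rel f (-h) e where
  he v := by simp [t.hf]; abel
  hf v := by simp [t.he]; abel
  ef v := by simp [t.ef]

theorem h_pow_e (t : IsSl2Rel e h f) (k : ℕ) (v : V) :
    h ((e ^ k) v) = (e ^ k) (h v) + (2 * k : ℝ) • (e ^ k) v := by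
  induction k with
  | zero => simp
  | succ k ih =>
    rw [pow_succ', Module.End.mul_apply, t.he, ih]
    simp only [Module.End.mul_apply, map_add, map_smul]
    push_cast
    module

theorem f_pow_e (t : IsSl2Rel e h f) (k : ℕ) (v : V) :
    f ((e ^ (k + 1)) v) =
      (e ^ (k + 1)) (f v) - (k + 1 : ℝ) • (e ^ k) (h v + (k : ℝ) • v) := by
  induction k with
  | zero => simp [t.ef]
  | succ k ih =>
    have h1 : f (e ((e ^ (k + 1)) v)) = e (f ((e ^ (k + 1)) v)) - h ((e ^ (k + 1)) v) := by
      rw [t.ef]; abel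
    rw [pow_succ', Module.End.mul_apply, h1, ih, t.h_pow_e]
    have h2 : ∀ w, e ((e ^ k) w) = (e ^ (k + 1)) w := fun w => by
      rw [pow_succ', Module.End.mul_apply]
    simp only [map_sub, map_smul, map_add, Module.End.mul_apply, h2]
    push_cast
    module

/-- For a lowest vector `u` of weight `1 - d`. -/
theorem f_pow_e_lowest (t : IsSl2Rel e h f) {d : ℝ} {u : V} (hf : f u = 0)
    (hu : h u = (1 - d) • u) (k : ℕ) :
    f ((e ^ (k + 1)) u) = ((k + 1) * (d - 1 - k) : ℝ) • (e ^ k) u := by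
  rw [t.f_pow_e, hf, hu]
  simp only [map_zero, map_add, map_smul]
  module

theorem h_pow_e_weight (t : IsSl2Rel e h f) {μ : ℝ} {u : V} (hu : h u = μ • u) (k : ℕ) :
    h ((e ^ k) u) = (μ + 2 * k) • (e ^ k) u := by
  rw [t.h_pow_e, hu, map_smul]; module

/-- The commutator with `h` multiplies `e ^ k` by `2k`. If no power vanished, it would have
infinitely many eigenvalues on the finite-dimensional algebra of endomorphisms. -/
theorem isNilpotent_e [FiniteDimensional ℝ V] (t : IsSl2Rel e h f) : IsNilpotent e := by
  let T : Module.End ℝ (Module.End ℝ V) :=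
    LinearMap.mulLeft ℝ h - LinearMap.mulRight ℝ h
  have hT : ∀ k : ℕ, T (e ^ k) = (2 * k : ℝ) • e ^ k := by
    intro k
    ext v
    simp [T, t.h_pow_e]
  by_contra hn
  have hk : ∀ k : ℕ, T.HasEigenvalue (2 * k : ℝ) := fun k =>
    Module.End.hasEigenvalue_of_hasEigenvector (x := e ^ k)
      ⟨Module.End.mem_eigenspace_iff.mpr (hT k), fun h0 => hn ⟨k, h0⟩⟩
  have hfin : (Set.range fun k : ℕ => (2 * k : ℝ)).Finite :=
    (Module.End.finite_hasEigenvalue T).subset (by rintro _ ⟨k, rfl⟩; exact hk k)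
  exact Set.infinite_range_of_injective
    (fun a b hab => by simpa using hab) hfin

theorem isNilpotent_f [FiniteDimensional ℝ V] (t : IsSl2Rel e h f) : IsNilpotent f :=
  t.symm.isNilpotent_e

end IsSl2Rel

/-- The operator `(h + 0)(h + 1)⋯(h + k - 1)`. -/
def risingProd (h : Module.End ℝ V) (k : ℕ) : Module.End ℝ V :=
  ((List.range k).map fun j => h + (j : ℝ) • (1 : Module.End ℝ V)).prod

theorem risingProd_succ (h : Module.End ℝ V) (k : ℕ) (v : V) :
    risingProd h (k + 1) v = risingProd h k (h v + (k : ℝ) • v) := by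
  simp [risingProd, List.range_succ]

/-- The factors `h + j` have distinct roots, so a vector of the `h`-stable space `K` killed by their
product is a sum of eigenvectors in `K`. The induction removes one factor at a time. -/
theorem mem_iSup_of_risingProd (K : Submodule ℝ V) (hK : ∀ v ∈ K, h v ∈ K) (k : ℕ) :
    ∀ v ∈ K, risingProd h k v = 0 →
      v ∈ ⨆ j ∈ Finset.range k, K ⊓ Module.End.eigenspace h (-(j : ℝ)) := by
  induction k with
  | zero => intro v _ hv; simpa [risingProd] using hv
  | succ k ih =>
    intro v hvK hv
    rw [risingProd_succ] at hv
    have h1 := ih _ (K.add_mem (hK v hvK) (K.smul_mem _ hvK)) hv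
    -- On the eigenspace of `-j` with `j < k`, the operator `h + k` is multiplication by `k - j ≠ 0`
    -- and can be inverted.
    have h2 : ∀ y ∈ ⨆ j ∈ Finset.range k, K ⊓ Module.End.eigenspace h (-(j : ℝ)),
        ∃ z ∈ ⨆ j ∈ Finset.range k, K ⊓ Module.End.eigenspace h (-(j : ℝ)),
          z ∈ K ∧ h z + (k : ℝ) • z = y := by
      intro y hy
      induction hy using Submodule.iSup_induction' with
      | mem j y hy =>
        by_cases hj : j ∈ Finset.range k
        · simp only [hj, iSup_pos] at hy
          have hne : (k : ℝ) - j ≠ 0 := by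
            rw [sub_ne_zero]; exact_mod_cast (Finset.mem_range.mp hj).ne'
          have hy2 := Module.End.mem_eigenspace_iff.mp hy.2
          refine ⟨((k : ℝ) - j)⁻¹ • y, ?_, K.smul_mem _ hy.1, ?_⟩
          · exact Submodule.smul_mem _ _ (Submodule.mem_iSup_of_mem j
              (Submodule.mem_iSup_of_mem hj hy))
          · rw [map_smul, hy2, smul_smul, smul_smul, ← add_smul]
            have : ((k : ℝ) - j)⁻¹ * -j + k * ((k : ℝ) - j)⁻¹ = 1 := by field_simp; ring
            rw [this, one_smul]
        · simp only [hj, not_false_eq_true, iSup_neg, Submodule.mem_bot] at hy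
          exact ⟨0, zero_mem _, zero_mem _, by simp [hy]⟩
      | zero => exact ⟨0, zero_mem _, zero_mem _, by simp⟩
      | add x y _ _ hx hy =>
        obtain ⟨a, ha, ha', hax⟩ := hx
        obtain ⟨b, hb, hb', hby⟩ := hy
        refine ⟨a + b, add_mem ha hb, add_mem ha' hb', ?_⟩
        rw [← hax, ← hby, map_add]; module
    obtain ⟨z, hz, hzK, hzv⟩ := h2 _ h1
    have hmono : (⨆ j ∈ Finset.range k, K ⊓ Module.End.eigenspace h (-(j : ℝ))) ≤
        ⨆ j ∈ Finset.range (k + 1), K ⊓ Module.End.eigenspace h (-(j : ℝ)) :=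
      biSup_mono fun j hj => by simp at hj ⊢; omega
    have h3 : v - z ∈ ⨆ j ∈ Finset.range (k + 1), K ⊓ Module.End.eigenspace h (-(j : ℝ)) := by
      refine Submodule.mem_iSup_of_mem k (Submodule.mem_iSup_of_mem (by simp) ⟨?_, ?_⟩)
      · exact K.sub_mem hvK hzK
      · rw [SetLike.mem_coe, Module.End.mem_eigenspace_iff, map_sub]
        have : h v = (h z + (k : ℝ) • z) - (k : ℝ) • v := by rw [hzv]; abel
        rw [this]; module
    have := add_mem h3 (hmono hz)
    rwa [sub_add_cancel] at this

/-- Lowest vectors of weight `1 - d`. -/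
def lowestWeight (h f : Module.End ℝ V) (d : ℕ) : Submodule ℝ V :=
  LinearMap.ker f ⊓ Module.End.eigenspace h (1 - d)

theorem mem_lowestWeight {d : ℕ} {v : V} :
    v ∈ lowestWeight h f d ↔ f v = 0 ∧ h v = (1 - d : ℝ) • v := by
  simp [lowestWeight]

namespace IsSl2Rel

theorem h_mem_ker_f (t : IsSl2Rel e h f) {v : V} (hv : f v = 0) : f (h v) = 0 := by
  have := t.hf v
  simp only [hv, map_zero, smul_zero, sub_zero] at this
  exact this.symm

/-- Moving one `f` through `e^(k+1)` on `ker f` produces the factor `-(k+1)(h + k)`, so the constant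
is `(-1)^k k!`. -/
theorem f_pow_e_pow (t : IsSl2Rel e h f) (k : ℕ) :
    ∃ c : ℝ, c ≠ 0 ∧ ∀ u, f u = 0 → (f ^ k) ((e ^ k) u) = c • risingProd h k u := by
  induction k with
  | zero => exact ⟨1, one_ne_zero, fun u _ => by simp [risingProd]⟩
  | succ k ih =>
    obtain ⟨c, hc, ih⟩ := ih
    refine ⟨-(k + 1) * c, mul_ne_zero (by
      rw [neg_ne_zero]; positivity) hc, fun u hu => ?_⟩
    rw [pow_succ f, Module.End.mul_apply, t.f_pow_e, hu, map_zero, zero_sub, map_neg, map_smul,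
      ih _ (by rw [map_add, map_smul, t.h_mem_ker_f hu, hu]; simp), risingProd_succ]
    module

variable [FiniteDimensional ℝ V]

/-- For large `k` the operator `f^k e^k` is zero, so on `ker f` the operator `h` is annihilated by a
polynomial with simple roots `0, -1, -2, …`. This is the source of diagonalisability and integrality
of lowest weights. -/
theorem exists_risingProd_eq_zero (t : IsSl2Rel e h f) :
    ∃ k, ∀ u, f u = 0 → risingProd h k u = 0 := by
  obtain ⟨k, hk⟩ := t.isNilpotent_e
  obtain ⟨c, hc, hck⟩ := t.f_pow_e_pow k
  refine ⟨k, fun u hu => ?_⟩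
  have := hck u hu
  rw [hk] at this
  simpa [hc] using this.symm

theorem ker_f_eq (t : IsSl2Rel e h f) :
    LinearMap.ker f = ⨆ d : ℕ, lowestWeight h f (d + 1) := by
  apply le_antisymm
  · intro u hu
    obtain ⟨k, hk⟩ := t.exists_risingProd_eq_zero
    have := mem_iSup_of_risingProd (h := h) (LinearMap.ker f)
      (fun v hv => t.h_mem_ker_f hv) k u hu (hk u hu)
    have hle : (⨆ j ∈ Finset.range k, LinearMap.ker f ⊓ Module.End.eigenspace h (-(j : ℝ))) ≤
        ⨆ d : ℕ, lowestWeight h f (d + 1) :=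
      iSup_mono fun j => iSup_le fun _ => by
        rw [lowestWeight]
        apply le_of_eq; congr 2; push_cast; ring
    exact hle this
  · exact iSup_le fun d => inf_le_left

/-- A non-zero `h`-stable space that meets the kernel of `f` contains a lowest weight vector. -/
theorem exists_lowest (t : IsSl2Rel e h f) (A : Submodule ℝ V) (hA : ∀ v ∈ A, h v ∈ A)
    {u : V} (hu : u ∈ A) (hfu : f u = 0) (h0 : u ≠ 0) :
    ∃ d : ℕ, ∃ w ∈ A, w ≠ 0 ∧ w ∈ lowestWeight h f (d + 1) := by
  obtain ⟨k, hk⟩ := t.exists_risingProd_eq_zero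
  have hK : ∀ v ∈ A ⊓ LinearMap.ker f, h v ∈ A ⊓ LinearMap.ker f := fun v hv =>
    ⟨hA v hv.1, t.h_mem_ker_f hv.2⟩
  have h1 := mem_iSup_of_risingProd (h := h) (A ⊓ LinearMap.ker f) hK k u ⟨hu, hfu⟩ (hk u hfu)
  by_contra hcon
  push Not at hcon
  have h2 : (⨆ j ∈ Finset.range k, (A ⊓ LinearMap.ker f) ⊓
      Module.End.eigenspace h (-(j : ℝ))) = ⊥ := by
    simp only [iSup_eq_bot]
    intro j _
    rw [Submodule.eq_bot_iff]
    intro x hx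
    by_contra hx0
    refine hcon j x hx.1.1 hx0 (mem_lowestWeight.mpr ⟨hx.1.2, ?_⟩)
    rw [Module.End.mem_eigenspace_iff.mp hx.2]; congr 1; push_cast; ring
  rw [h2] at h1
  exact h0 (by simpa using h1)

/-- The `μ`-eigenspace is `h`-stable and meets `ker f`, so it contains a lowest vector of some
weight `-d`, and that weight is `μ`. -/
theorem weight_nonpos (t : IsSl2Rel e h f) {u : V} {μ : ℝ} (hfu : f u = 0)
    (hu : h u = μ • u) (h0 : u ≠ 0) : μ ≤ 0 := by
  obtain ⟨d, w, hw, hw0, hwd⟩ := t.exists_lowest (Module.End.eigenspace h μ)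
    (fun v hv => by
      rw [Module.End.mem_eigenspace_iff] at hv ⊢
      rw [hv, map_smul, hv]) (Module.End.mem_eigenspace_iff.mpr hu) hfu h0
  have h1 := (mem_lowestWeight.mp hwd).2
  rw [Module.End.mem_eigenspace_iff.mp hw] at h1
  have := smul_left_injective ℝ hw0 h1
  rw [this]; push_cast; linarith [Nat.cast_nonneg (α := ℝ) d]

/-- `ker e` and the image of `f` meet trivially. -/
theorem f_eq_zero_of_e_f_eq_zero (t : IsSl2Rel e h f) {w : V} (hw : e (f w) = 0) : f w = 0 := by
  by_contra hne
  -- an eigenvector in `ker e ∩ im f`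
  obtain ⟨m, z, hz, hz0, hzm⟩ := t.symm.exists_lowest (LinearMap.range f)
    (by
      rintro _ ⟨v, rfl⟩
      refine ⟨-h v - (-(2 : ℝ)) • v, ?_⟩
      simp [t.hf]; abel) ⟨w, rfl⟩ hw hne
  obtain ⟨hez, hhz⟩ := mem_lowestWeight.mp hzm
  obtain ⟨w, rfl⟩ := hz
  -- A lowest vector of the opposite triple `(f, -h, e)` is a highest vector of the original one, of
  -- weight `m ≥ 0`.
  have hhz' : h (f w) = (m : ℝ) • f w := by
    have : -h (f w) = (1 - ((m + 1 : ℕ) : ℝ)) • f w := hhz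
    rw [← neg_neg (h (f w)), this]; push_cast; module
  -- correct `w` by an element of `ker f` to be an eigenvector
  let T : Module.End ℝ V := h - ((m : ℝ) + 2) • (1 : Module.End ℝ V)
  have hTK : ∀ v ∈ LinearMap.ker f, T v ∈ LinearMap.ker f := fun v hv => by
    have hv' : f v = 0 := hv
    simp [T, t.h_mem_ker_f hv', hv']
  -- By `weight_nonpos` the positive number `m + 2` is not a weight of `ker f`, so `h - (m + 2)` is
  -- invertible there.
  have hinj : Function.Injective (T.restrict hTK) := by
    rw [← LinearMap.ker_eq_bot, Submodule.eq_bot_iff]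
    rintro ⟨v, hv⟩ hv0
    have h1 : T v = 0 := congrArg Subtype.val hv0
    have h2 : h v = ((m : ℝ) + 2) • v := by simpa [T, sub_eq_zero] using h1
    by_contra hv1
    have := t.weight_nonpos hv h2 (fun h => hv1 (by simpa using h))
    linarith [Nat.cast_nonneg (α := ℝ) m]
  have hsurj := LinearMap.injective_iff_surjective.mp hinj
  have hTw : T w ∈ LinearMap.ker f := by
    have := t.hf w
    simp only [T, LinearMap.mem_ker, LinearMap.sub_apply, LinearMap.smul_apply,
      Module.End.one_apply, map_sub, map_smul]
    rw [hhz'] at this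
    have h3 : f (h w) = (m : ℝ) • f w + (2 : ℝ) • f w := by rw [this]; abel
    rw [h3]; module
  obtain ⟨⟨a, ha⟩, haw⟩ := hsurj ⟨T w, hTw⟩
  have haw' : T a = T w := congrArg Subtype.val haw
  have ha' : f a = 0 := ha
  set x := w - a with hx
  have hfx : f x = f w := by simp [hx, ha']
  have hhx : h x = ((m : ℝ) + 2) • x := by
    have : T x = 0 := by simp [hx, haw']
    simpa [T, sub_eq_zero] using this
  have hx0 : x ≠ 0 := fun h => hz0 (by rw [← hfx, h, map_zero])
  -- Since `e (f x) = 0`, the commutation formula gives `f (e^(k+1) x) = -(k+1)(m+2+k) e^k x` with a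
  -- non-zero coefficient, so no power kills `x`, against nilpotency of `e`.
  have hpow : ∀ k, (e ^ k) x ≠ 0 := by
    intro k
    induction k with
    | zero => simpa using hx0
    | succ k ih =>
      intro h0
      have := t.f_pow_e k x
      rw [h0, pow_succ e, Module.End.mul_apply, hfx, hez, map_zero, map_zero, hhx, zero_sub,
        ← add_smul, map_smul, smul_smul, eq_comm, neg_eq_zero, smul_eq_zero] at this
      rcases this with h | h
      · have : (0 : ℝ) < (k + 1) * (m + 2 + k) := by positivity
        exact this.ne' h
      · exact ih h
  obtain ⟨k, hk⟩ := t.isNilpotent_e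
  exact hpow k (by rw [hk]; rfl)

/-- The vector `e^d u` has weight `1 + d > 0`, and `f` kills it because the coefficient of
`f_pow_e_lowest` vanishes at the end of the string; `weight_nonpos` excludes such a vector unless it
is zero. -/
theorem e_pow_eq_zero (t : IsSl2Rel e h f) {d : ℕ} {u : V}
    (hu : u ∈ lowestWeight h f d) : (e ^ d) u = 0 := by
  obtain ⟨hfu, hhu⟩ := mem_lowestWeight.mp hu
  by_contra h0
  cases d with
  | zero =>
    have := t.weight_nonpos hfu hhu (by simpa using h0)
    norm_num at this
  | succ d =>
    have h1 := t.f_pow_e_lowest hfu hhu d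
    rw [show (((d + 1 : ℕ) : ℝ) - 1 - d) = 0 by push_cast; ring, mul_zero, zero_smul] at h1
    have h2 := t.weight_nonpos h1 (t.h_pow_e_weight hhu (d + 1)) h0
    push_cast at h2
    linarith [Nat.cast_nonneg (α := ℝ) d]

theorem lowestWeight_zero (t : IsSl2Rel e h f) : lowestWeight h f 0 = ⊥ := by
  rw [Submodule.eq_bot_iff]
  intro u hu
  simpa using t.e_pow_eq_zero hu

/-- Complete reducibility: `V` is spanned by the strings `e^l u` of lowest weight vectors `u`. -/
theorem iSup_map_lowestWeight (t : IsSl2Rel e h f) :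
    (⨆ d : ℕ, ⨆ l ∈ Finset.range d, (lowestWeight h f d).map (e ^ l)) = ⊤ := by
  set S := ⨆ d : ℕ, ⨆ l ∈ Finset.range d, (lowestWeight h f d).map (e ^ l) with hS
  have hmem : ∀ d l u, l < d → u ∈ lowestWeight h f d → (e ^ l) u ∈ S := fun d l u hl hu =>
    Submodule.mem_iSup_of_mem d (Submodule.mem_iSup_of_mem l
      (Submodule.mem_iSup_of_mem (Finset.mem_range.mpr hl) ⟨u, hu, rfl⟩))
  have hker : LinearMap.ker f ≤ S := by
    rw [t.ker_f_eq]
    refine iSup_le fun d u hu => ?_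
    simpa using hmem (d + 1) 0 u (by omega) hu
  -- Modulo `ker e` every element of `S` is `f` of an element of `S`: below the top of a string,
  -- `e^l u` is a multiple of `f (e^(l+1) u)`; the top vector is killed by `e`.
  have hlift : ∀ y ∈ S, ∃ s ∈ S, e (y - f s) = 0 := by
    intro y hy
    rw [hS] at hy
    induction hy using Submodule.iSup_induction' with
    | mem d y hy =>
      induction hy using Submodule.iSup_induction' with
      | mem l y hy =>
        by_cases hl : l ∈ Finset.range d
        · simp only [hl, iSup_pos] at hy
          obtain ⟨u, hu, rfl⟩ := hy
          rw [Finset.mem_range] at hl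
          obtain ⟨hfu, hhu⟩ := mem_lowestWeight.mp hu
          by_cases hl' : l + 1 = d
          · refine ⟨0, zero_mem _, ?_⟩
            rw [map_zero, sub_zero, ← Module.End.mul_apply, ← pow_succ', hl',
              t.e_pow_eq_zero hu]
          · have hlt : l + 1 < d := by omega
            have hc : (((l : ℝ) + 1) * (d - 1 - l)) ≠ 0 := by
              have : ((l + 1 : ℕ) : ℝ) < d := by exact_mod_cast hlt
              push_cast at this
              refine mul_ne_zero (by positivity) (by linarith)
            refine ⟨(((l : ℝ) + 1) * (d - 1 - l))⁻¹ • (e ^ (l + 1)) u,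
              S.smul_mem _ (hmem d (l + 1) u hlt hu), ?_⟩
            rw [map_smul, t.f_pow_e_lowest hfu hhu, smul_smul, inv_mul_cancel₀ hc, one_smul,
              sub_self, map_zero]
        · simp only [hl, not_false_eq_true, iSup_neg, Submodule.mem_bot] at hy
          exact ⟨0, zero_mem _, by simp [hy]⟩
      | zero => exact ⟨0, zero_mem _, by simp⟩
      | add x y _ _ hx hy =>
        obtain ⟨a, ha, hax⟩ := hx
        obtain ⟨b, hb, hby⟩ := hy
        refine ⟨a + b, add_mem ha hb, ?_⟩
        rw [map_add, add_sub_add_comm, map_add, hax, hby, add_zero]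
    | zero => exact ⟨0, zero_mem _, by simp⟩
    | add x y _ _ hx hy =>
      obtain ⟨a, ha, hax⟩ := hx
      obtain ⟨b, hb, hby⟩ := hy
      refine ⟨a + b, add_mem ha hb, ?_⟩
      rw [map_add, add_sub_add_comm, map_add, hax, hby, add_zero]
  -- If `f w ∈ S`, choose `s ∈ S` with `f w - f s ∈ ker e`. As `ker e` and the image of `f` meet
  -- trivially, `w - s ∈ ker f ≤ S`. Nilpotency of `f` makes this induction reach every vector.
  have hall : ∀ k : ℕ, ∀ w, (f ^ k) w = 0 → w ∈ S := by
    intro k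
    induction k with
    | zero => intro w hw; have : w = 0 := by simpa using hw
              rw [this]; exact zero_mem _
    | succ k ih =>
      intro w hw
      rw [pow_succ, Module.End.mul_apply] at hw
      obtain ⟨s, hs, hes⟩ := hlift _ (ih _ hw)
      have h1 : f (w - s) = 0 := t.f_eq_zero_of_e_f_eq_zero (by rw [map_sub]; exact hes)
      have := add_mem (hker (show w - s ∈ LinearMap.ker f from h1)) hs
      rwa [sub_add_cancel] at this
  obtain ⟨k, hk⟩ := t.isNilpotent_f
  exact Submodule.eq_top_iff'.mpr fun w => hall k w (by rw [hk]; rfl)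

end IsSl2Rel
end Sl2
end SOpq

/-! ### Irreducible submodules as strings through lowest weight vectors -/

namespace SOpq
section Sl2Irreducible

variable {V : Type*} [AddCommGroup V] [Module ℝ V] {e h f : Module.End ℝ V}

/-- `A` is stable under `e`, `h` and `f`. -/
def IsStable (e h f : Module.End ℝ V) (A : Submodule ℝ V) : Prop :=
  ∀ v ∈ A, e v ∈ A ∧ h v ∈ A ∧ f v ∈ A

/-- `A` is a non-zero irreducible submodule. -/
def IsIrreducibleStable (e h f : Module.End ℝ V) (A : Submodule ℝ V) : Prop :=
  IsStable e h f A ∧ A ≠ ⊥ ∧ ∀ B, IsStable e h f B → B ≤ A → B = ⊥ ∨ B = A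

/-- The map `(a_l) ↦ ∑ e^l a_l`. -/
def stringMap (e : Module.End ℝ V) (d : ℕ) (N : Submodule ℝ V) : (Fin d → N) →ₗ[ℝ] V :=
  ∑ l : Fin d, (e ^ (l : ℕ)) ∘ₗ N.subtype ∘ₗ LinearMap.proj l

theorem stringMap_apply (d : ℕ) (N : Submodule ℝ V) (a : Fin d → N) :
    stringMap e d N a = ∑ l : Fin d, (e ^ (l : ℕ)) (a l : V) := by
  simp [stringMap]

theorem pow_mem_range_stringMap {d : ℕ} {N : Submodule ℝ V} {u : V} (hu : u ∈ N) {l : ℕ}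
    (hl : l < d) : (e ^ l) u ∈ LinearMap.range (stringMap e d N) := by
  refine ⟨Pi.single ⟨l, hl⟩ ⟨u, hu⟩, ?_⟩
  rw [stringMap_apply, Finset.sum_eq_single ⟨l, hl⟩]
  · simp
  · intro b _ hb; simp [Pi.single_eq_of_ne hb]
  · simp

theorem range_stringMap_le {d : ℕ} {N A : Submodule ℝ V}
    (hA : ∀ u ∈ N, ∀ l < d, (e ^ l) u ∈ A) : LinearMap.range (stringMap e d N) ≤ A := by
  rintro _ ⟨a, rfl⟩
  rw [stringMap_apply]
  exact A.sum_mem fun l _ => hA _ (a l).2 _ l.2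

namespace IsSl2Rel

theorem f_pow_e_pow_lowest (t : IsSl2Rel e h f) {d : ℕ} {u : V}
    (hu : u ∈ lowestWeight h f d) {l : ℕ} (hl : l < d) :
    ∃ c : ℝ, c ≠ 0 ∧ (f ^ l) ((e ^ l) u) = c • u := by
  obtain ⟨hfu, hhu⟩ := mem_lowestWeight.mp hu
  induction l with
  | zero => exact ⟨1, one_ne_zero, by simp⟩
  | succ l ih =>
    obtain ⟨c, hc, hcu⟩ := ih (by omega)
    refine ⟨((l + 1) * (d - 1 - l) : ℝ) * c, mul_ne_zero ?_ hc, ?_⟩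
    · have : ((l + 1 : ℕ) : ℝ) < d := by exact_mod_cast hl
      push_cast at this
      exact mul_ne_zero (by positivity) (by linarith)
    · rw [pow_succ f, Module.End.mul_apply, t.f_pow_e_lowest hfu hhu, map_smul, hcu, smul_smul]

theorem e_pow_injOn (t : IsSl2Rel e h f) {d : ℕ} {u : V}
    (hu : u ∈ lowestWeight h f d) {l : ℕ} (hl : l < d) (h0 : (e ^ l) u = 0) : u = 0 := by
  obtain ⟨c, hc, hcu⟩ := t.f_pow_e_pow_lowest hu hl
  rw [h0, map_zero, eq_comm, smul_eq_zero] at hcu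
  exact hcu.resolve_left hc

variable [FiniteDimensional ℝ V]

theorem e_pow_eq_zero_of_le (t : IsSl2Rel e h f) {d : ℕ} {u : V}
    (hu : u ∈ lowestWeight h f d) {l : ℕ} (hl : d ≤ l) : (e ^ l) u = 0 := by
  rw [← Nat.sub_add_cancel hl, pow_add, Module.End.mul_apply, t.e_pow_eq_zero hu, map_zero]

/-- Applying `e^(d-1-l)` kills the terms above `l`, the terms below `l` vanish by induction, and
`e^(d-1)` is injective on lowest vectors of weight `1 - d`. -/
theorem sum_pow_eq_zero (t : IsSl2Rel e h f) {d : ℕ} {a : ℕ → V}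
    (ha : ∀ l, a l ∈ lowestWeight h f d) (h0 : ∑ l ∈ Finset.range d, (e ^ l) (a l) = 0) :
    ∀ l < d, a l = 0 := by
  intro l
  induction l using Nat.strong_induction_on with
  | _ l ih =>
    intro hl
    have h1 := congrArg (e ^ (d - 1 - l)) h0
    rw [map_zero, map_sum, Finset.sum_eq_single l] at h1
    · rw [← Module.End.mul_apply, ← pow_add] at h1
      exact t.e_pow_injOn (ha l) (by omega) h1
    · intro b hb hbl
      rw [Finset.mem_range] at hb
      rcases lt_or_gt_of_ne hbl with h | h
      · rw [ih b h hb]; simp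
      · rw [← Module.End.mul_apply, ← pow_add]
        exact t.e_pow_eq_zero_of_le (ha b) (by omega)
    · intro h; simp at h; omega

theorem stringMap_injective (t : IsSl2Rel e h f) {d : ℕ} {N : Submodule ℝ V}
    (hN : N ≤ lowestWeight h f d) : Function.Injective (stringMap e d N) := by
  rw [← LinearMap.ker_eq_bot, Submodule.eq_bot_iff]
  intro a ha
  rw [LinearMap.mem_ker, stringMap_apply] at ha
  let a' : ℕ → V := fun l => if hl : l < d then (a ⟨l, hl⟩ : V) else 0
  have h1 : ∑ l ∈ Finset.range d, (e ^ l) (a' l) = 0 := by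
    rw [Finset.sum_range, ← ha]
    exact Finset.sum_congr rfl fun l _ => by simp [a']
  have h2 := t.sum_pow_eq_zero (a := a') (fun l => by
    by_cases hl : l < d
    · simpa [a', hl] using hN (a ⟨l, hl⟩).2
    · simp [a', hl]) h1
  ext l
  simpa [a'] using h2 l l.2

/-- The operator `f` lowers each layer above the bottom by a non-zero factor, so `f x = 0` and the
independence of the layers leave only the bottom component of `x`. -/
theorem mem_of_mem_range_stringMap (t : IsSl2Rel e h f) {d : ℕ} {N : Submodule ℝ V}
    (hN : N ≤ lowestWeight h f d) {x : V} (hx : x ∈ LinearMap.range (stringMap e d N))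
    (hfx : f x = 0) : x ∈ N := by
  obtain ⟨a, rfl⟩ := hx
  rw [stringMap_apply] at hfx ⊢
  cases d with
  | zero => simp
  | succ d =>
    rw [Fin.sum_univ_succ] at hfx ⊢
    have hlow : ∀ l, f ((e ^ (l + 1)) (if hl : l + 1 < d + 1 then (a ⟨l + 1, hl⟩ : V) else 0)) =
        (e ^ l) (((l + 1) * (((d + 1 : ℕ) : ℝ) - 1 - l) : ℝ) •
          (if hl : l + 1 < d + 1 then (a ⟨l + 1, hl⟩ : V) else 0)) := by
      intro l
      split_ifs with hl
      · obtain ⟨h1, h2⟩ := mem_lowestWeight.mp (hN (a ⟨l + 1, hl⟩).2)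
        rw [t.f_pow_e_lowest h1 h2, map_smul]
      · simp
    have h0 := t.sum_pow_eq_zero (d := d + 1)
      (a := fun l => ((l + 1) * (((d + 1 : ℕ) : ℝ) - 1 - l) : ℝ) •
          (if hl : l + 1 < d + 1 then (a ⟨l + 1, hl⟩ : V) else 0))
      (fun l => Submodule.smul_mem _ _ (by
        split_ifs with hl
        · exact hN (a ⟨l + 1, hl⟩).2
        · exact zero_mem _)) (by
        rw [Finset.sum_range_succ]
        simp only [← hlow]
        rw [map_add] at hfx
        simp only [Fin.val_zero, pow_zero, Module.End.one_apply] at hfx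
        rw [(mem_lowestWeight.mp (hN (a 0).2)).1, zero_add, map_sum] at hfx
        rw [Finset.sum_range]
        refine Eq.trans ?_ hfx
        simp [Fin.succ])
    have hz : ∀ l : Fin d, (a l.succ : V) = 0 := by
      intro l
      have := h0 l (by omega)
      rw [smul_eq_zero] at this
      rcases this with h | h
      · exfalso
        have : ((l : ℕ) : ℝ) + 1 ≤ d := by exact_mod_cast l.2
        push_cast at h
        have h3 : (0 : ℝ) < ((l : ℕ) + 1) * (d + 1 - 1 - (l : ℕ)) :=
          mul_pos (by positivity) (by linarith)
        exact h3.ne' h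
      · simpa [Fin.succ] using h
    simp [hz]

theorem isStable_range_stringMap (t : IsSl2Rel e h f) {d : ℕ} {N : Submodule ℝ V}
    (hN : N ≤ lowestWeight h f d) : IsStable e h f (LinearMap.range (stringMap e d N)) := by
  have key : ∀ u ∈ N, ∀ l : ℕ, (e ^ l) u ∈ LinearMap.range (stringMap e d N) := by
    intro u hu l
    rcases lt_or_ge l d with hl | hl
    · exact pow_mem_range_stringMap hu hl
    · rw [t.e_pow_eq_zero_of_le (hN hu) hl]; exact zero_mem _
  rintro _ ⟨a, rfl⟩
  rw [stringMap_apply, map_sum, map_sum, map_sum]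
  refine ⟨Submodule.sum_mem _ fun l _ => ?_, Submodule.sum_mem _ fun l _ => ?_,
    Submodule.sum_mem _ fun l _ => ?_⟩
  · rw [← Module.End.mul_apply, ← pow_succ']
    exact key _ (a l).2 _
  · rw [t.h_pow_e_weight (mem_lowestWeight.mp (hN (a l).2)).2]
    exact Submodule.smul_mem _ _ (key _ (a l).2 _)
  · obtain ⟨h1, h2⟩ := mem_lowestWeight.mp (hN (a l).2)
    rcases hl : (l : ℕ) with _ | k
    · simp [h1]
    · rw [t.f_pow_e_lowest h1 h2]
      exact Submodule.smul_mem _ _ (key _ (a l).2 _)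

theorem finrank_range_stringMap (t : IsSl2Rel e h f) {d : ℕ} {N : Submodule ℝ V}
    (hN : N ≤ lowestWeight h f d) :
    Module.finrank ℝ (LinearMap.range (stringMap e d N)) = d * Module.finrank ℝ N := by
  rw [LinearMap.finrank_range_of_inj (t.stringMap_injective hN), Module.finrank_pi_fintype]
  simp

theorem exists_mem_ker_f (t : IsSl2Rel e h f) {A : Submodule ℝ V} (hA : ∀ v ∈ A, f v ∈ A)
    (h0 : A ≠ ⊥) : ∃ v ∈ A, v ≠ 0 ∧ f v = 0 := by
  obtain ⟨v, hv, hv0⟩ := Submodule.exists_mem_ne_zero_of_ne_bot h0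
  obtain ⟨k, hk⟩ := t.isNilpotent_f
  replace hk : (f ^ k) v = 0 := by rw [hk]; rfl
  clear h0
  induction k generalizing v with
  | zero => exact absurd (by simpa using hk) hv0
  | succ k ih =>
    by_cases hfv : f v = 0
    · exact ⟨v, hv, hv0, hfv⟩
    · exact ih (f v) (hA v hv) hfv (by rwa [pow_succ, Module.End.mul_apply] at hk)

/-- A non-zero submodule contains a non-zero vector killed by `f`. In this string such a vector is a
multiple of `w`, and `w` generates the string. -/
theorem isIrreducible_string (t : IsSl2Rel e h f) {d : ℕ} {w : V}
    (hw : w ∈ lowestWeight h f d) (hw0 : w ≠ 0) :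
    IsIrreducibleStable e h f (LinearMap.range (stringMap e d (ℝ ∙ w))) := by
  have hN : (ℝ ∙ w) ≤ lowestWeight h f d := by
    rwa [Submodule.span_singleton_le_iff_mem]
  have hd : 0 < d := by
    rcases Nat.eq_zero_or_pos d with rfl | hd
    · rw [t.lowestWeight_zero] at hw; exact absurd (by simpa using hw) hw0
    · exact hd
  refine ⟨t.isStable_range_stringMap hN, ?_, ?_⟩
  · rw [Submodule.ne_bot_iff]
    have hw' : (e ^ 0) w ∈ _ :=
      pow_mem_range_stringMap (e := e) (Submodule.mem_span_singleton_self (R := ℝ) w) hd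
    exact ⟨w, hw', hw0⟩
  · intro B hB hBle
    by_cases hB0 : B = ⊥
    · exact Or.inl hB0
    · refine Or.inr (le_antisymm hBle ?_)
      obtain ⟨v, hv, hv0, hfv⟩ := t.exists_mem_ker_f (fun v hv => (hB v hv).2.2) hB0
      have h1 := t.mem_of_mem_range_stringMap hN (hBle hv) hfv
      obtain ⟨c, rfl⟩ := Submodule.mem_span_singleton.mp h1
      have hc : c ≠ 0 := fun h => hv0 (by simp [h])
      have hwB : w ∈ B := by
        have := B.smul_mem c⁻¹ hv
        rwa [smul_smul, inv_mul_cancel₀ hc, one_smul] at this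
      refine range_stringMap_le fun u hu l hl => ?_
      obtain ⟨c, rfl⟩ := Submodule.mem_span_singleton.mp hu
      rw [map_smul]
      refine B.smul_mem _ ?_
      clear hl
      induction l with
      | zero => simpa using hwB
      | succ l ih =>
        rw [pow_succ', Module.End.mul_apply]
        exact (hB _ ih).1

/-- The irreducible submodules are the strings through lowest weight vectors. -/
theorem exists_string_of_isIrreducible (t : IsSl2Rel e h f) {A : Submodule ℝ V}
    (hA : IsIrreducibleStable e h f A) :
    ∃ w ∈ lowestWeight h f (Module.finrank ℝ A), w ≠ 0 ∧
      A = LinearMap.range (stringMap e (Module.finrank ℝ A) (ℝ ∙ w)) := by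
  obtain ⟨hs, h0, hirr⟩ := hA
  obtain ⟨v, hv, hv0, hfv⟩ := t.exists_mem_ker_f (fun v hv => (hs v hv).2.2) h0
  obtain ⟨n, w, hwA, hw0, hw⟩ := t.exists_lowest A (fun v hv => (hs v hv).2.1) hv hfv hv0
  have hN : (ℝ ∙ w) ≤ lowestWeight h f (n + 1) := by
    rwa [Submodule.span_singleton_le_iff_mem]
  have hle : LinearMap.range (stringMap e (n + 1) (ℝ ∙ w)) ≤ A := by
    refine range_stringMap_le fun u hu l _ => ?_
    have huA : u ∈ A := (Submodule.span_singleton_le_iff_mem w A).mpr hwA hu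
    clear hu
    induction l with
    | zero => simpa using huA
    | succ l ih =>
      rw [pow_succ', Module.End.mul_apply]
      exact (hs _ (ih (by omega))).1
  have heq := (hirr _ (t.isStable_range_stringMap hN) hle).resolve_left
    (t.isIrreducible_string hw hw0).2.1
  have hfr : Module.finrank ℝ A = n + 1 := by
    rw [← heq, t.finrank_range_stringMap hN, finrank_span_singleton hw0, mul_one]
  rw [hfr]
  exact ⟨w, hw, hw0, heq.symm⟩

theorem sSup_irreducible (t : IsSl2Rel e h f) (d : ℕ) :
    sSup {A | IsIrreducibleStable e h f A ∧ Module.finrank ℝ A = d} =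
      LinearMap.range (stringMap e d (lowestWeight h f d)) := by
  apply le_antisymm
  · refine sSup_le ?_
    rintro A ⟨hA, rfl⟩
    obtain ⟨w, hw, hw0, hAw⟩ := t.exists_string_of_isIrreducible hA
    conv_lhs => rw [hAw]
    exact range_stringMap_le fun u hu l hl => pow_mem_range_stringMap
      ((Submodule.span_singleton_le_iff_mem w _).mpr hw hu) hl
  · refine range_stringMap_le fun u hu l hl => ?_
    by_cases hu0 : u = 0
    · rw [hu0, map_zero]; exact zero_mem _
    · have hfr : Module.finrank ℝ (LinearMap.range (stringMap e d (ℝ ∙ u))) = d := by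
        rw [t.finrank_range_stringMap (by rwa [Submodule.span_singleton_le_iff_mem]),
          finrank_span_singleton hu0, mul_one]
      have hirr : LinearMap.range (stringMap e d (ℝ ∙ u)) ∈
          {A | IsIrreducibleStable e h f A ∧ Module.finrank ℝ A = d} :=
        ⟨t.isIrreducible_string hu hu0, hfr⟩
      exact Submodule.mem_sSup_of_mem hirr
        (pow_mem_range_stringMap (Submodule.mem_span_singleton_self u) hl)

/-- This turns the definition of `L(d-1)` through irreducible submodules into equations: being
killed by `f` and having weight `1 - d`. -/
theorem ker_inf_sSup_irreducible (t : IsSl2Rel e h f) (d : ℕ) :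
    LinearMap.ker f ⊓ sSup {A | IsIrreducibleStable e h f A ∧ Module.finrank ℝ A = d} =
      lowestWeight h f d := by
  rw [t.sSup_irreducible]
  apply le_antisymm
  · rintro x ⟨hx, hx'⟩
    exact t.mem_of_mem_range_stringMap le_rfl hx' hx
  · intro x hx
    refine ⟨(mem_lowestWeight.mp hx).1, ?_⟩
    rcases Nat.eq_zero_or_pos d with rfl | hd
    · rw [t.lowestWeight_zero] at hx
      rw [(Submodule.mem_bot ℝ).mp hx]; exact zero_mem _
    · exact pow_mem_range_stringMap (e := e) (l := 0) hx hd

theorem exists_irreducible_iff (t : IsSl2Rel e h f) (d : ℕ) :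
    (∃ A, IsIrreducibleStable e h f A ∧ Module.finrank ℝ A = d) ↔ lowestWeight h f d ≠ ⊥ := by
  constructor
  · rintro ⟨A, hA, rfl⟩
    obtain ⟨w, hw, hw0, -⟩ := t.exists_string_of_isIrreducible hA
    exact (Submodule.ne_bot_iff _).mpr ⟨w, hw, hw0⟩
  · intro h0
    obtain ⟨w, hw, hw0⟩ := Submodule.exists_mem_ne_zero_of_ne_bot h0
    refine ⟨_, t.isIrreducible_string hw hw0, ?_⟩
    rw [t.finrank_range_stringMap (by rwa [Submodule.span_singleton_le_iff_mem]),
      finrank_span_singleton hw0, mul_one]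

end IsSl2Rel
end Sl2Irreducible
end SOpq

/-! ### The form of signature (p, q) and its invariance -/

namespace SOpq
section Form

variable {p q : ℕ}

theorem Ipq_eq (p q : ℕ) : Ipq p q = Matrix.diagonal (Sum.elim (fun _ => 1) fun _ => -1) := rfl

theorem Ipq_transpose : (Ipq p q)ᵀ = Ipq p q := by
  rw [Ipq_eq, Matrix.diagonal_transpose]

theorem Ipq_mul_self : Ipq p q * Ipq p q = 1 := by
  rw [Ipq_eq, Matrix.diagonal_mul_diagonal, ← Matrix.diagonal_one]
  congr 1
  ext (i | i) <;> simp

theorem form_comm (x y : Vec p q) : form x y = form y x := by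
  rw [form, form, Matrix.dotProduct_mulVec, ← Matrix.mulVec_transpose, Ipq_transpose,
    dotProduct_comm]

theorem form_add_left (x y z : Vec p q) : form (x + y) z = form x z + form y z := by
  simp [form, add_dotProduct]

theorem form_sub_left (x y z : Vec p q) : form (x - y) z = form x z - form y z := by
  simp [form, sub_dotProduct]

theorem form_smul_left (c : ℝ) (x z : Vec p q) : form (c • x) z = c * form x z := by
  simp [form, smul_dotProduct]

theorem form_zero_left (z : Vec p q) : form 0 z = 0 := by
  simp [form]

theorem form_sum_left {ι : Type*} (s : Finset ι) (x : ι → Vec p q) (z : Vec p q) :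
    form (∑ i ∈ s, x i) z = ∑ i ∈ s, form (x i) z := by
  simp [form, sum_dotProduct]

theorem form_add_right (x y z : Vec p q) : form z (x + y) = form z x + form z y := by
  simp [form_comm z, form_add_left]

theorem form_sub_right (x y z : Vec p q) : form z (x - y) = form z x - form z y := by
  simp [form_comm z, form_sub_left]

theorem form_smul_right (c : ℝ) (x z : Vec p q) : form z (c • x) = c * form z x := by
  simp [form_comm z, form_smul_left]

theorem form_zero_right (z : Vec p q) : form z 0 = 0 := by
  simp [form_comm z, form_zero_left]

theorem form_sum_right {ι : Type*} (s : Finset ι) (x : ι → Vec p q) (z : Vec p q) :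
    form z (∑ i ∈ s, x i) = ∑ i ∈ s, form z (x i) := by
  simp [form_comm z, form_sum_left]

theorem form_nondegenerate {x : Vec p q} (hx : ∀ y, form x y = 0) : x = 0 := by
  have h : Ipq p q *ᵥ x = 0 := by
    ext i
    have := hx (Pi.single i 1)
    rwa [form_comm, form, single_one_dotProduct] at this
  rw [← Matrix.one_mulVec x, ← Ipq_mul_self, ← Matrix.mulVec_mulVec, h, Matrix.mulVec_zero]

/-- The form is determined by its values on pairs of basis vectors. -/
theorem mem_SO_iff (g : SL p q) :
    g ∈ SO p q ↔ ∀ x y, form ((g : Matrix (Idx p q) (Idx p q) ℝ) *ᵥ x)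
      ((g : Matrix (Idx p q) (Idx p q) ℝ) *ᵥ y) = form x y := by
  have key : ∀ x y, form ((g : Matrix (Idx p q) (Idx p q) ℝ) *ᵥ x)
      ((g : Matrix (Idx p q) (Idx p q) ℝ) *ᵥ y) =
      x ⬝ᵥ (((g : Matrix (Idx p q) (Idx p q) ℝ)ᵀ * Ipq p q *
        (g : Matrix (Idx p q) (Idx p q) ℝ)) *ᵥ y) := by
    intro x y
    rw [form, ← Matrix.mulVec_mulVec, ← Matrix.mulVec_mulVec, Matrix.dotProduct_mulVec,
      Matrix.dotProduct_mulVec, Matrix.dotProduct_mulVec, Matrix.vecMul_transpose,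
      ← Matrix.dotProduct_mulVec, ← Matrix.dotProduct_mulVec]
  constructor
  · intro hg x y
    rw [key, show _ = _ from hg]; rfl
  · intro hg
    change (g : Matrix (Idx p q) (Idx p q) ℝ)ᵀ * Ipq p q * g = Ipq p q
    ext i j
    have := hg (Pi.single i 1) (Pi.single j 1)
    rw [key, form] at this
    simpa using this

theorem form_so_left (Z : so p q) (x y : Vec p q) :
    form ((Z : Matrix (Idx p q) (Idx p q) ℝ) *ᵥ x) y =
      -form x ((Z : Matrix (Idx p q) (Idx p q) ℝ) *ᵥ y) := by
  have hZ : (Z : Matrix (Idx p q) (Idx p q) ℝ)ᵀ * Ipq p q =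
      Ipq p q * -(Z : Matrix (Idx p q) (Idx p q) ℝ) := by
    have := Z.2
    simpa [so, LieAlgebra.Orthogonal.so', mem_skewAdjointMatricesLieSubalgebra,
      Matrix.IsSkewAdjoint, Matrix.IsAdjointPair] using this
  rw [form, form, Matrix.mulVec_mulVec, Matrix.dotProduct_mulVec, ← Matrix.vecMul_transpose,
    Matrix.vecMul_vecMul, hZ, ← Matrix.dotProduct_mulVec]
  simp [Matrix.neg_mulVec]

end Form

/-! ### Pairing of strings under the form -/

section TripleFacts

variable {p q : ℕ} {X H Y : so p q}

theorem powApply_eq (l : ℕ) (v : Vec p q) :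
    powApply X l v = ((X : Matrix (Idx p q) (Idx p q) ℝ).mulVecLin ^ l) v := by
  induction l with
  | zero => simp [powApply]
  | succ l ih =>
    rw [pow_succ', Module.End.mul_apply, ← ih, powApply, powApply, pow_succ',
      Matrix.mulVecLin_apply, Matrix.mulVec_mulVec]

theorem powApply_powApply (k l : ℕ) (v : Vec p q) :
    powApply X k (powApply X l v) = powApply X (k + l) v := by
  simp [powApply, pow_add]

theorem isSl2Rel (hXHY : IsSl2Triple H X Y) :
    IsSl2Rel (X : Matrix (Idx p q) (Idx p q) ℝ).mulVecLin
      (H : Matrix (Idx p q) (Idx p q) ℝ).mulVecLin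
      (Y : Matrix (Idx p q) (Idx p q) ℝ).mulVecLin := by
  have h1 : (H : Matrix (Idx p q) (Idx p q) ℝ) * X - X * H = (2 : ℝ) • X := by
    have := congrArg (Subtype.val) hXHY.lie_h_e_nsmul
    rw [two_smul]
    simpa [two_smul, Ring.lie_def] using this
  have h2 : (H : Matrix (Idx p q) (Idx p q) ℝ) * Y - Y * H = -((2 : ℝ) • Y) := by
    have := congrArg (Subtype.val) hXHY.lie_h_f_nsmul
    rw [two_smul]
    simpa [two_smul, Ring.lie_def] using this
  have h3 : (X : Matrix (Idx p q) (Idx p q) ℝ) * Y - Y * X = H := by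
    have := congrArg (Subtype.val) hXHY.lie_e_f
    simpa [Ring.lie_def] using this
  constructor
  · intro v
    simp only [Matrix.mulVecLin_apply, Matrix.mulVec_mulVec]
    rw [← Matrix.smul_mulVec, ← Matrix.add_mulVec, ← h1]; congr 1; abel
  · intro v
    simp only [Matrix.mulVecLin_apply, Matrix.mulVec_mulVec]
    rw [← Matrix.smul_mulVec, ← Matrix.sub_mulVec, sub_eq_add_neg, ← h2]; congr 1; abel
  · intro v
    simp only [Matrix.mulVecLin_apply, Matrix.mulVec_mulVec]
    rw [← Matrix.add_mulVec, ← h3]; congr 1; abel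

theorem isIrred_iff (A : Submodule ℝ (Vec p q)) :
    IsIrred X H Y A ↔ IsIrreducibleStable (X : Matrix (Idx p q) (Idx p q) ℝ).mulVecLin
      (H : Matrix (Idx p q) (Idx p q) ℝ).mulVecLin
      (Y : Matrix (Idx p q) (Idx p q) ℝ).mulVecLin A := by
  have hs : ∀ A, IsSubmod X H Y A ↔ IsStable (X : Matrix (Idx p q) (Idx p q) ℝ).mulVecLin
      (H : Matrix (Idx p q) (Idx p q) ℝ).mulVecLin
      (Y : Matrix (Idx p q) (Idx p q) ℝ).mulVecLin A := by
    intro A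
    simp only [IsSubmod, IsStable, Set.mem_insert_iff, Set.mem_singleton_iff, forall_eq_or_imp,
      forall_eq, Matrix.mulVecLin_apply]
    exact ⟨fun h v hv => ⟨h.1 v hv, h.2.1 v hv, h.2.2 v hv⟩,
      fun h => ⟨fun v hv => (h v hv).1, fun v hv => (h v hv).2.1, fun v hv => (h v hv).2.2⟩⟩
  simp only [IsIrred, IsIrreducibleStable, hs]

theorem lowest_eq (hXHY : IsSl2Triple H X Y) (d : ℕ) :
    lowest X H Y d = lowestWeight (H : Matrix (Idx p q) (Idx p q) ℝ).mulVecLin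
      (Y : Matrix (Idx p q) (Idx p q) ℝ).mulVecLin d := by
  rw [lowest, isotypic]
  simp only [isIrred_iff]
  exact (isSl2Rel hXHY).ker_inf_sSup_irreducible d

theorem mem_lowest (hXHY : IsSl2Triple H X Y) {d : ℕ} {v : Vec p q} :
    v ∈ lowest X H Y d ↔ (Y : Matrix (Idx p q) (Idx p q) ℝ) *ᵥ v = 0 ∧
      (H : Matrix (Idx p q) (Idx p q) ℝ) *ᵥ v = (1 - d : ℝ) • v := by
  rw [lowest_eq hXHY, mem_lowestWeight]; rfl

theorem mem_parts (hXHY : IsSl2Triple H X Y) {d : ℕ} :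
    d ∈ parts X H Y ↔ mult X H Y d ≠ 0 := by
  have h1 : mult X H Y d ≠ 0 ↔ lowest X H Y d ≠ ⊥ := by
    rw [mult, Ne, Submodule.finrank_eq_zero]
  rw [h1, lowest_eq hXHY, ← (isSl2Rel hXHY).exists_irreducible_iff]
  simp only [parts, Finset.mem_filter, Finset.mem_range, isIrred_iff]
  refine ⟨fun h => h.2, fun h => ⟨?_, h⟩⟩
  obtain ⟨A, -, rfl⟩ := h
  have := Submodule.finrank_le A
  simp only [Module.finrank_fintype_fun_eq_card, Fintype.card_sum, Fintype.card_fin] at this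
  omega

theorem mult_eq_zero (hXHY : IsSl2Triple H X Y) {d : ℕ} (hd : d ∉ parts X H Y) :
    mult X H Y d = 0 := by
  rw [mem_parts hXHY] at hd; simpa using hd

theorem pos_of_mem_parts (hXHY : IsSl2Triple H X Y) {d : ℕ} (hd : d ∈ parts X H Y) : 0 < d := by
  rcases Nat.eq_zero_or_pos d with rfl | h
  · rw [mem_parts hXHY, mult, lowest_eq hXHY, (isSl2Rel hXHY).lowestWeight_zero] at hd
    simp at hd
  · exact h

theorem powApply_eq_zero (hXHY : IsSl2Triple H X Y) {d l : ℕ} {v : Vec p q}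
    (hv : v ∈ lowest X H Y d) (hl : d ≤ l) : powApply X l v = 0 := by
  rw [powApply_eq]
  rw [lowest_eq hXHY] at hv
  exact (isSl2Rel hXHY).e_pow_eq_zero_of_le hv hl

theorem form_powApply_left (k : ℕ) (x y : Vec p q) :
    form (powApply X k x) y = (-1) ^ k * form x (powApply X k y) := by
  induction k generalizing y with
  | zero => simp [powApply]
  | succ k ih =>
    have h1 : ∀ z, powApply X (k + 1) z =
        (X : Matrix (Idx p q) (Idx p q) ℝ) *ᵥ powApply X k z := fun z => by
      simp [powApply, pow_succ']
    have h2 : powApply X k ((X : Matrix (Idx p q) (Idx p q) ℝ) *ᵥ y) = powApply X (k + 1) y := by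
      simp [powApply, pow_succ]
    rw [h1, form_so_left, ih, h2]
    ring

/-- Vectors in strings pair to zero unless the strings have the same length and the weights are
opposite. -/
theorem form_string_eq_zero (hXHY : IsSl2Triple H X Y) {d d' l l' : ℕ} {u v : Vec p q}
    (hu : u ∈ lowest X H Y d) (hv : v ∈ lowest X H Y d') (h : ¬(d = d' ∧ l + l' + 1 = d)) :
    form (powApply X l u) (powApply X l' v) = 0 := by
  have hw : ∀ {d l : ℕ} {u : Vec p q}, u ∈ lowest X H Y d →
      (H : Matrix (Idx p q) (Idx p q) ℝ) *ᵥ powApply X l u =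
        (1 - d + 2 * l : ℝ) • powApply X l u := by
    intro d l u hu
    rw [powApply_eq]
    exact (isSl2Rel hXHY).h_pow_e_weight (mem_lowest hXHY |>.mp hu).2 l
  -- The equation says that the two weights are opposite; otherwise skewness of `H` gives
  -- orthogonality. If they are opposite and `d ≠ d'`, moving all powers of `X` onto the vector of
  -- the shorter string yields `X^(l+l')` with `l + l'` at least its length, which is zero.
  by_cases hwt : (2 * l + 2 * l' + 2 : ℝ) = d + d'
  · have hwt' : 2 * l + 2 * l' + 2 = d + d' := by exact_mod_cast hwt
    rcases lt_trichotomy d d' with hlt | heq | hlt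
    · rw [form_comm, form_powApply_left, powApply_powApply, powApply_eq_zero hXHY hu (by omega),
        form_zero_right, mul_zero]
    · exact absurd ⟨heq, by omega⟩ h
    · rw [form_powApply_left, powApply_powApply, powApply_eq_zero hXHY hv (by omega),
        form_zero_right, mul_zero]
  · have h1 := form_so_left H (powApply X l u) (powApply X l' v)
    rw [hw hu, hw hv, form_smul_left, form_smul_right] at h1
    have h2 : ((2 * l + 2 * l' + 2 : ℝ) - (d + d')) *
        form (powApply X l u) (powApply X l' v) = 0 := by linear_combination h1
    exact (mul_eq_zero.mp h2).resolve_left (sub_ne_zero.mpr hwt)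

theorem form_string (u v : Vec p q) {d l l' : ℕ} (h : l + l' + 1 = d) :
    form (powApply X l u) (powApply X l' v) = (-1) ^ l * formL X d u v := by
  rw [form_powApply_left, powApply_powApply, formL]
  congr 3; omega

theorem formL_comm (d : ℕ) (u v : Vec p q) :
    formL X d u v = (-1) ^ (d - 1) * formL X d v u := by
  rw [formL, form_comm, form_powApply_left, formL]

end TripleFacts

/-! ### The basis of strings and the Gram matrices -/

namespace AdaptedBasis

variable {p q : ℕ} {X H Y : so p q} (B : AdaptedBasis X H Y)

theorem vec_eq (d : ℕ) (j : Fin (mult X H Y d)) : B.vec d j = B.v d j := by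
  simp [vec]

theorem vec_mem (d j : ℕ) : B.vec d j ∈ lowest X H Y d := by
  unfold vec
  split_ifs with h
  · exact (B.v d ⟨j, h⟩).2
  · exact zero_mem _

/-- The Gram matrix of `(·,·)_d` in the basis of `L(d-1)`. -/
def gram (d : ℕ) : Matrix (Fin (mult X H Y d)) (Fin (mult X H Y d)) ℝ :=
  Matrix.of fun i j => formL X d (B.v d i) (B.v d j)

theorem gram_apply (d : ℕ) (i j : Fin (mult X H Y d)) :
    B.gram d i j = formL X d (B.vec d i) (B.vec d j) := by
  rw [vec_eq, vec_eq]; rfl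

theorem form_xv_eq_zero (hXHY : IsSl2Triple H X Y) {d d' l l' i j : ℕ}
    (h : ¬(d = d' ∧ l + l' + 1 = d)) : form (B.xv d l i) (B.xv d' l' j) = 0 :=
  form_string_eq_zero hXHY (B.vec_mem d i) (B.vec_mem d' j) h

theorem form_xv {d l l' : ℕ} (h : l + l' + 1 = d) (i j : Fin (mult X H Y d)) :
    form (B.xv d l i) (B.xv d l' j) = (-1) ^ l * B.gram d i j := by
  rw [gram_apply]
  exact form_string _ _ h

/-- The index set of the basis `X^l v^d_j`. -/
abbrev StrIdx (X H Y : so p q) : Type :=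
  Σ x : (Σ d : parts X H Y, Fin d), Fin (mult X H Y x.1)

/-- The vectors `X^l v^d_j`. -/
def strVec (x : StrIdx X H Y) : Vec p q := B.xv x.1.1 x.1.2 x.2

theorem span_xv (hXHY : IsSl2Triple H X Y) : Submodule.span ℝ (Set.range B.strVec) = ⊤ := by
  rw [eq_top_iff, ← (isSl2Rel hXHY).iSup_map_lowestWeight]
  refine iSup_le fun d => iSup₂_le fun l hl => ?_
  rw [Finset.mem_range] at hl
  rintro _ ⟨u, hu, rfl⟩
  rw [← lowest_eq hXHY] at hu
  obtain ⟨u, rfl⟩ : ∃ w : lowest X H Y d, (w : Vec p q) = u := ⟨⟨u, hu⟩, rfl⟩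
  by_cases hd : d ∈ parts X H Y
  · rw [← (B.v d).sum_repr u]
    simp only [Submodule.coe_sum, Submodule.coe_smul, map_sum, map_smul]
    refine Submodule.sum_mem _ fun j _ => Submodule.smul_mem _ _ (Submodule.subset_span ?_)
    refine ⟨⟨⟨⟨d, hd⟩, ⟨l, hl⟩⟩, j⟩, ?_⟩
    rw [← powApply_eq, ← vec_eq]; rfl
  · have := mult_eq_zero hXHY hd
    rw [mult, Submodule.finrank_eq_zero] at this
    have hu0 : (u : Vec p q) = 0 := by
      exact (Submodule.mem_bot ℝ).mp (this.le u.2)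
    rw [hu0, map_zero]; exact zero_mem _

/-- The vector `X^(d-1) u` is orthogonal to every string vector outside `L(d-1)`, so under the
hypothesis it is orthogonal to all of `V` and vanishes; and `X^(d-1)` is injective on `L(d-1)`. -/
theorem formL_nondegenerate (hXHY : IsSl2Triple H X Y) {d : ℕ} {u : Vec p q}
    (hu : u ∈ lowest X H Y d) (h0 : ∀ j, formL X d u (B.v d j) = 0) : u = 0 := by
  rcases Nat.eq_zero_or_pos d with rfl | hd
  · rw [lowest_eq hXHY, (isSl2Rel hXHY).lowestWeight_zero] at hu
    simpa using hu
  have h1 : powApply X (d - 1) u = 0 := by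
    apply form_nondegenerate
    intro y
    have hy : y ∈ Submodule.span ℝ (Set.range B.strVec) := by
      rw [B.span_xv hXHY]; trivial
    induction hy using Submodule.span_induction with
    | mem y hy =>
      obtain ⟨⟨⟨⟨d', hd'⟩, l⟩, j⟩, rfl⟩ := hy
      by_cases h : d = d' ∧ d - 1 + (l : ℕ) + 1 = d
      · obtain ⟨rfl, hl⟩ := h
        have : form (powApply X (d - 1) u) (powApply X l (B.vec d j)) = 0 := by
          rw [form_string _ _ hl, vec_eq, h0, mul_zero]
        exact this
      · exact form_string_eq_zero hXHY hu (B.vec_mem d' j) h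
    | zero => exact form_zero_right _
    | add x y _ _ hx hy => rw [form_add_right, hx, hy, add_zero]
    | smul c x _ hx => rw [form_smul_right, hx, mul_zero]
  rw [powApply_eq] at h1
  rw [lowest_eq hXHY] at hu
  exact (isSl2Rel hXHY).e_pow_injOn hu (by omega) h1

theorem gram_det_ne_zero (hXHY : IsSl2Triple H X Y) (d : ℕ) : (B.gram d).det ≠ 0 := by
  intro h0
  obtain ⟨c, hc, hc0⟩ := Matrix.exists_vecMul_eq_zero_iff.mpr h0
  apply hc
  have h1 : ((∑ i, c i • B.v d i : lowest X H Y d) : Vec p q) = 0 := by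
    apply B.formL_nondegenerate hXHY (SetLike.coe_mem _)
    intro j
    have := congrFun hc0 j
    simp only [Matrix.vecMul, dotProduct, Pi.zero_apply] at this
    rw [← this]
    simp only [Submodule.coe_sum, Submodule.coe_smul, formL, form_sum_left, form_smul_left]
    rfl
  have h2 : ∑ i, c i • B.v d i = 0 := Subtype.ext h1
  ext i
  exact Fintype.linearIndependent_iff.mp (B.v d).linearIndependent c h2 i

theorem gram_transpose (d : ℕ) : (B.gram d)ᵀ = (-1 : ℝ) ^ (d - 1) • B.gram d := by
  ext i j
  simp only [Matrix.transpose_apply, Matrix.smul_apply, smul_eq_mul]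
  exact formL_comm d _ _

/-- For `d` even the Gram matrix is antisymmetric and invertible, which is impossible in odd size.
Thus the halves `t_d / 2` in the definition of a symplectic basis are exact. -/
theorem even_mult (B : AdaptedBasis X H Y) (hXHY : IsSl2Triple H X Y) {d : ℕ} (hd : Even d) : Even (mult X H Y d) := by
  rcases Nat.eq_zero_or_pos d with rfl | hpos
  · have : mult X H Y 0 = 0 := by
      rw [mult, lowest_eq hXHY, (isSl2Rel hXHY).lowestWeight_zero]; simp
    rw [this]; exact Even.zero
  have h1 := congrArg Matrix.det (B.gram_transpose d)
  rw [Matrix.det_transpose, Matrix.det_smul, Fintype.card_fin,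
    Odd.neg_one_pow (Nat.Even.sub_odd hpos hd odd_one)] at h1
  by_contra h
  rw [Nat.not_even_iff_odd] at h
  rw [h.neg_one_pow] at h1
  exact B.gram_det_ne_zero hXHY d (by linarith)

/-- Pairing a relation with `X^(d-1-l) v^d_k` isolates the coefficients of the layer `X^l L(d-1)`,
up to the invertible Gram matrix. -/
theorem linearIndependent_strVec (hXHY : IsSl2Triple H X Y) : LinearIndependent ℝ B.strVec := by
  rw [Fintype.linearIndependent_iff]
  intro c hc
  rintro ⟨⟨⟨d, hd⟩, l⟩, j⟩
  have hl := l.2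
  simp only at hl
  have h1 : (fun i => c ⟨⟨⟨d, hd⟩, l⟩, i⟩) ᵥ* B.gram d = 0 := by
    ext k
    have h2 := congrArg (fun z => form z (B.xv d (d - 1 - l) k)) hc
    simp only [form_sum_left, form_smul_left, form_zero_left, strVec] at h2
    rw [Fintype.sum_sigma, Finset.sum_eq_single ⟨⟨d, hd⟩, l⟩] at h2
    · simp only [B.form_xv (show (l : ℕ) + (d - 1 - l) + 1 = d by omega)] at h2
      have h3 : (-1 : ℝ) ^ (l : ℕ) ≠ 0 := pow_ne_zero _ (by norm_num)
      have h4 : (-1 : ℝ) ^ (l : ℕ) *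
          (((fun i => c ⟨⟨⟨d, hd⟩, l⟩, i⟩) ᵥ* B.gram d) k) = 0 := by
        rw [← h2, Matrix.vecMul, dotProduct, Finset.mul_sum]
        exact Finset.sum_congr rfl fun i _ => by ring
      exact (mul_eq_zero.mp h4).resolve_left h3
    · rintro ⟨⟨d', hd'⟩, l'⟩ _ hne
      refine Finset.sum_eq_zero fun i _ => ?_
      rw [B.form_xv_eq_zero hXHY, mul_zero]
      rintro ⟨h3, h4⟩
      simp only at h3 h4
      subst h3
      exact hne (by congr 1; ext; omega)
    · simp
  have h5 := Matrix.eq_zero_of_vecMul_eq_zero (B.gram_det_ne_zero hXHY d) h1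
  exact congrFun h5 j

/-- The basis `X^l v^d_j` of `V`. -/
def strBasis (hXHY : IsSl2Triple H X Y) : Module.Basis (StrIdx X H Y) ℝ (Vec p q) :=
  Module.Basis.mk (B.linearIndependent_strVec hXHY) (B.span_xv hXHY).ge

theorem strBasis_apply (hXHY : IsSl2Triple H X Y) (x : StrIdx X H Y) :
    B.strBasis hXHY x = B.xv x.1.1 x.1.2 x.2 := by
  simp [strBasis, strVec]

end AdaptedBasis
end SOpq

/-! ### The centralizer as families of isometries of the spaces `L(d-1)` -/

namespace SOpq

/-- Any linear order on the index type makes a block diagonal matrix block triangular, and the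
triangular formula applies. -/
theorem det_blockDiagonal_dep {o : Type*} [Fintype o] [DecidableEq o] {m : o → Type*}
    [∀ i, Fintype (m i)] [∀ i, DecidableEq (m i)] (M : ∀ i, Matrix (m i) (m i) ℝ) :
    (Matrix.blockDiagonal' M).det = ∏ i, (M i).det := by
  let : LinearOrder o := LinearOrder.lift' (Fintype.equivFin o) (Fintype.equivFin o).injective
  have h1 : (Matrix.blockDiagonal' M).BlockTriangular Sigma.fst := by
    rintro ⟨i, a⟩ ⟨j, b⟩ hij
    exact Matrix.blockDiagonal'_apply_ne _ _ _ (ne_of_gt hij)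
  rw [h1.det_fintype]
  refine Finset.prod_congr rfl fun k _ => ?_
  rw [← Matrix.det_submatrix_equiv_self (Equiv.sigmaSubtype k).symm]
  congr 1
  · ext a b
    simp [Matrix.toSquareBlock, Matrix.toSquareBlockProp, Equiv.sigmaSubtype]

namespace AdaptedBasis

variable {p q : ℕ} {X H Y : so p q} (B : AdaptedBasis X H Y)

/-- Families of endomorphisms of the spaces `L(d-1)`, as matrices. -/
abbrev Fam (X H Y : so p q) : Type :=
  ∀ d : ℕ, Matrix (Fin (mult X H Y d)) (Fin (mult X H Y d)) ℝ

/-- The block diagonal matrix with `A_d` acting on each `X^l L(d-1)`. -/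
def famMatrix (X H Y : so p q) : Fam X H Y →+* Matrix (StrIdx X H Y) (StrIdx X H Y) ℝ :=
  (Matrix.blockDiagonal'RingHom
    (fun x : (Σ d : parts X H Y, Fin d) => Fin (mult X H Y x.1)) ℝ).comp
    (RingHom.pi fun x : (Σ d : parts X H Y, Fin d) =>
      Pi.evalRingHom (fun d : ℕ => Matrix (Fin (mult X H Y d)) (Fin (mult X H Y d)) ℝ) x.1)

theorem famMatrix_apply (A : Fam X H Y) :
    famMatrix X H Y A = Matrix.blockDiagonal' fun x : (Σ d : parts X H Y, Fin d) => A x.1 := rfl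

/-- The endomorphism of `V` that acts by `A_d` on each `X^l L(d-1)`. -/
def act (hXHY : IsSl2Triple H X Y) : Fam X H Y →+* Matrix (Idx p q) (Idx p q) ℝ :=
  ((Matrix.toLinAlgEquiv (B.strBasis hXHY)).trans
    LinearMap.toMatrixAlgEquiv').toRingEquiv.toRingHom.comp (famMatrix X H Y)

variable (hXHY : IsSl2Triple H X Y)

theorem act_mulVecLin (A : Fam X H Y) : (B.act hXHY A).mulVecLin =
    Matrix.toLin (B.strBasis hXHY) (B.strBasis hXHY) (famMatrix X H Y A) := by
  change Matrix.toLin' (LinearMap.toMatrix' (Matrix.toLin (B.strBasis hXHY) (B.strBasis hXHY)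
    (famMatrix X H Y A))) = _
  rw [Matrix.toLin'_toMatrix']

theorem act_xv (A : Fam X H Y) (d l : ℕ) (j : Fin (mult X H Y d)) :
    B.act hXHY A *ᵥ B.xv d l j = ∑ i, A d i j • B.xv d l i := by
  by_cases hl : l < d
  · have hd : d ∈ parts X H Y := by
      rw [mem_parts hXHY]; exact (Fin.pos j).ne'
    have h1 := Matrix.toLin_self (B.strBasis hXHY) (B.strBasis hXHY) (famMatrix X H Y A)
      ⟨⟨⟨d, hd⟩, ⟨l, hl⟩⟩, j⟩
    rw [← act_mulVecLin, strBasis_apply, Matrix.mulVecLin_apply] at h1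
    rw [h1, Fintype.sum_sigma, Finset.sum_eq_single ⟨⟨d, hd⟩, ⟨l, hl⟩⟩]
    · refine Finset.sum_congr rfl fun i _ => ?_
      rw [famMatrix_apply, Matrix.blockDiagonal'_apply_eq, strBasis_apply]
    · intro x _ hx
      refine Finset.sum_eq_zero fun i _ => ?_
      rw [famMatrix_apply, Matrix.blockDiagonal'_apply_ne _ _ _ hx, zero_smul]
    · simp
  · have h0 : ∀ i, B.xv d l i = 0 := fun i =>
      powApply_eq_zero hXHY (B.vec_mem d i) (not_lt.mp hl)
    simp [h0]

/-- Matrices that agree on the vectors `X^l v^d_j` are equal. -/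
theorem matrix_ext (hXHY : IsSl2Triple H X Y) {M N : Matrix (Idx p q) (Idx p q) ℝ}
    (h : ∀ d l, ∀ j : Fin (mult X H Y d), M *ᵥ B.xv d l j = N *ᵥ B.xv d l j) : M = N := by
  have h1 : M.mulVecLin = N.mulVecLin :=
    (B.strBasis hXHY).ext fun x => by
      rw [strBasis_apply]; exact h _ _ _
  exact Matrix.toLin'.injective h1

theorem eq_act {M : Matrix (Idx p q) (Idx p q) ℝ} {A : Fam X H Y}
    (h : ∀ d l, ∀ j : Fin (mult X H Y d), M *ᵥ B.xv d l j = ∑ i, A d i j • B.xv d l i) :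
    M = B.act hXHY A :=
  B.matrix_ext hXHY fun d l j => by rw [h, act_xv]

/-- The exponent counts the layers: `A d` occurs once on each `X^l L(d-1)` with `l < d`. -/
theorem det_act (A : Fam X H Y) :
    (B.act hXHY A).det = ∏ d ∈ parts X H Y, (A d).det ^ d := by
  have h1 : (B.act hXHY A).det = (famMatrix X H Y A).det := by
    rw [← LinearMap.det_toLin (B.strBasis hXHY), ← act_mulVecLin]
    exact (LinearMap.det_toLin' _).symm
  rw [h1, famMatrix_apply, det_blockDiagonal_dep, Fintype.prod_sigma]
  refine Eq.trans (Finset.prod_congr rfl fun d _ => ?_)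
    (Finset.prod_coe_sort (parts X H Y) fun d => (A d).det ^ d)
  exact (Finset.prod_const (A d).det).trans (by rw [Finset.card_univ, Fintype.card_fin])

theorem form_sum_xv {d l l' : ℕ} (h : l + l' + 1 = d)
    (A C : Matrix (Fin (mult X H Y d)) (Fin (mult X H Y d)) ℝ) (i j : Fin (mult X H Y d)) :
    form (∑ k, A k i • B.xv d l k) (∑ k, C k j • B.xv d l' k) =
      (-1) ^ l * (Aᵀ * B.gram d * C) i j := by
  simp only [form_sum_left, form_sum_right, form_smul_left, form_smul_right, B.form_xv h,
    Matrix.mul_apply, Matrix.transpose_apply, Finset.sum_mul, Finset.mul_sum]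
  exact Finset.sum_congr rfl fun k _ => Finset.sum_congr rfl fun m _ => by ring

theorem form_act_xv {A : Fam X H Y} (hA : ∀ d, (A d)ᵀ * B.gram d * A d = B.gram d)
    (x y : Vec p q) :
    form (B.act hXHY A *ᵥ x) (B.act hXHY A *ᵥ y) = form x y := by
  let β : LinearMap.BilinForm ℝ (Vec p q) := LinearMap.mk₂ ℝ form form_add_left
    form_smul_left (fun z x y => form_add_right x y z) (fun c z x => form_smul_right c x z)
  have h1 : β.compl₁₂ (B.act hXHY A).mulVecLin (B.act hXHY A).mulVecLin = β := by
    refine LinearMap.ext_basis (B.strBasis hXHY) (B.strBasis hXHY) ?_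
    rintro ⟨⟨⟨d, hd⟩, l⟩, j⟩ ⟨⟨⟨d', hd'⟩, l'⟩, j'⟩
    rw [LinearMap.compl₁₂_apply, strBasis_apply, strBasis_apply]
    change form (B.act hXHY A *ᵥ B.xv d l j) (B.act hXHY A *ᵥ B.xv d' l' j') =
      form (B.xv d l j) (B.xv d' l' j')
    rw [act_xv, act_xv]
    by_cases h : d = d' ∧ (l : ℕ) + l' + 1 = d
    · obtain ⟨rfl, h⟩ := h
      rw [B.form_sum_xv h, B.form_xv h, hA]
    · rw [B.form_xv_eq_zero hXHY h]
      simp only [form_sum_left, form_sum_right, form_smul_left, form_smul_right,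
        B.form_xv_eq_zero hXHY h, mul_zero, Finset.sum_const_zero]
  exact congrArg (fun γ : LinearMap.BilinForm ℝ (Vec p q) => γ x y) h1

theorem X_xv (d l j : ℕ) : (X : Matrix (Idx p q) (Idx p q) ℝ) *ᵥ B.xv d l j = B.xv d (l + 1) j := by
  simp [xv, powApply, pow_succ']

theorem H_xv (hXHY : IsSl2Triple H X Y) (d l j : ℕ) : (H : Matrix (Idx p q) (Idx p q) ℝ) *ᵥ B.xv d l j =
    (1 - d + 2 * l : ℝ) • B.xv d l j := by
  rw [xv, powApply_eq]
  exact (isSl2Rel hXHY).h_pow_e_weight ((mem_lowest hXHY).mp (B.vec_mem d j)).2 l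

theorem Y_xv (hXHY : IsSl2Triple H X Y) (d l : ℕ) : ∃ c : ℝ, ∀ j, (Y : Matrix (Idx p q) (Idx p q) ℝ) *ᵥ B.xv d l j =
    c • B.xv d (l - 1) j := by
  cases l with
  | zero =>
    refine ⟨0, fun j => ?_⟩
    rw [zero_smul]
    simpa [xv, powApply] using ((mem_lowest hXHY).mp (B.vec_mem d j)).1
  | succ l =>
    refine ⟨(l + 1) * (d - 1 - l), fun j => ?_⟩
    obtain ⟨h1, h2⟩ := (mem_lowest hXHY).mp (B.vec_mem d j)
    rw [xv, powApply_eq, xv, powApply_eq]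
    exact (isSl2Rel hXHY).f_pow_e_lowest h1 h2 l

/-- Each of `X, H, Y` sends `X^l v^d_j` to a multiple of some `X^l' v^d_j`, with multiple and `l'`
independent of `j`, while the family mixes only the indices `j`. -/
theorem commute_act (A : Fam X H Y) {Z : so p q} (hZ : Z ∈ ({X, H, Y} : Set (so p q))) :
    B.act hXHY A * (Z : Matrix (Idx p q) (Idx p q) ℝ) =
      (Z : Matrix (Idx p q) (Idx p q) ℝ) * B.act hXHY A := by
  refine B.matrix_ext hXHY fun d l j => ?_
  rw [← Matrix.mulVec_mulVec, ← Matrix.mulVec_mulVec, act_xv, Matrix.mulVec_sum]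
  simp only [Matrix.mulVec_smul]
  simp only [Set.mem_insert_iff, Set.mem_singleton_iff] at hZ
  rcases hZ with rfl | rfl | rfl
  · simp only [X_xv, act_xv]
  · simp only [B.H_xv hXHY, Matrix.mulVec_smul, act_xv, Finset.smul_sum]
    exact Finset.sum_congr rfl fun i _ => smul_comm _ _ _
  · obtain ⟨c, hc⟩ := B.Y_xv hXHY d l
    simp only [hc, Matrix.mulVec_smul, act_xv, Finset.smul_sum]
    exact Finset.sum_congr rfl fun i _ => smul_comm _ _ _

/-- The centralizer is the group of families of isometries of the spaces `L(d-1)`. -/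
theorem mem_centralizer_iff (g : SL p q) : g ∈ centralizer X H Y ↔
    ∃ A : Fam X H Y, (∀ d, (A d)ᵀ * B.gram d * A d = B.gram d) ∧
      (g : Matrix (Idx p q) (Idx p q) ℝ) = B.act hXHY A := by
  have hginv : (g : Matrix (Idx p q) (Idx p q) ℝ) *
      ((g⁻¹ : SL p q) : Matrix (Idx p q) (Idx p q) ℝ) = 1 := by
    rw [← Matrix.SpecialLinearGroup.coe_mul]; simp
  have hinvg : ((g⁻¹ : SL p q) : Matrix (Idx p q) (Idx p q) ℝ) *
      (g : Matrix (Idx p q) (Idx p q) ℝ) = 1 := by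
    rw [← Matrix.SpecialLinearGroup.coe_mul]; simp
  constructor
  · rintro ⟨hSO, hcomm⟩
    rw [mem_SO_iff] at hSO
    have hc : ∀ Z ∈ ({X, H, Y} : Set (so p q)), ∀ v,
        (Z : Matrix (Idx p q) (Idx p q) ℝ) *ᵥ ((g : Matrix (Idx p q) (Idx p q) ℝ) *ᵥ v) =
        (g : Matrix (Idx p q) (Idx p q) ℝ) *ᵥ ((Z : Matrix (Idx p q) (Idx p q) ℝ) *ᵥ v) := by
      intro Z hZ v
      rw [Matrix.mulVec_mulVec, Matrix.mulVec_mulVec]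
      congr 1
      conv_lhs => rw [← hcomm Z hZ]
      rw [Matrix.mul_assoc, hinvg, Matrix.mul_one]
    have hlow : ∀ d, ∀ u ∈ lowest X H Y d,
        (g : Matrix (Idx p q) (Idx p q) ℝ) *ᵥ u ∈ lowest X H Y d := by
      intro d u hu
      rw [mem_lowest hXHY] at hu ⊢
      rw [hc Y (by simp), hc H (by simp), hu.1, hu.2, Matrix.mulVec_zero, Matrix.mulVec_smul]
      exact ⟨rfl, rfl⟩
    -- The matrix of `g` on the lowest layer; commuting with `X` propagates it to every layer.
    let A : Fam X H Y := fun d => Matrix.of fun i j =>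
      (B.v d).repr ⟨_, hlow d _ (B.v d j).2⟩ i
    have hA0 : ∀ d, ∀ j : Fin (mult X H Y d),
        (g : Matrix (Idx p q) (Idx p q) ℝ) *ᵥ B.vec d j = ∑ i, A d i j • B.vec d i := by
      intro d j
      have := (B.v d).sum_repr ⟨_, hlow d _ (B.v d j).2⟩
      have h2 := congrArg Subtype.val this
      simp only [Submodule.coe_sum, Submodule.coe_smul] at h2
      rw [vec_eq, ← h2]
      exact Finset.sum_congr rfl fun i _ => by rw [vec_eq]; rfl
    have hA : ∀ d l, ∀ j : Fin (mult X H Y d),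
        (g : Matrix (Idx p q) (Idx p q) ℝ) *ᵥ B.xv d l j = ∑ i, A d i j • B.xv d l i := by
      intro d l j
      induction l with
      | zero => simpa [xv, powApply] using hA0 d j
      | succ l ih =>
        rw [← X_xv, ← hc X (by simp), ih, Matrix.mulVec_sum]
        simp only [Matrix.mulVec_smul, X_xv]
    refine ⟨A, fun d => ?_, B.eq_act hXHY hA⟩
    rcases Nat.eq_zero_or_pos d with rfl | hd
    · have : mult X H Y 0 = 0 :=
        mult_eq_zero hXHY fun h => absurd (pos_of_mem_parts hXHY h) (lt_irrefl _)
      ext i; exact absurd i.2 (by omega)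
    ext i j
    -- The bottom and top layers pair by exactly `(·,·)_d`, the sign `(-1)^l` being `1` for `l = 0`.
    have h1 := hSO (B.xv d 0 i) (B.xv d (d - 1) j)
    rw [hA, hA, B.form_sum_xv (by omega), B.form_xv (by omega)] at h1
    simpa using h1
  · rintro ⟨A, hA, hg⟩
    refine ⟨(mem_SO_iff g).mpr fun x y => ?_, fun Z hZ => ?_⟩
    · rw [hg, B.form_act_xv hXHY hA]
    · have := B.commute_act hXHY A hZ
      rw [← hg] at this
      rw [this, Matrix.mul_assoc, hginv, Matrix.mul_one]

end AdaptedBasis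
end SOpq

/-! ### Polar decomposition and bounded powers -/

namespace SOpq

section Polar

variable {n : Type*} [Fintype n] [DecidableEq n]

open scoped MatrixOrder in
/-- Polar decomposition in the isometry group of a form with orthogonal Gram matrix. -/
theorem exists_polar {J A : Matrix n n ℝ} (hJ : Jᵀ * J = 1) (hA : Aᵀ * J * A = J) :
    ∃ K P : Matrix n n ℝ, A = K * P ∧ Kᵀ * K = 1 ∧ Kᵀ * J * K = J ∧ Pᵀ * J * P = J ∧
      P.PosDef := by
  have hJ' : J * Jᵀ = 1 := mul_eq_one_comm.mp hJ
  have hinv : (Jᵀ * Aᵀ * J) * A = 1 := by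
    rw [Matrix.mul_assoc, Matrix.mul_assoc, ← Matrix.mul_assoc Aᵀ, hA, hJ]
  have hinv' := mul_eq_one_comm.mp hinv
  set h := Aᵀ * A with hh
  have hpsd : h.PosSemidef := by
    have := Matrix.posSemidef_conjTranspose_mul_self A
    rwa [Matrix.conjTranspose_eq_transpose_of_trivial] at this
  -- Invariance of the form reads `A⁻¹ = Jᵀ Aᵀ J`, whence `h⁻¹ = Jᵀ h J`.
  have hhinv : h * (Jᵀ * h * J) = 1 := by
    have h1 : A * Jᵀ * Aᵀ = Jᵀ := by
      calc A * Jᵀ * Aᵀ = A * (Jᵀ * Aᵀ * J) * Jᵀ := by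
            simp only [Matrix.mul_assoc]; rw [hJ', Matrix.mul_one]
        _ = Jᵀ := by rw [hinv', Matrix.one_mul]
    calc Aᵀ * A * (Jᵀ * (Aᵀ * A) * J) = Aᵀ * (A * Jᵀ * Aᵀ) * (A * J) := by
          simp only [Matrix.mul_assoc]
      _ = (Jᵀ * Aᵀ * J * A)ᵀ * 1 := by
          rw [h1]
          have h2 : Aᵀ * Jᵀ * A = Jᵀ := by
            have := congrArg Matrix.transpose hA
            simpa [Matrix.mul_assoc] using this
          rw [hinv, Matrix.transpose_one, ← Matrix.mul_assoc, h2, hJ, Matrix.mul_one]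
      _ = 1 := by rw [hinv, Matrix.transpose_one, Matrix.mul_one]
  set P := CFC.sqrt h with hP
  have hPP : P * P = h := CFC.sqrt_mul_sqrt_self h hpsd.nonneg
  have hPpsd : P.PosSemidef := Matrix.nonneg_iff_posSemidef.mp (CFC.sqrt_nonneg h)
  have hPt : Pᵀ = P := by
    have := hPpsd.isHermitian
    rwa [Matrix.IsHermitian, Matrix.conjTranspose_eq_transpose_of_trivial] at this
  have hPunit : P * (P * (Jᵀ * h * J)) = 1 := by rw [← Matrix.mul_assoc, hPP, hhinv]
  have hPdef : P.PosDef := by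
    rw [hPpsd.posDef_iff_det_ne_zero]
    intro h0
    have := congrArg Matrix.det hPunit
    rw [Matrix.det_mul, h0, zero_mul, Matrix.det_one] at this
    exact zero_ne_one this
  have hdet : IsUnit P.det := isUnit_iff_ne_zero.mpr hPdef.det_pos.ne'
  -- Both `Jᵀ P J` and `P⁻¹` are positive square roots of `h⁻¹`, so uniqueness makes them equal;
  -- that equality is `P J P = J`, the statement that `P` is again an isometry.
  have hsq : CFC.sqrt (Jᵀ * h * J) = Jᵀ * P * J := by
    refine CFC.sqrt_unique ?_ ?_
    · calc Jᵀ * P * J * (Jᵀ * P * J) = Jᵀ * P * (J * Jᵀ) * P * J := by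
            simp only [Matrix.mul_assoc]
        _ = Jᵀ * h * J := by rw [hJ', Matrix.mul_one, Matrix.mul_assoc Jᵀ, hPP]
    · have := hPpsd.conjTranspose_mul_mul_same J
      rw [Matrix.conjTranspose_eq_transpose_of_trivial] at this
      exact this.nonneg
  have hsq' : CFC.sqrt (Jᵀ * h * J) = P⁻¹ := by
    have : Jᵀ * h * J = h⁻¹ := (Matrix.inv_eq_right_inv hhinv).symm
    rw [this, ← hpsd.inv_sqrt]
  have hPJP : P * J * P = J := by
    have h1 : Jᵀ * P * J * P = 1 := by
      rw [← hsq, hsq', Matrix.nonsing_inv_mul _ hdet]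
    calc P * J * P = (J * Jᵀ) * P * J * P := by rw [hJ', Matrix.one_mul]
      _ = J * (Jᵀ * P * J * P) := by simp only [Matrix.mul_assoc]
      _ = J := by rw [h1, Matrix.mul_one]
  have hPinvt : P⁻¹ᵀ = P⁻¹ := by rw [Matrix.transpose_nonsing_inv, hPt]
  refine ⟨A * P⁻¹, P, ?_, ?_, ?_, ?_, hPdef⟩
  · rw [Matrix.mul_assoc, Matrix.nonsing_inv_mul _ hdet, Matrix.mul_one]
  · rw [Matrix.transpose_mul, hPinvt]
    calc P⁻¹ * Aᵀ * (A * P⁻¹) = P⁻¹ * (Aᵀ * A) * P⁻¹ := by simp only [Matrix.mul_assoc]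
      _ = (P⁻¹ * P) * (P * P⁻¹) := by rw [← hh, ← hPP]; simp only [Matrix.mul_assoc]
      _ = 1 := by rw [Matrix.nonsing_inv_mul _ hdet, Matrix.mul_nonsing_inv _ hdet,
                    Matrix.one_mul]
  · rw [Matrix.transpose_mul, hPinvt]
    calc P⁻¹ * Aᵀ * J * (A * P⁻¹) = P⁻¹ * (Aᵀ * J * A) * P⁻¹ := by
          simp only [Matrix.mul_assoc]
      _ = (P⁻¹ * P) * J * (P * P⁻¹) := by
          conv_lhs => rw [hA, ← hPJP]
          simp only [Matrix.mul_assoc]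
      _ = J := by rw [Matrix.nonsing_inv_mul _ hdet, Matrix.mul_nonsing_inv _ hdet,
                    Matrix.one_mul, Matrix.mul_one]
  · rw [hPt, hPJP]

theorem le_one_of_bounded_pow {P : Matrix n n ℝ} {C : ℝ} (hC : ∀ k i j, |(P ^ k) i j| ≤ C)
    {x : n → ℝ} {μ : ℝ} (hx : x ≠ 0) (hμ : 0 ≤ μ) (h : P *ᵥ x = μ • x) : μ ≤ 1 := by
  by_contra hlt
  push Not at hlt
  obtain ⟨i, hi⟩ := Function.ne_iff.mp hx
  have hpow : ∀ k : ℕ, (P ^ k) *ᵥ x = μ ^ k • x := by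
    intro k
    induction k with
    | zero => simp
    | succ k ih => rw [pow_succ, ← Matrix.mulVec_mulVec, h, Matrix.mulVec_smul, ih, smul_smul,
        pow_succ']
  have hb : ∀ k : ℕ, μ ^ k ≤ C * (∑ j, |x j|) / |x i| := by
    intro k
    rw [le_div_iff₀ (abs_pos.mpr hi)]
    calc μ ^ k * |x i| = |((P ^ k) *ᵥ x) i| := by
          rw [hpow, Pi.smul_apply, smul_eq_mul, abs_mul, abs_of_nonneg (pow_nonneg hμ k)]
      _ ≤ ∑ j, |(P ^ k) i j * x j| := Finset.abs_sum_le_sum_abs _ _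
      _ ≤ ∑ j, C * |x j| := Finset.sum_le_sum fun j _ => by
          rw [abs_mul]; exact mul_le_mul_of_nonneg_right (hC k i j) (abs_nonneg _)
      _ = C * ∑ j, |x j| := by rw [Finset.mul_sum]
  obtain ⟨k, hk⟩ := pow_unbounded_of_one_lt (C * (∑ j, |x j|) / |x i|) hlt
  exact absurd (hb k) (not_le.mpr hk)

/-- The relation `P J P = J` sends an eigenvector for `μ` to one for `μ⁻¹`. Bounded powers force
both eigenvalues to be at most `1`, so all are `1`, and a symmetric matrix with this spectrum is the
identity. -/
theorem eq_one_of_posDef_of_bounded_pow {J P : Matrix n n ℝ} (hJ : Jᵀ * J = 1)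
    (hP : P.PosDef) (hPJ : Pᵀ * J * P = J) {C : ℝ} (hC : ∀ k i j, |(P ^ k) i j| ≤ C) :
    P = 1 := by
  have hPt : Pᵀ = P := by
    have := hP.isHermitian
    rwa [Matrix.IsHermitian, Matrix.conjTranspose_eq_transpose_of_trivial] at this
  rw [hPt] at hPJ
  have hev : ∀ i, hP.isHermitian.eigenvalues i = 1 := by
    intro i
    have hpos := hP.eigenvalues_pos i
    have hvec := hP.isHermitian.mulVec_eigenvectorBasis i
    have hne : ⇑(hP.isHermitian.eigenvectorBasis i) ≠ 0 := by
      have := hP.isHermitian.eigenvectorBasis.orthonormal.ne_zero i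
      exact fun h => this (by ext j; exact congrFun h j)
    set x : n → ℝ := ⇑(hP.isHermitian.eigenvectorBasis i) with hx
    set μ := hP.isHermitian.eigenvalues i with hμ
    refine le_antisymm (le_one_of_bounded_pow hC hne hpos.le hvec) ?_
    have hJx : P *ᵥ (J *ᵥ x) = μ⁻¹ • (J *ᵥ x) := by
      have h1 : (P * J * P) *ᵥ x = J *ᵥ x := by rw [hPJ]
      rw [← Matrix.mulVec_mulVec, hvec, Matrix.mulVec_smul, ← Matrix.mulVec_mulVec] at h1
      rwa [eq_inv_smul_iff₀ hpos.ne']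
    have hJne : J *ᵥ x ≠ 0 := by
      intro h0
      apply hne
      rw [← Matrix.one_mulVec x, ← hJ, ← Matrix.mulVec_mulVec, h0, Matrix.mulVec_zero]
    have := le_one_of_bounded_pow hC hJne (inv_nonneg.mpr hpos.le) hJx
    exact (inv_le_one₀ hpos).mp this
  have h1 := hP.isHermitian.spectral_theorem
  rw [h1]
  have h2 : (RCLike.ofReal ∘ hP.isHermitian.eigenvalues : n → ℝ) = fun _ => 1 := by
    ext i; simp [hev i]
  rw [h2]
  have : (Matrix.diagonal fun _ : n => (1 : ℝ)) = 1 := Matrix.diagonal_one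
  rw [this, map_one]

end Polar

/-! ### The maximal compact subgroup of families of orthogonal isometries -/

namespace AdaptedBasis

variable {p q : ℕ} {X H Y : so p q} (B : AdaptedBasis X H Y)

theorem gram_odd {d : ℕ} (hd : Odd d) : B.gram d =
    Matrix.diagonal fun j : Fin (mult X H Y d) => if (j : ℕ) < B.pos d then 1 else -1 := by
  ext i j
  rw [Matrix.diagonal_apply]
  refine (B.odd_form d hd i j).trans ?_
  by_cases h : i = j
  · subst h; rfl
  · rw [if_neg h, if_neg h]

theorem gram_even {d : ℕ} (hd : Even d) (i j : Fin (mult X H Y d)) : B.gram d i j =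
    if (j : ℕ) = i + mult X H Y d / 2 then 1
    else if (i : ℕ) = j + mult X H Y d / 2 then -1 else 0 := B.even_form d hd i j

/-- In an adapted basis each row of the Gram matrix has a single non-zero entry `±1`. This
normalisation is what `exists_polar` requires of `J`. -/
theorem gram_transpose_mul (hXHY : IsSl2Triple H X Y) (d : ℕ) :
    (B.gram d)ᵀ * B.gram d = 1 := by
  rcases Nat.even_or_odd d with hd | hd
  · obtain ⟨m, hm⟩ := B.even_mult hXHY hd
    have hm2 : mult X H Y d / 2 = m := by omega
    ext i k
    simp only [Matrix.mul_apply, Matrix.transpose_apply, B.gram_even hd, hm2]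
    have hi := i.2
    have hk := k.2
    have hcond : (if (i : ℕ) < m then (i : ℕ) + m else i - m) < mult X H Y d := by
      split_ifs <;> omega
    -- The only index contributing is the symplectic partner of `i`, half the size away.
    rw [Finset.sum_eq_single ⟨if (i : ℕ) < m then (i : ℕ) + m else i - m, hcond⟩]
    · rw [Matrix.one_apply]
      simp only [Fin.ext_iff]
      split_ifs <;> first | omega | norm_num
    · intro j _ hj
      have hj2 := j.2
      have hj : (j : ℕ) ≠ if (i : ℕ) < m then (i : ℕ) + m else i - m :=
        fun h => hj (Fin.ext h)
      split_ifs at * <;> first | omega | simp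
    · simp
  · rw [B.gram_odd hd, Matrix.diagonal_transpose, Matrix.diagonal_mul_diagonal,
      ← Matrix.diagonal_one]
    congr 1
    ext j
    split_ifs <;> norm_num

variable (hXHY : IsSl2Triple H X Y)

theorem continuous_act : Continuous (B.act hXHY) := by
  have h1 : Continuous (famMatrix X H Y) := by
    refine Continuous.matrix_blockDiagonal' (A := fun (A : Fam X H Y)
      (x : (Σ d : parts X H Y, Fin d)) => A x.1) ?_
    exact continuous_pi fun x => continuous_apply _
  have h2 : Continuous ((Matrix.toLinAlgEquiv (B.strBasis hXHY)).trans
      LinearMap.toMatrixAlgEquiv').toLinearMap :=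
    LinearMap.continuous_of_finiteDimensional _
  exact h2.comp h1

/-- The elements of the centralizer that act by orthogonal matrices on the spaces `L(d-1)`. -/
def orthogonalSubgroup (hXHY : IsSl2Triple H X Y) : Subgroup (SL p q) where
  carrier := {g | ∃ A : Fam X H Y, (∀ d, (A d)ᵀ * A d = 1 ∧ (A d)ᵀ * B.gram d * A d = B.gram d) ∧
    (g : Matrix (Idx p q) (Idx p q) ℝ) = B.act hXHY A}
  one_mem' := ⟨1, fun d => by simp, by simp⟩
  mul_mem' := by
    rintro g g' ⟨A, hA, hg⟩ ⟨A', hA', hg'⟩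
    refine ⟨A * A', fun d => ⟨?_, ?_⟩, ?_⟩
    · rw [Pi.mul_apply, Matrix.transpose_mul]
      calc (A' d)ᵀ * (A d)ᵀ * (A d * A' d) = (A' d)ᵀ * ((A d)ᵀ * A d) * A' d := by
            simp only [Matrix.mul_assoc]
        _ = 1 := by rw [(hA d).1, Matrix.mul_one, (hA' d).1]
    · rw [Pi.mul_apply, Matrix.transpose_mul]
      calc (A' d)ᵀ * (A d)ᵀ * B.gram d * (A d * A' d) =
            (A' d)ᵀ * ((A d)ᵀ * B.gram d * A d) * A' d := by
            simp only [Matrix.mul_assoc]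
        _ = _ := by rw [(hA d).2, (hA' d).2]
    · rw [Matrix.SpecialLinearGroup.coe_mul, hg, hg', map_mul]
  inv_mem' := by
    rintro g ⟨A, hA, hg⟩
    have hA' : ∀ d, A d * (A d)ᵀ = 1 := fun d => mul_eq_one_comm.mp (hA d).1
    refine ⟨fun d => (A d)ᵀ, fun d => ⟨?_, ?_⟩, ?_⟩
    · rw [Matrix.transpose_transpose, hA']
    · rw [Matrix.transpose_transpose]
      calc A d * B.gram d * (A d)ᵀ = A d * ((A d)ᵀ * B.gram d * A d) * (A d)ᵀ := by
            rw [(hA d).2]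
        _ = (A d * (A d)ᵀ) * B.gram d * (A d * (A d)ᵀ) := by simp only [Matrix.mul_assoc]
        _ = B.gram d := by rw [hA', Matrix.one_mul, Matrix.mul_one]
    · have h1 : B.act hXHY (fun d => (A d)ᵀ) * (g : Matrix (Idx p q) (Idx p q) ℝ) = 1 := by
        rw [hg, ← map_mul, ← map_one (B.act hXHY)]
        congr 1
        ext d : 1
        exact (hA d).1
      have h2 : (g : Matrix (Idx p q) (Idx p q) ℝ) *
          ((g⁻¹ : SL p q) : Matrix (Idx p q) (Idx p q) ℝ) = 1 := by
        rw [← Matrix.SpecialLinearGroup.coe_mul]; simp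
      calc ((g⁻¹ : SL p q) : Matrix (Idx p q) (Idx p q) ℝ)
          = (B.act hXHY (fun d => (A d)ᵀ) * (g : Matrix (Idx p q) (Idx p q) ℝ)) *
            ((g⁻¹ : SL p q) : Matrix (Idx p q) (Idx p q) ℝ) := by rw [h1, Matrix.one_mul]
        _ = _ := by rw [Matrix.mul_assoc, h2, Matrix.mul_one]

theorem orthogonalSubgroup_le : B.orthogonalSubgroup hXHY ≤ centralizer X H Y := by
  rintro g ⟨A, hA, hg⟩
  exact (B.mem_centralizer_iff hXHY g).mpr ⟨A, fun d => (hA d).2, hg⟩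

theorem isCompact_orthogonal {n : Type*} [Fintype n] [DecidableEq n] (J : Matrix n n ℝ) :
    IsCompact {M : Matrix n n ℝ | Mᵀ * M = 1 ∧ Mᵀ * J * M = J} := by
  refine IsCompact.of_isClosed_subset
    (IsCompact.matrix (m := n) (n := n) (isCompact_Icc (a := (-1 : ℝ)) (b := 1))) ?_ ?_
  · refine IsClosed.inter (isClosed_eq ?_ continuous_const) (isClosed_eq ?_ continuous_const)
    · exact continuous_id.matrix_transpose.matrix_mul continuous_id
    · exact (continuous_id.matrix_transpose.matrix_mul continuous_const).matrix_mul continuous_id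
  · rintro M ⟨hM, -⟩ i j
    have h1 : ∑ k, M k j * M k j = 1 := by
      have := congrFun (congrFun hM j) j
      simpa [Matrix.mul_apply] using this
    have h2 : M i j * M i j ≤ 1 := by
      rw [← h1]
      exact Finset.single_le_sum (f := fun k => M k j * M k j)
        (fun k _ => mul_self_nonneg _) (Finset.mem_univ i)
    exact abs_le.mp (abs_le_one_iff_mul_self_le_one.mpr h2)

/-- It is a continuous image: the families of orthogonal isometries form a product of compact sets
over all `d`, compact by Tychonoff, and determinant `1` cuts out a closed subset. -/
theorem isCompact_orthogonalSubgroup :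
    IsCompact (B.orthogonalSubgroup hXHY : Set (SL p q)) := by
  have hemb : Topology.IsEmbedding
      (fun g : SL p q => (g : Matrix (Idx p q) (Idx p q) ℝ)) := ⟨⟨rfl⟩, Subtype.val_injective⟩
  rw [hemb.isCompact_iff]
  have h1 : IsCompact (Set.pi Set.univ fun d : ℕ =>
      {M : Matrix (Fin (mult X H Y d)) (Fin (mult X H Y d)) ℝ |
        Mᵀ * M = 1 ∧ Mᵀ * B.gram d * M = B.gram d}) :=
    isCompact_univ_pi fun d => isCompact_orthogonal _
  have h2 : IsClosed {A : Fam X H Y | (B.act hXHY A).det = 1} :=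
    isClosed_eq (B.continuous_act hXHY).matrix_det continuous_const
  convert (h1.inter_right h2).image (B.continuous_act hXHY) using 1
  ext M
  constructor
  · rintro ⟨g, ⟨A, hA, hg⟩, rfl⟩
    exact ⟨A, ⟨fun d _ => hA d, by rw [Set.mem_ofPred_eq, ← hg]; exact g.2⟩, hg.symm⟩
  · rintro ⟨A, ⟨hA, hdet⟩, rfl⟩
    exact ⟨⟨_, hdet⟩, ⟨A, fun d => hA d trivial, rfl⟩, rfl⟩

/-- The coordinates of `A_d` are continuous functions of `act A`. -/
theorem exists_continuous_entry (d : ℕ) (i j : Fin (mult X H Y d)) :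
    ∃ φ : Matrix (Idx p q) (Idx p q) ℝ → ℝ, Continuous φ ∧
      ∀ A : Fam X H Y, φ (B.act hXHY A) = A d i j := by
  have hd : d ∈ parts X H Y := by
    rw [mem_parts hXHY]; exact (Fin.pos j).ne'
  have hpos := pos_of_mem_parts hXHY hd
  let φ : Matrix (Idx p q) (Idx p q) ℝ →ₗ[ℝ] ℝ :=
    { toFun := fun M => (B.strBasis hXHY).repr (M *ᵥ B.xv d 0 j) ⟨⟨⟨d, hd⟩, ⟨0, hpos⟩⟩, i⟩
      map_add' := fun M N => by simp [Matrix.add_mulVec]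
      map_smul' := fun c M => by simp [Matrix.smul_mulVec] }
  refine ⟨φ, LinearMap.continuous_of_finiteDimensional φ, fun A => ?_⟩
  change (B.strBasis hXHY).repr (B.act hXHY A *ᵥ B.xv d 0 j) ⟨⟨⟨d, hd⟩, ⟨0, hpos⟩⟩, i⟩ = _
  have h1 : ∀ k : Fin (mult X H Y d), B.xv d 0 k =
      B.strBasis hXHY ⟨⟨⟨d, hd⟩, ⟨0, hpos⟩⟩, k⟩ := fun k => by rw [strBasis_apply]
  rw [act_xv, map_sum, Finsupp.finsetSum_apply, Finset.sum_eq_single i]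
  · rw [h1, map_smul, Module.Basis.repr_self]; simp
  · intro k _ hk
    rw [h1, map_smul, Module.Basis.repr_self, Finsupp.smul_apply,
      Finsupp.single_eq_of_ne (by simpa using hk.symm), smul_zero]
  · simp

/-- An element of a larger compact group is split by polar decomposition in every `L(d-1)`. The
orthogonal factor already lies in the subgroup, so the positive factor lies in the larger group,
where its powers stay bounded; this makes it trivial. -/
theorem maximal_orthogonalSubgroup :
    Maximal (fun S : Subgroup (SL p q) =>
      S ≤ centralizer X H Y ∧ IsCompact (S : Set (SL p q))) (B.orthogonalSubgroup hXHY) := by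
  refine ⟨⟨B.orthogonalSubgroup_le hXHY, B.isCompact_orthogonalSubgroup hXHY⟩, ?_⟩
  rintro S ⟨hSZ, hS⟩ hKS g hg
  obtain ⟨A, hA, hgA⟩ := (B.mem_centralizer_iff hXHY g).mp (hSZ hg)
  choose K P hAKP hK hKJ hPJ hP using fun d => exists_polar (B.gram_transpose_mul hXHY d) (hA d)
  -- Both factors must have determinant `1` to define elements of `SL`: an isometry has determinant
  -- `±1`, and that of a positive definite matrix is positive.
  have hPdet : ∀ d, (P d).det = 1 := by
    intro d
    have h1 := congrArg Matrix.det (hPJ d)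
    rw [Matrix.det_mul, Matrix.det_mul, Matrix.det_transpose] at h1
    have h2 := B.gram_det_ne_zero hXHY d
    have h3 : (P d).det * (P d).det = 1 := by
      apply mul_right_cancel₀ h2; linear_combination h1
    have h4 := (hP d).det_pos
    nlinarith
  have hgK : (B.act hXHY A) = B.act hXHY K * B.act hXHY P := by
    rw [← map_mul]; congr 1; ext d : 1; exact hAKP d
  have hdetP : (B.act hXHY P).det = 1 := by
    rw [det_act]; simp [hPdet]
  have hdetK : (B.act hXHY K).det = 1 := by
    have := g.2
    rw [hgA, hgK, Matrix.det_mul, hdetP, mul_one] at this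
    exact this
  let k : SL p q := ⟨_, hdetK⟩
  let x : SL p q := ⟨_, hdetP⟩
  have hk : k ∈ B.orthogonalSubgroup hXHY := ⟨K, fun d => ⟨hK d, hKJ d⟩, rfl⟩
  have hgkx : g = k * x := Subtype.ext (hgA.trans hgK)
  have hx : x ∈ S := by
    have := S.mul_mem (S.inv_mem (hKS hk)) hg
    rwa [hgkx, inv_mul_cancel_left] at this
  have hP1 : ∀ d, P d = 1 := by
    intro d
    have hbd : ∀ i j, ∃ C, ∀ n : ℕ, |(P d ^ n) i j| ≤ C := by
      intro i j
      obtain ⟨φ, hφ, hφA⟩ := B.exists_continuous_entry hXHY d i j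
      have hc : Continuous fun s : SL p q => φ s.1 := hφ.comp continuous_subtype_val
      obtain ⟨C, hC⟩ := (hS.image hc).isBounded.exists_norm_le
      refine ⟨C, fun n => ?_⟩
      have h1 : (x ^ n).1 = B.act hXHY (P ^ n) := by
        rw [map_pow]; exact Matrix.SpecialLinearGroup.coe_pow x n
      have h2 := hC _ ⟨x ^ n, S.pow_mem hx n, rfl⟩
      change ‖φ (x ^ n).1‖ ≤ C at h2
      rw [h1, hφA, Real.norm_eq_abs, Pi.pow_apply] at h2
      exact h2
    choose C hC using hbd
    refine eq_one_of_posDef_of_bounded_pow (B.gram_transpose_mul hXHY d) (hP d) (hPJ d)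
      (C := ∑ i, ∑ j, |C i j|) fun n i j => ?_
    calc |(P d ^ n) i j| ≤ |C i j| := (hC i j n).trans (le_abs_self _)
      _ ≤ ∑ j, |C i j| := Finset.single_le_sum (f := fun j => |C i j|)
          (fun _ _ => abs_nonneg _) (Finset.mem_univ j)
      _ ≤ _ := Finset.single_le_sum (f := fun i => ∑ j, |C i j|)
          (fun _ _ => Finset.sum_nonneg fun _ _ => abs_nonneg _) (Finset.mem_univ i)
  have hAK : A = K := by
    ext d : 1; rw [hAKP d, hP1 d, Matrix.mul_one]
  exact ⟨K, fun d => ⟨hK d, hKJ d⟩, by rw [hgA, hAK]⟩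

end AdaptedBasis
end SOpq

/-! ### Orthogonal isometries as `O(a) × O(b)` and `U(m)` -/

namespace SOpq

section Blocks

theorem toSize_self {n : ℕ} (M : Matrix (Fin n) (Fin n) ℝ) : toSize n ⟨n, M⟩ = M := by
  simp [toSize]

theorem det_toSize {n t : ℕ} (h : n = t) (M : Matrix (Fin n) (Fin n) ℝ) :
    (toSize t ⟨n, M⟩).det = M.det := by
  subst h; rw [toSize_self]

/-- The block diagonal matrix of two square blocks. -/
def pairBlock {a b : ℕ} (C : Matrix (Fin a) (Fin a) ℝ) (D : Matrix (Fin b) (Fin b) ℝ) :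
    Matrix (Fin (a + b)) (Fin (a + b)) ℝ :=
  Matrix.reindex finSumFinEquiv finSumFinEquiv (Matrix.fromBlocks C 0 0 D)

theorem det_pairBlock {a b : ℕ} (C : Matrix (Fin a) (Fin a) ℝ) (D : Matrix (Fin b) (Fin b) ℝ) :
    (pairBlock C D).det = C.det * D.det := by
  rw [pairBlock, Matrix.det_reindex_self, Matrix.det_fromBlocks_zero₂₁]

theorem reindex_inj_iff {α β : Type*} (e : α ≃ β) (M N : Matrix α α ℝ) :
    Matrix.reindex e e M = Matrix.reindex e e N ↔ M = N :=
  (Matrix.reindex e e).injective.eq_iff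

theorem reindex_mul {α β : Type*} [Fintype α] [Fintype β] (e : α ≃ β) (M N : Matrix α α ℝ) :
    Matrix.reindex e e M * Matrix.reindex e e N = Matrix.reindex e e (M * N) := by
  simp [Matrix.reindex_apply, Matrix.submatrix_mul_equiv]

theorem signDiagonal_eq (a b : ℕ) :
    (Matrix.diagonal fun j : Fin (a + b) => if (j : ℕ) < a then (1 : ℝ) else -1) =
      Matrix.reindex finSumFinEquiv finSumFinEquiv
        (Matrix.fromBlocks 1 0 0 (-1 : Matrix (Fin b) (Fin b) ℝ)) := by
  rw [← Equiv.symm_apply_eq]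
  ext (i | i) (j | j) <;> have := i.2 <;> have := j.2 <;>
    simp only [Matrix.reindex_symm, Matrix.reindex_apply, Equiv.symm_symm,
      Matrix.submatrix_apply, Matrix.diagonal_apply, finSumFinEquiv_apply_left,
      finSumFinEquiv_apply_right, Fin.val_castAdd, Fin.val_natAdd, Matrix.fromBlocks_apply₁₁,
      Matrix.fromBlocks_apply₁₂, Matrix.fromBlocks_apply₂₁, Matrix.fromBlocks_apply₂₂,
      Matrix.one_apply, Matrix.zero_apply, Matrix.neg_apply, Fin.ext_iff] <;>
    split_ifs <;> first | omega | norm_num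

theorem symplecticMatrix_eq (m : ℕ) :
    (Matrix.of fun i j : Fin (m + m) => if (j : ℕ) = i + m then (1 : ℝ)
      else if (i : ℕ) = j + m then -1 else 0) =
      Matrix.reindex finSumFinEquiv finSumFinEquiv
        (Matrix.fromBlocks 0 1 (-1 : Matrix (Fin m) (Fin m) ℝ) 0) := by
  rw [← Equiv.symm_apply_eq]
  ext (i | i) (j | j) <;> have := i.2 <;> have := j.2 <;>
    simp only [Matrix.reindex_symm, Matrix.reindex_apply, Equiv.symm_symm,
      Matrix.submatrix_apply, Matrix.of_apply, finSumFinEquiv_apply_left,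
      finSumFinEquiv_apply_right, Fin.val_castAdd, Fin.val_natAdd, Matrix.fromBlocks_apply₁₁,
      Matrix.fromBlocks_apply₁₂, Matrix.fromBlocks_apply₂₁, Matrix.fromBlocks_apply₂₂,
      Matrix.one_apply, Matrix.zero_apply, Matrix.neg_apply, Fin.ext_iff] <;>
    split_ifs <;> first | omega | norm_num

/-- For an orthogonal matrix the transpose is the inverse, so preserving `J` is the same as
commuting with `J`. The two intersections below are computed as commutants. -/
theorem commute_of_isometry {n : Type*} [Fintype n] [DecidableEq n] {M J : Matrix n n ℝ}
    (h1 : Mᵀ * M = 1) (h2 : Mᵀ * J * M = J) : J * M = M * J := by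
  have h1' := mul_eq_one_comm.mp h1
  calc J * M = (M * Mᵀ) * J * M := by rw [h1', Matrix.one_mul]
    _ = M * (Mᵀ * J * M) := by simp only [Matrix.mul_assoc]
    _ = M * J := by rw [h2]

theorem isometry_of_commute {n : Type*} [Fintype n] [DecidableEq n] {M J : Matrix n n ℝ}
    (h1 : Mᵀ * M = 1) (h2 : J * M = M * J) : Mᵀ * J * M = J := by
  rw [Matrix.mul_assoc, h2, ← Matrix.mul_assoc, h1, Matrix.one_mul]

/-- `O(a,b) ∩ O(a+b) = O(a) × O(b)`. -/
theorem exists_pairBlock {a b t : ℕ} (h : a + b = t) {M : Matrix (Fin t) (Fin t) ℝ}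
    (h1 : Mᵀ * M = 1)
    (h2 : Mᵀ * (Matrix.diagonal fun j : Fin t => if (j : ℕ) < a then (1 : ℝ) else -1) * M =
      Matrix.diagonal fun j : Fin t => if (j : ℕ) < a then (1 : ℝ) else -1) :
    ∃ C ∈ Matrix.orthogonalGroup (Fin a) ℝ, ∃ D ∈ Matrix.orthogonalGroup (Fin b) ℝ,
      M = toSize t ⟨_, pairBlock C D⟩ := by
  subst h
  have h3 := commute_of_isometry h1 h2
  obtain ⟨N, rfl⟩ := (Matrix.reindex (finSumFinEquiv (m := a) (n := b)) finSumFinEquiv).surjective M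
  rw [signDiagonal_eq, reindex_mul, reindex_mul, reindex_inj_iff] at h3
  have h4 : Nᵀ * N = 1 := by
    rw [Matrix.transpose_reindex, reindex_mul, ← Matrix.submatrix_one_equiv
      (finSumFinEquiv (m := a) (n := b)).symm] at h1
    exact (reindex_inj_iff _ _ _).mp h1
  obtain ⟨N11, N12, N21, N22, rfl⟩ : ∃ N11 N12 N21 N22, N = Matrix.fromBlocks N11 N12 N21 N22 :=
    ⟨_, _, _, _, (Matrix.fromBlocks_toBlocks N).symm⟩
  simp only [Matrix.fromBlocks_multiply, Matrix.fromBlocks_inj, Matrix.one_mul, Matrix.mul_one,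
    Matrix.zero_mul, Matrix.mul_zero, add_zero, zero_add, Matrix.neg_mul, Matrix.mul_neg] at h3
  -- Commuting with `diag(1, -1)` gives `N12 = -N12`, and likewise for `N21`.
  have h12 : N12 = 0 := by
    have := h3.2.1; ext i j; have := congrFun (congrFun this i) j; simp at this ⊢; linarith
  have h21 : N21 = 0 := by
    have := h3.2.2.1; ext i j; have := congrFun (congrFun this i) j; simp at this ⊢; linarith
  subst h12 h21
  rw [Matrix.fromBlocks_transpose, Matrix.fromBlocks_multiply, ← Matrix.fromBlocks_one,
    Matrix.fromBlocks_inj] at h4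
  simp only [Matrix.transpose_zero, Matrix.mul_zero, add_zero, zero_add] at h4
  refine ⟨N11, ?_, N22, ?_, ?_⟩
  · rw [Matrix.mem_orthogonalGroup_iff']; exact h4.1
  · rw [Matrix.mem_orthogonalGroup_iff']; exact h4.2.2.2
  · rw [toSize_self]; rfl

theorem pairBlock_isometry {a b t : ℕ} (h : a + b = t) {C : Matrix (Fin a) (Fin a) ℝ}
    {D : Matrix (Fin b) (Fin b) ℝ} (hC : C ∈ Matrix.orthogonalGroup (Fin a) ℝ)
    (hD : D ∈ Matrix.orthogonalGroup (Fin b) ℝ) :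
    (toSize t ⟨_, pairBlock C D⟩)ᵀ * toSize t ⟨_, pairBlock C D⟩ = 1 ∧
    (toSize t ⟨_, pairBlock C D⟩)ᵀ *
      (Matrix.diagonal fun j : Fin t => if (j : ℕ) < a then (1 : ℝ) else -1) *
      toSize t ⟨_, pairBlock C D⟩ =
      Matrix.diagonal fun j : Fin t => if (j : ℕ) < a then (1 : ℝ) else -1 := by
  subst h
  rw [Matrix.mem_orthogonalGroup_iff'] at hC hD
  rw [toSize_self, pairBlock]
  have h1 : (Matrix.reindex finSumFinEquiv finSumFinEquiv (Matrix.fromBlocks C 0 0 D))ᵀ *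
      Matrix.reindex finSumFinEquiv finSumFinEquiv (Matrix.fromBlocks C 0 0 D) = 1 := by
    rw [Matrix.transpose_reindex, reindex_mul, Matrix.fromBlocks_transpose,
      Matrix.fromBlocks_multiply]
    rw [show Cᵀ * C = 1 from hC, show Dᵀ * D = 1 from hD]
    simp
  refine ⟨h1, isometry_of_commute h1 ?_⟩
  rw [signDiagonal_eq, reindex_mul, reindex_mul]
  simp [Matrix.fromBlocks_multiply]

theorem mem_unitaryGroup_iff_re_im {m : ℕ} (U : Matrix (Fin m) (Fin m) ℂ) :
    U ∈ Matrix.unitaryGroup (Fin m) ℂ ↔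
      (U.map Complex.re)ᵀ * U.map Complex.re + (U.map Complex.im)ᵀ * U.map Complex.im = 1 ∧
      (U.map Complex.re)ᵀ * U.map Complex.im = (U.map Complex.im)ᵀ * U.map Complex.re := by
  rw [Matrix.mem_unitaryGroup_iff', ← Matrix.ext_iff, ← Matrix.ext_iff, ← Matrix.ext_iff,
    ← forall_and]
  refine forall_congr' fun i => ?_
  rw [← forall_and]
  refine forall_congr' fun j => ?_
  rw [Complex.ext_iff]
  refine and_congr ?_ ?_
  · simp only [Matrix.mul_apply, Matrix.add_apply, Matrix.star_apply, Complex.re_sum,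
      Matrix.transpose_apply, Matrix.map_apply, ← Finset.sum_add_distrib]
    have h1 : ∀ k, (star (U k i) * U k j).re =
        (U k i).re * (U k j).re + (U k i).im * (U k j).im := fun k => by simp
    simp only [h1, Matrix.one_apply]
    split_ifs <;> simp
  · simp only [Matrix.mul_apply, Matrix.star_apply, Complex.im_sum,
      Matrix.transpose_apply, Matrix.map_apply]
    have h1 : ∀ k, (star (U k i) * U k j).im =
        (U k i).re * (U k j).im - (U k i).im * (U k j).re := fun k => by simp; ring
    simp only [h1, Matrix.one_apply, Finset.sum_sub_distrib]
    rw [← sub_eq_zero (a := ∑ k, (U k i).re * (U k j).im)]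
    split_ifs <;> simp

/-- `Sp(2m, ℝ) ∩ O(2m) = U(m)`. -/
theorem exists_wp {m t : ℕ} (h : m + m = t) {M : Matrix (Fin t) (Fin t) ℝ}
    (h1 : Mᵀ * M = 1)
    (h2 : Mᵀ * (Matrix.of fun i j : Fin t => if (j : ℕ) = i + m then (1 : ℝ)
      else if (i : ℕ) = j + m then -1 else 0) * M =
      Matrix.of fun i j : Fin t => if (j : ℕ) = i + m then (1 : ℝ)
      else if (i : ℕ) = j + m then -1 else 0) :
    ∃ U ∈ Matrix.unitaryGroup (Fin m) ℂ, M = toSize t ⟨_, wp U⟩ := by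
  subst h
  have h3 := commute_of_isometry h1 h2
  obtain ⟨N, rfl⟩ := (Matrix.reindex (finSumFinEquiv (m := m) (n := m)) finSumFinEquiv).surjective M
  rw [symplecticMatrix_eq, reindex_mul, reindex_mul, reindex_inj_iff] at h3
  have h4 : Nᵀ * N = 1 := by
    rw [Matrix.transpose_reindex, reindex_mul, ← Matrix.submatrix_one_equiv
      (finSumFinEquiv (m := m) (n := m)).symm] at h1
    exact (reindex_inj_iff _ _ _).mp h1
  obtain ⟨N11, N12, N21, N22, rfl⟩ : ∃ N11 N12 N21 N22, N = Matrix.fromBlocks N11 N12 N21 N22 :=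
    ⟨_, _, _, _, (Matrix.fromBlocks_toBlocks N).symm⟩
  simp only [Matrix.fromBlocks_multiply, Matrix.fromBlocks_inj, Matrix.one_mul, Matrix.mul_one,
    Matrix.zero_mul, Matrix.mul_zero, add_zero, zero_add, Matrix.neg_mul, Matrix.mul_neg] at h3
  obtain ⟨h5, rfl, -, -⟩ := h3
  obtain rfl : N12 = -N21 := by rw [h5, neg_neg]
  rw [Matrix.fromBlocks_transpose, Matrix.fromBlocks_multiply, ← Matrix.fromBlocks_one,
    Matrix.fromBlocks_inj] at h4
  -- Commuting with the symplectic matrix has left the shape `(S, -T; T, S)`; its complex matrix is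
  -- `S + iT`, unitary because the real one is orthogonal.
  let U : Matrix (Fin m) (Fin m) ℂ := Matrix.of fun i j => ⟨N22 i j, N21 i j⟩
  have hre : U.map Complex.re = N22 := by ext i j; rfl
  have him : U.map Complex.im = N21 := by ext i j; rfl
  refine ⟨U, ?_, ?_⟩
  · rw [mem_unitaryGroup_iff_re_im, hre, him]
    refine ⟨h4.1, ?_⟩
    have := h4.2.1
    rw [Matrix.mul_neg] at this
    exact (neg_add_eq_zero.mp this)
  · rw [toSize_self, wp, hre, him]

theorem symplecticMatrix_mul_wp {m t : ℕ} (h : m + m = t) (U : Matrix (Fin m) (Fin m) ℂ) :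
    (Matrix.of fun i j : Fin t => if (j : ℕ) = i + m then (1 : ℝ)
      else if (i : ℕ) = j + m then -1 else 0) * toSize t ⟨_, wp U⟩ =
    toSize t ⟨_, wp U⟩ * (Matrix.of fun i j : Fin t => if (j : ℕ) = i + m then (1 : ℝ)
      else if (i : ℕ) = j + m then -1 else 0) := by
  subst h
  rw [toSize_self, wp, symplecticMatrix_eq, reindex_mul, reindex_mul]
  simp [Matrix.fromBlocks_multiply]

theorem wp_isometry {m t : ℕ} (h : m + m = t) {U : Matrix (Fin m) (Fin m) ℂ}
    (hU : U ∈ Matrix.unitaryGroup (Fin m) ℂ) :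
    (toSize t ⟨_, wp U⟩)ᵀ * toSize t ⟨_, wp U⟩ = 1 ∧
    (toSize t ⟨_, wp U⟩)ᵀ * (Matrix.of fun i j : Fin t => if (j : ℕ) = i + m then (1 : ℝ)
      else if (i : ℕ) = j + m then -1 else 0) * toSize t ⟨_, wp U⟩ =
      Matrix.of fun i j : Fin t => if (j : ℕ) = i + m then (1 : ℝ)
      else if (i : ℕ) = j + m then -1 else 0 := by
  have hcomm := symplecticMatrix_mul_wp h U
  subst h
  obtain ⟨h1, h2⟩ := (mem_unitaryGroup_iff_re_im U).mp hU
  rw [toSize_self, wp] at *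
  have h3 : (Matrix.reindex finSumFinEquiv finSumFinEquiv
      (Matrix.fromBlocks (U.map Complex.re) (-(U.map Complex.im))
      (U.map Complex.im) (U.map Complex.re)))ᵀ * Matrix.reindex finSumFinEquiv finSumFinEquiv
      (Matrix.fromBlocks (U.map Complex.re) (-(U.map Complex.im))
      (U.map Complex.im) (U.map Complex.re)) = 1 := by
    rw [Matrix.transpose_reindex, reindex_mul, Matrix.fromBlocks_transpose,
      Matrix.fromBlocks_multiply, h1]
    simp only [Matrix.mul_neg, Matrix.transpose_neg, Matrix.neg_mul, neg_neg, h2, neg_add_cancel]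
    rw [add_comm (_ * _) (_ * _), h1]
    simp
  exact ⟨h3, isometry_of_commute h3 hcomm⟩

end Blocks

/-! ### Block data and families of isometries -/

section Parts

variable {p q : ℕ} {X H Y : so p q}

theorem mem_evenParts {d : ℕ} : d ∈ evenParts X H Y ↔ d ∈ parts X H Y ∧ d % 2 = 0 :=
  Finset.mem_filter

theorem mem_oddParts1 {d : ℕ} : d ∈ oddParts1 X H Y ↔ d ∈ parts X H Y ∧ d % 4 = 1 :=
  Finset.mem_filter

theorem mem_oddParts3 {d : ℕ} : d ∈ oddParts3 X H Y ↔ d ∈ parts X H Y ∧ d % 4 = 3 :=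
  Finset.mem_filter

theorem prod_parts (f : ℕ → ℝ) : ∏ d ∈ parts X H Y, f d =
    (∏ d ∈ evenParts X H Y, f d) * (∏ d ∈ oddParts1 X H Y, f d) *
      ∏ d ∈ oddParts3 X H Y, f d := by
  have h1 : parts X H Y = (evenParts X H Y ∪ oddParts1 X H Y) ∪ oddParts3 X H Y := by
    ext d
    simp only [Finset.mem_union, mem_evenParts, mem_oddParts1, mem_oddParts3]
    constructor
    · intro h
      have : d % 2 = 0 ∨ d % 4 = 1 ∨ d % 4 = 3 := by omega
      tauto
    · tauto
  conv_lhs => rw [h1]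
  rw [Finset.prod_union, Finset.prod_union]
  · rw [Finset.disjoint_left]
    intro d h h'
    rw [mem_evenParts] at h; rw [mem_oddParts1] at h'; omega
  · rw [Finset.disjoint_left]
    intro d h h'
    rw [Finset.mem_union, mem_evenParts, mem_oddParts1] at h; rw [mem_oddParts3] at h'; omega

end Parts

namespace AdaptedBasis

variable {p q : ℕ} {X H Y : so p q} {B : AdaptedBasis X H Y}

/-- The family of endomorphisms of the `L(d-1)` given by a block datum. -/
def BlockData.fam (g : B.BlockData) : Fam X H Y := fun d =>
  if h : d ∈ evenParts X H Y then toSize _ ⟨_, wp (g.A ⟨d, h⟩)⟩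
  else if h : d ∈ oddParts1 X H Y then toSize _ ⟨_, pairBlock (g.C ⟨d, h⟩) (g.D ⟨d, h⟩)⟩
  else if h : d ∈ oddParts3 X H Y then toSize _ ⟨_, pairBlock (g.E ⟨d, h⟩) (g.F ⟨d, h⟩)⟩
  else 1

theorem BlockData.fam_even (g : B.BlockData) (d : evenParts X H Y) :
    g.fam d = toSize _ ⟨_, wp (g.A d)⟩ := by
  rw [fam, dif_pos d.2]

theorem BlockData.fam_odd1 (g : B.BlockData) (d : oddParts1 X H Y) :
    g.fam d = toSize _ ⟨_, pairBlock (g.C d) (g.D d)⟩ := by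
  have h := mem_oddParts1.mp d.2
  rw [fam, dif_neg (by rw [mem_evenParts]; omega), dif_pos d.2]

theorem BlockData.fam_odd3 (g : B.BlockData) (d : oddParts3 X H Y) :
    g.fam d = toSize _ ⟨_, pairBlock (g.E d) (g.F d)⟩ := by
  have h := mem_oddParts3.mp d.2
  rw [fam, dif_neg (by rw [mem_evenParts]; omega), dif_neg (by rw [mem_oddParts1]; omega),
    dif_pos d.2]

theorem pos_add_neg (B : AdaptedBasis X H Y) {d : ℕ} (hd : Odd d) :
    B.pos d + B.neg d = mult X H Y d := by
  have := B.pos_le d hd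
  rw [neg]; omega

theorem half_add_half (B : AdaptedBasis X H Y) (hXHY : IsSl2Triple H X Y) {d : ℕ} (hd : Even d) :
    mult X H Y d / 2 + mult X H Y d / 2 = mult X H Y d := by
  obtain ⟨m, hm⟩ := B.even_mult hXHY hd
  omega

theorem odd_of_mem1 {d : ℕ} (h : d ∈ oddParts1 X H Y) : Odd d := by
  have := mem_oddParts1.mp h
  exact Nat.odd_iff.mpr (by omega)

theorem odd_of_mem3 {d : ℕ} (h : d ∈ oddParts3 X H Y) : Odd d := by
  have := mem_oddParts3.mp h
  exact Nat.odd_iff.mpr (by omega)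

theorem even_of_mem {d : ℕ} (h : d ∈ evenParts X H Y) : Even d :=
  Nat.even_iff.mpr (mem_evenParts.mp h).2

theorem gram_even_eq (B : AdaptedBasis X H Y) {d : ℕ} (hd : Even d) : B.gram d =
    Matrix.of fun i j : Fin (mult X H Y d) => if (j : ℕ) = i + mult X H Y d / 2 then (1 : ℝ)
      else if (i : ℕ) = j + mult X H Y d / 2 then -1 else 0 := by
  ext i j; exact B.gram_even hd i j

theorem BlockData.fam_isometry (hXHY : IsSl2Triple H X Y) {g : B.BlockData}
    (hg : g.IsCompactType) (d : ℕ) :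
    (g.fam d)ᵀ * g.fam d = 1 ∧ (g.fam d)ᵀ * B.gram d * g.fam d = B.gram d := by
  by_cases h0 : d ∈ evenParts X H Y
  · rw [B.gram_even_eq (even_of_mem h0), g.fam_even ⟨d, h0⟩]
    exact wp_isometry (B.half_add_half hXHY (even_of_mem h0)) (hg.1 ⟨d, h0⟩)
  · by_cases h1 : d ∈ oddParts1 X H Y
    · rw [B.gram_odd (odd_of_mem1 h1), g.fam_odd1 ⟨d, h1⟩]
      exact pairBlock_isometry (B.pos_add_neg (odd_of_mem1 h1)) (hg.2.1 ⟨d, h1⟩).1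
        (hg.2.1 ⟨d, h1⟩).2
    · by_cases h3 : d ∈ oddParts3 X H Y
      · rw [B.gram_odd (odd_of_mem3 h3), g.fam_odd3 ⟨d, h3⟩]
        exact pairBlock_isometry (B.pos_add_neg (odd_of_mem3 h3)) (hg.2.2 ⟨d, h3⟩).1
          (hg.2.2 ⟨d, h3⟩).2
      · rw [fam, dif_neg h0, dif_neg h1, dif_neg h3]
        simp

theorem exists_blockData (hXHY : IsSl2Triple H X Y) {A : Fam X H Y}
    (hA : ∀ d, (A d)ᵀ * A d = 1 ∧ (A d)ᵀ * B.gram d * A d = B.gram d) :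
    ∃ g : B.BlockData, g.IsCompactType ∧ A = g.fam := by
  have h0 : ∀ d : evenParts X H Y, ∃ U ∈ Matrix.unitaryGroup (Fin (mult X H Y d / 2)) ℂ,
      A d = toSize _ ⟨_, wp U⟩ := fun d =>
    exists_wp (B.half_add_half hXHY (even_of_mem d.2)) (hA d).1
      (by rw [← B.gram_even_eq (even_of_mem d.2)]; exact (hA d).2)
  have h1 : ∀ d : oddParts1 X H Y, ∃ C ∈ Matrix.orthogonalGroup (Fin (B.pos d)) ℝ,
      ∃ D ∈ Matrix.orthogonalGroup (Fin (B.neg d)) ℝ, A d = toSize _ ⟨_, pairBlock C D⟩ :=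
    fun d => exists_pairBlock (B.pos_add_neg (odd_of_mem1 d.2)) (hA d).1
      (by rw [← B.gram_odd (odd_of_mem1 d.2)]; exact (hA d).2)
  have h3 : ∀ d : oddParts3 X H Y, ∃ C ∈ Matrix.orthogonalGroup (Fin (B.pos d)) ℝ,
      ∃ D ∈ Matrix.orthogonalGroup (Fin (B.neg d)) ℝ, A d = toSize _ ⟨_, pairBlock C D⟩ :=
    fun d => exists_pairBlock (B.pos_add_neg (odd_of_mem3 d.2)) (hA d).1
      (by rw [← B.gram_odd (odd_of_mem3 d.2)]; exact (hA d).2)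
  choose U hU hAU using h0
  choose C hC D hD hACD using h1
  choose E hE F hF hAEF using h3
  let g : B.BlockData := ⟨U, C, D, E, F⟩
  refine ⟨g, ⟨hU, fun d => ⟨hC d, hD d⟩, fun d => ⟨hE d, hF d⟩⟩, ?_⟩
  ext d : 1
  by_cases h0 : d ∈ evenParts X H Y
  · exact (hAU ⟨d, h0⟩).trans (g.fam_even ⟨d, h0⟩).symm
  · by_cases h1 : d ∈ oddParts1 X H Y
    · exact (hACD ⟨d, h1⟩).trans (g.fam_odd1 ⟨d, h1⟩).symm
    · by_cases h3 : d ∈ oddParts3 X H Y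
      · exact (hAEF ⟨d, h3⟩).trans (g.fam_odd3 ⟨d, h3⟩).symm
      -- Outside the set of dimensions the multiplicity is zero, so the matrices are empty and there
      -- is nothing to compare.
      · have hd : d ∉ parts X H Y := by
          rw [mem_evenParts] at h0; rw [mem_oddParts1] at h1; rw [mem_oddParts3] at h3
          intro h
          have : d % 2 = 0 ∨ d % 4 = 1 ∨ d % 4 = 3 := by omega
          tauto
        have := mult_eq_zero hXHY hd
        ext i
        exact absurd i.2 (by omega)

theorem pow_odd_of_orthogonal {n : Type*} [Fintype n] [DecidableEq n] {C : Matrix n n ℝ}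
    (hC : C ∈ Matrix.orthogonalGroup n ℝ) {d : ℕ} (hd : Odd d) : C.det ^ d = C.det := by
  have h1 : C.det * C.det = 1 := by
    rw [Matrix.mem_orthogonalGroup_iff] at hC
    have := congrArg Matrix.det hC
    simpa [Matrix.star_eq_conjTranspose] using this
  obtain ⟨k, rfl⟩ := hd
  rw [pow_succ, pow_mul, sq, h1, one_pow, one_mul]

/-- An even power `d` splits equally into the factors `d / 2` of `χ_p` and `χ_q`. For odd `d` the
determinants of the orthogonal blocks are `±1`, so their `d`-th powers equal the determinants
themselves. -/
theorem BlockData.det_act (hXHY : IsSl2Triple H X Y) {g : B.BlockData} (hg : g.IsCompactType) :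
    (B.act hXHY g.fam).det = g.chiP * g.chiQ := by
  rw [AdaptedBasis.det_act, prod_parts, ← Finset.prod_coe_sort (evenParts X H Y),
    ← Finset.prod_coe_sort (oddParts1 X H Y), ← Finset.prod_coe_sort (oddParts3 X H Y)]
  have h0 : ∀ d : evenParts X H Y, (g.fam d).det ^ (d : ℕ) =
      (wp (g.A d)).det ^ ((d : ℕ) / 2) * (wp (g.A d)).det ^ ((d : ℕ) / 2) := by
    intro d
    obtain ⟨k, hk⟩ := even_of_mem d.2
    rw [g.fam_even, det_toSize (B.half_add_half hXHY (even_of_mem d.2)), ← pow_add]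
    congr 1; omega
  have h1 : ∀ d : oddParts1 X H Y, (g.fam d).det ^ (d : ℕ) = (g.C d).det * (g.D d).det := by
    intro d
    rw [g.fam_odd1, det_toSize (B.pos_add_neg (odd_of_mem1 d.2)), det_pairBlock, mul_pow,
      pow_odd_of_orthogonal (hg.2.1 d).1 (odd_of_mem1 d.2),
      pow_odd_of_orthogonal (hg.2.1 d).2 (odd_of_mem1 d.2)]
  have h3 : ∀ d : oddParts3 X H Y, (g.fam d).det ^ (d : ℕ) = (g.E d).det * (g.F d).det := by
    intro d
    rw [g.fam_odd3, det_toSize (B.pos_add_neg (odd_of_mem3 d.2)), det_pairBlock, mul_pow,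
      pow_odd_of_orthogonal (hg.2.2 d).1 (odd_of_mem3 d.2),
      pow_odd_of_orthogonal (hg.2.2 d).2 (odd_of_mem3 d.2)]
  simp only [h0, h1, h3, Finset.prod_mul_distrib, chiP, chiQ]
  ring

end AdaptedBasis
end SOpq

/-! ### The action on ordered sets of vectors -/

namespace SOpq

section MatrixOn

variable {p q : ℕ}

/-- The matrix `G` acts on the ordered set `L` by the matrix `M`. -/
def MatrixOn {m : ℕ} (G : Matrix (Idx p q) (Idx p q) ℝ) (L : List (Vec p q))
    (M : Matrix (Fin m) (Fin m) ℝ) : Prop :=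
  ∃ u : Fin m → Vec p q, List.ofFn u = L ∧ ∀ j, G *ᵥ u j = ∑ i, M i j • u i

theorem hasMatrix_iff {m : ℕ} (g : SL p q) (L : List (Vec p q)) (M : Matrix (Fin m) (Fin m) ℝ) :
    HasMatrix g L M ↔ MatrixOn (g : Matrix (Idx p q) (Idx p q) ℝ) L M := Iff.rfl

variable {G : Matrix (Idx p q) (Idx p q) ℝ}

theorem MatrixOn.length_eq {m : ℕ} {L : List (Vec p q)} {M : Matrix (Fin m) (Fin m) ℝ}
    (h : MatrixOn G L M) : m = L.length := by
  obtain ⟨u, rfl, -⟩ := h; simp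

theorem MatrixOn.mulVec_mem {m : ℕ} {L : List (Vec p q)} {M : Matrix (Fin m) (Fin m) ℝ}
    (h : MatrixOn G L M) : ∀ w ∈ spanList L, G *ᵥ w ∈ spanList L := by
  obtain ⟨u, rfl, hu⟩ := h
  have h1 : spanList (List.ofFn u) ≤ (spanList (List.ofFn u)).comap G.mulVecLin := by
    refine Submodule.span_le.mpr ?_
    intro v hv
    obtain ⟨j, rfl⟩ := (List.mem_ofFn' u v).mp hv
    change G *ᵥ u j ∈ spanList (List.ofFn u)
    rw [hu]
    exact Submodule.sum_mem _ fun i _ => Submodule.smul_mem _ _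
      (Submodule.subset_span ((List.mem_ofFn' u _).mpr ⟨i, rfl⟩))
  exact fun w hw => h1 hw

theorem ofFn_eq_map_range {α : Type*} (n : ℕ) (f : ℕ → α) :
    List.ofFn (fun i : Fin n => f i) = (List.range n).map f := by
  apply List.ext_getElem <;> simp

theorem matrixOn_map_range {m : ℕ} (f : ℕ → Vec p q) {M : Matrix (Fin m) (Fin m) ℝ}
    (h : ∀ j : Fin m, G *ᵥ f j = ∑ i : Fin m, M i j • f i) :
    MatrixOn G ((List.range m).map f) M :=
  ⟨fun i => f i, ofFn_eq_map_range m f, h⟩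

theorem matrixOn_nil : MatrixOn G [] (directSum []).2 :=
  ⟨fun _ => 0, rfl, fun j => j.elim0⟩

theorem MatrixOn.append {L L' : List (Vec p q)} {S : SqBlock} {T : List SqBlock}
    (h : MatrixOn G L S.2) (h' : MatrixOn G L' (directSum T).2) :
    MatrixOn G (L ++ L') (directSum (S :: T)).2 := by
  obtain ⟨m, A⟩ := S
  obtain ⟨u, rfl, hu⟩ := h
  obtain ⟨u', rfl, hu'⟩ := h'
  refine ⟨Fin.append u u', List.ofFn_fin_append u u', fun j => ?_⟩
  change _ = ∑ i : Fin (m + (directSum T).1), _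
  rw [Fin.sum_univ_add]
  refine Fin.addCases (fun j => ?_) (fun j => ?_) j
  · rw [Fin.append_left, hu]
    simp [directSum]
  · rw [Fin.append_right, hu']
    simp [directSum]

theorem MatrixOn.take {L : List (Vec p q)} {m : ℕ} {A : Matrix (Fin m) (Fin m) ℝ}
    {T : List SqBlock} (h : MatrixOn G L (directSum (⟨m, A⟩ :: T)).2) :
    MatrixOn G (L.take m) A := by
  obtain ⟨u, rfl, hu⟩ := h
  refine ⟨fun i => u (Fin.castAdd _ i), ?_, fun j => ?_⟩
  · apply List.ext_getElem
    · rw [List.length_ofFn, List.length_take, List.length_ofFn]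
      exact (min_eq_left (Nat.le_add_right _ _)).symm
    · intro i h1 h2
      simp
      rfl
  · have h1 := hu (Fin.castAdd _ j)
    rw [h1]
    change ∑ i : Fin (m + (directSum T).1), _ = _
    rw [Fin.sum_univ_add]
    simp [directSum]

theorem sum_toSize {n t : ℕ} (h : n = t) (M : Matrix (Fin n) (Fin n) ℝ) {f : ℕ → Vec p q}
    (hf : ∀ j : Fin t, G *ᵥ f j = ∑ i : Fin t, toSize t ⟨n, M⟩ i j • f i) (j : Fin n) :
    G *ᵥ f j = ∑ i : Fin n, M i j • f i := by
  subst h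
  rw [hf, toSize_self]

theorem sum_pairBlock {a b : ℕ} {C : Matrix (Fin a) (Fin a) ℝ} {D : Matrix (Fin b) (Fin b) ℝ}
    {f : ℕ → Vec p q}
    (hf : ∀ j : Fin (a + b), G *ᵥ f j = ∑ i : Fin (a + b), pairBlock C D i j • f i) :
    (∀ j : Fin a, G *ᵥ f j = ∑ i : Fin a, C i j • f i) ∧
    ∀ j : Fin b, G *ᵥ f (a + j) = ∑ i : Fin b, D i j • f (a + i) := by
  constructor
  · intro j
    have := hf (Fin.castAdd b j)
    rw [Fin.sum_univ_add] at this
    simpa [pairBlock] using this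
  · intro j
    have := hf (Fin.natAdd a j)
    rw [Fin.sum_univ_add] at this
    simpa [pairBlock] using this

end MatrixOn

/-! ### The vectors `w`: their squares and the action on them -/

namespace AdaptedBasis

variable {p q : ℕ} {X H Y : so p q} (B : AdaptedBasis X H Y)

theorem inv_sqrt_two_mul_self : (√2 : ℝ)⁻¹ * (√2)⁻¹ = 1 / 2 := by
  rw [← mul_inv, Real.mul_self_sqrt (by norm_num)]; norm_num

/-- With `θ = 2k + 1` the middle index is `k`, even exactly when `θ ≡ 1` mod `4`. So the sign
prescribed there is `(-1)^k`, and the middle case joins the case `l < k`. -/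
theorem cmpSign_eq {θ k l : ℕ} (hk : θ = 2 * k + 1) :
    cmpSign θ l = if l ≤ k then (-1) ^ l else (-1) ^ (l + 1) := by
  have h1 : (θ - 1) / 2 = k := by omega
  rw [cmpSign, h1]
  rcases lt_trichotomy l k with h | h | h
  · rw [if_pos h, if_pos h.le]
  · subst h
    rw [if_neg (lt_irrefl _), if_pos rfl, if_pos le_rfl]
    rcases Nat.even_or_odd l with hl | hl
    · rw [hl.neg_one_pow, if_pos]
      obtain ⟨c, hc⟩ := hl; omega
    · rw [hl.neg_one_pow, if_neg]
      obtain ⟨c, hc⟩ := hl; omega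
  · rw [if_neg (by omega), if_neg (by omega), if_neg (by omega)]

theorem cmpSign_eq_or {θ : ℕ} (hθ : Odd θ) (l : ℕ) : cmpSign θ l = 1 ∨ cmpSign θ l = -1 := by
  obtain ⟨k, hk⟩ := hθ
  rw [cmpSign_eq hk]
  split_ifs
  · exact neg_one_pow_eq_or ℝ l
  · exact neg_one_pow_eq_or ℝ (l + 1)

theorem cmpSign_zero {θ : ℕ} (hθ : Odd θ) : cmpSign θ 0 = 1 := by
  obtain ⟨k, hk⟩ := hθ
  rw [cmpSign_eq hk]; simp

theorem wOdd_lt {k j l : ℕ} (h : l < k) :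
    B.wOdd (2 * k + 1) j l = (√2)⁻¹ • (B.xv (2 * k + 1) l j + B.xv (2 * k + 1) (2 * k - l) j) := by
  rw [wOdd, if_pos (by omega)]; rfl

theorem wOdd_eq {k j : ℕ} : B.wOdd (2 * k + 1) j k = B.xv (2 * k + 1) k j := by
  rw [wOdd, if_neg (by omega), if_pos (by omega)]

theorem wOdd_gt {k j l : ℕ} (h : k < l) :
    B.wOdd (2 * k + 1) j l = (√2)⁻¹ • (B.xv (2 * k + 1) (2 * k - l) j - B.xv (2 * k + 1) l j) := by
  rw [wOdd, if_neg (by omega), if_neg (by omega)]; rfl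

theorem neg_one_pow_sub {k l : ℕ} (h : l ≤ 2 * k) : (-1 : ℝ) ^ (2 * k - l) = (-1) ^ l := by
  rcases Nat.even_or_odd l with ⟨c, hc⟩ | ⟨c, hc⟩
  · rw [Even.neg_one_pow ⟨c, hc⟩, Even.neg_one_pow ⟨k - c, by omega⟩]
  · rw [Odd.neg_one_pow ⟨c, hc⟩, Odd.neg_one_pow ⟨k - c - 1, by omega⟩]

/-- The layers `l` and `2k - l` are dual to each other, so the sum and the difference of their
vectors diagonalise the form, with opposite signs. Exponents of equal parity give equal signs, and
this makes the mixed terms cancel when `l + l' = 2k`. -/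
theorem form_wOdd (hXHY : IsSl2Triple H X Y) {θ l l' : ℕ} (hθ : Odd θ) (hl : l < θ)
    (hl' : l' < θ) (i j : Fin (mult X H Y θ)) :
    form (B.wOdd θ i l) (B.wOdd θ j l') = if l = l' then cmpSign θ l * B.gram θ i j else 0 := by
  obtain ⟨k, rfl⟩ := hθ
  have F : ∀ a b, form (B.xv (2 * k + 1) a i) (B.xv (2 * k + 1) b j) =
      if a + b = 2 * k then (-1) ^ a * B.gram _ i j else 0 := by
    intro a b
    split_ifs with h
    · exact B.form_xv (by omega) i j
    · exact B.form_xv_eq_zero hXHY (by omega)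
  have hs := inv_sqrt_two_mul_self
  have hp := neg_one_pow_sub (show l ≤ 2 * k by omega)
  rw [cmpSign_eq rfl]
  rcases lt_trichotomy l k with h | h | h <;> rcases lt_trichotomy l' k with h' | h' | h'
  · rw [wOdd_lt _ h, wOdd_lt _ h']
    simp only [form_smul_left, form_smul_right, form_add_left, form_add_right, F]
    rw [if_neg (show ¬l + l' = 2 * k by omega),
      if_neg (show ¬2 * k - l + (2 * k - l') = 2 * k by omega), if_pos h.le]
    by_cases e : l = l'
    · subst e
      rw [if_pos (by omega), if_pos (by omega), if_pos rfl, hp]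
      linear_combination 2 * ((-1) ^ l * B.gram (2 * k + 1) i j) * hs
    · rw [if_neg (by omega), if_neg (by omega), if_neg e]; ring
  · subst h'
    rw [wOdd_lt _ h, wOdd_eq]
    simp only [form_smul_left, form_add_left, F]
    rw [if_neg (by omega), if_neg (by omega), if_neg (by omega)]; ring
  · rw [wOdd_lt _ h, wOdd_gt _ h', if_neg (show l ≠ l' by omega)]
    simp only [form_smul_left, form_smul_right, form_add_left, form_sub_right, F]
    rw [if_neg (show l + (2 * k - l') ≠ 2 * k by omega),
      if_neg (show 2 * k - l + l' ≠ 2 * k by omega)]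
    by_cases e : l + l' = 2 * k
    · rw [if_pos e, if_pos (by omega), hp]; ring
    · rw [if_neg e, if_neg (by omega)]; ring
  · subst h
    rw [wOdd_eq, wOdd_lt _ h', if_neg (show l ≠ l' by omega)]
    simp only [form_smul_right, form_add_right, F]
    rw [if_neg (by omega), if_neg (by omega)]; ring
  · subst h h'
    rw [wOdd_eq, wOdd_eq, F, if_pos (by omega), if_pos rfl, if_pos le_rfl]
  · subst h
    rw [wOdd_eq, wOdd_gt _ h', if_neg (show l ≠ l' by omega)]
    simp only [form_smul_right, form_sub_right, F]
    rw [if_neg (by omega), if_neg (by omega)]; ring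
  · rw [wOdd_gt _ h, wOdd_lt _ h', if_neg (show l ≠ l' by omega)]
    simp only [form_smul_left, form_smul_right, form_sub_left, form_add_right, F]
    rw [if_neg (show 2 * k - l + l' ≠ 2 * k by omega),
      if_neg (show l + (2 * k - l') ≠ 2 * k by omega)]
    by_cases e : l + l' = 2 * k
    · rw [if_pos (show l + l' = 2 * k from e), if_pos (by omega), hp]; ring
    · rw [if_neg (show ¬l + l' = 2 * k from e), if_neg (by omega)]; ring
  · subst h'
    rw [wOdd_gt _ h, wOdd_eq]
    simp only [form_smul_left, form_sub_left, F]
    rw [if_neg (by omega), if_neg (by omega), if_neg (by omega)]; ring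
  · rw [wOdd_gt _ h, wOdd_gt _ h', if_neg (show ¬l ≤ k by omega)]
    simp only [form_smul_left, form_smul_right, form_sub_left, form_sub_right, F]
    rw [if_neg (show 2 * k - l + (2 * k - l') ≠ 2 * k by omega),
      if_neg (show l + l' ≠ 2 * k by omega)]
    by_cases e : l = l'
    · subst e
      rw [if_pos (by omega), if_pos (by omega), if_pos rfl, hp, pow_succ]
      linear_combination -2 * ((-1) ^ l * B.gram (2 * k + 1) i j) * hs
    · rw [if_neg (by omega), if_neg (by omega), if_neg e]; ring

theorem gram_odd_apply {d : ℕ} (hd : Odd d) (i j : Fin (mult X H Y d)) : B.gram d i j =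
    if i = j then (if (j : ℕ) < B.pos d then 1 else -1) else 0 := by
  exact B.odd_form d hd i j

/-- The matrix `A_d` acts on the `w^θ_{jl}` by the same matrix. -/
theorem act_wOdd {G : Matrix (Idx p q) (Idx p q) ℝ} {θ a b : ℕ} {M : Matrix (Fin a) (Fin a) ℝ}
    (hG : ∀ l, ∀ j : Fin a, G *ᵥ B.xv θ l (b + j) = ∑ i : Fin a, M i j • B.xv θ l (b + i))
    (l : ℕ) (j : Fin a) :
    G *ᵥ B.wOdd θ (b + j) l = ∑ i : Fin a, M i j • B.wOdd θ (b + i) l := by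
  simp only [wOdd]
  split_ifs
  · simp only [Matrix.mulVec_smul, Matrix.mulVec_add, hG, ← Finset.sum_add_distrib,
      Finset.smul_sum, ← smul_add]
    exact Finset.sum_congr rfl fun i _ => smul_comm _ _ _
  · exact hG l j
  · simp only [Matrix.mulVec_smul, Matrix.mulVec_sub, hG, ← Finset.sum_sub_distrib,
      Finset.smul_sum, ← smul_sub]
    exact Finset.sum_congr rfl fun i _ => smul_comm _ _ _

/-- The square of `w^θ_{jl}` is `cmpSign` times the square of `v^θ_j`. Selecting by sign therefore
keeps an initial or a final segment of the indices `j`, and which one is decided by `cmpSign`. -/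
theorem setCsgn_cmpSign (hXHY : IsSl2Triple H X Y) {θ l : ℕ} (hθ : Odd θ) (hl : l < θ) :
    B.setCsgn (cmpSign θ l) θ l = (List.range (B.pos θ)).map (fun j => B.wOdd θ j l) ∧
    B.setCsgn (-cmpSign θ l) θ l =
      (List.range (B.neg θ)).map (fun j => B.wOdd θ (B.pos θ + j) l) := by
  have hsq : cmpSign θ l * cmpSign θ l = 1 := by
    rcases cmpSign_eq_or hθ l with h | h <;> rw [h] <;> norm_num
  have hform : ∀ j, j < mult X H Y θ → form (B.wOdd θ j l) (B.wOdd θ j l) =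
      cmpSign θ l * (if j < B.pos θ then 1 else -1) := by
    intro j hj
    have := B.form_wOdd hXHY hθ hl hl ⟨j, hj⟩ ⟨j, hj⟩
    rw [if_pos rfl, B.gram_odd_apply hθ, if_pos rfl] at this
    exact this
  have hle := B.pos_add_neg hθ
  constructor
  · rw [setCsgn, setC, ← hle, List.range_add, List.map_append, List.filter_append,
      List.filter_eq_self.mpr, List.filter_eq_nil_iff.mpr, List.append_nil]
    · intro v hv
      simp only [List.map_map, List.mem_map, List.mem_range, Function.comp_apply] at hv
      obtain ⟨j, hj, rfl⟩ := hv
      rw [hform _ (by omega), if_neg (by omega), decide_eq_true_eq, not_lt]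
      linarith
    · intro v hv
      simp only [List.mem_map, List.mem_range] at hv
      obtain ⟨j, hj, rfl⟩ := hv
      rw [hform _ (by omega), if_pos (by omega), decide_eq_true_eq]
      linarith
  · rw [setCsgn, setC, ← hle, List.range_add, List.map_append, List.filter_append,
      List.filter_eq_nil_iff.mpr, List.nil_append, List.filter_eq_self.mpr, List.map_map]
    · rfl
    · intro v hv
      simp only [List.map_map, List.mem_map, List.mem_range, Function.comp_apply] at hv
      obtain ⟨j, hj, rfl⟩ := hv
      rw [hform _ (by omega), if_neg (by omega), decide_eq_true_eq]
      linarith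
    · intro v hv
      simp only [List.mem_map, List.mem_range] at hv
      obtain ⟨j, hj, rfl⟩ := hv
      rw [hform _ (by omega), if_pos (by omega), decide_eq_true_eq, not_lt]
      linarith

/-- The partners `± X^(η-1-l) v^η_{j ± t/2}` of the vectors `X^l v^η_j`. -/
def partner (η l : ℕ) (j : Fin (mult X H Y η)) : Vec p q :=
  ∑ k, B.gram η j k • B.xv η (η - 1 - l) k

/-- A row of the Gram matrix has one non-zero entry, so the sum reduces to the vector and sign in
the explicit definition. The sum form replaces the four cases of `wEven` by the two signs in
`wEven_lo` and `wEven_hi`. -/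
theorem partner_eq (hXHY : IsSl2Triple H X Y) {η : ℕ} (hη : Even η) (l : ℕ)
    (j : Fin (mult X H Y η)) : B.partner η l j =
      if (j : ℕ) < mult X H Y η / 2 then B.xv η (η - 1 - l) (j + mult X H Y η / 2)
      else -B.xv η (η - 1 - l) (j - mult X H Y η / 2) := by
  have h2 := B.half_add_half hXHY hη
  have hj := j.2
  rw [partner]
  split_ifs with h
  · rw [Finset.sum_eq_single ⟨j + mult X H Y η / 2, by omega⟩]
    · rw [B.gram_even hη, if_pos rfl, one_smul]
    · intro k _ hk
      have hk' : (k : ℕ) ≠ j + mult X H Y η / 2 := fun h => hk (Fin.ext h)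
      rw [B.gram_even hη, if_neg hk', if_neg (by omega), zero_smul]
    · simp
  · rw [Finset.sum_eq_single ⟨j - mult X H Y η / 2, by omega⟩]
    · rw [B.gram_even hη, if_neg (by simp; omega), if_pos (by simp; omega), neg_smul, one_smul]
    · intro k _ hk
      have hk' : (k : ℕ) ≠ j - mult X H Y η / 2 := fun h => hk (Fin.ext h)
      have := k.2
      rw [B.gram_even hη, if_neg (by omega), if_neg (by omega), zero_smul]
    · simp

theorem wEven_lo (hXHY : IsSl2Triple H X Y) {η : ℕ} (hη : Even η) (l : ℕ)
    (j : Fin (mult X H Y η)) : B.wEven η j l =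
      (√2)⁻¹ • (B.xv η l j + (-1 : ℝ) ^ l • B.partner η l j) := by
  have hj := j.2
  rw [B.partner_eq hXHY hη, wEven]
  split_ifs with h
  · rfl
  · rw [smul_neg, ← sub_eq_add_neg]

theorem wEven_hi (hXHY : IsSl2Triple H X Y) {η : ℕ} (hη : Even η) (l : ℕ)
    (j : Fin (mult X H Y η)) : B.wEven η (mult X H Y η + j) l =
      (√2)⁻¹ • (B.xv η l j - (-1 : ℝ) ^ l • B.partner η l j) := by
  have hj := j.2
  have h2 := B.half_add_half hXHY hη
  rw [B.partner_eq hXHY hη, wEven]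
  rw [if_neg (show ¬mult X H Y η + (j : ℕ) < mult X H Y η / 2 by omega),
    if_neg (show ¬mult X H Y η + (j : ℕ) < mult X H Y η by omega), Nat.add_sub_cancel_left]
  by_cases h : (j : ℕ) < mult X H Y η / 2
  · rw [if_pos (show mult X H Y η + (j : ℕ) < 3 * mult X H Y η / 2 by omega), if_pos h]
    congr 5; omega
  · rw [if_neg (show ¬mult X H Y η + (j : ℕ) < 3 * mult X H Y η / 2 by omega), if_neg h,
      smul_neg, sub_neg_eq_add, show mult X H Y η + (j : ℕ) - 3 * mult X H Y η / 2 =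
        j - mult X H Y η / 2 by omega]

theorem gram_mul_transpose (hXHY : IsSl2Triple H X Y) (d : ℕ) :
    B.gram d * (B.gram d)ᵀ = 1 := mul_eq_one_comm.mp (B.gram_transpose_mul hXHY d)

theorem form_xv_partner (hXHY : IsSl2Triple H X Y) {η l l' : ℕ} (hl : l < η / 2)
    (hl' : l' < η / 2) (i j : Fin (mult X H Y η)) :
    form (B.xv η l i) (B.partner η l' j) =
      if l = l' then (if i = j then (-1) ^ l else 0) else 0 := by
  rw [partner, form_sum_right]
  simp only [form_smul_right]
  split_ifs with h1 h2
  · subst h1 h2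
    have h3 := congrFun (congrFun (B.gram_mul_transpose hXHY η) i) i
    rw [Matrix.mul_apply, Matrix.one_apply_eq] at h3
    simp only [B.form_xv (show l + (η - 1 - l) + 1 = η by omega)]
    refine Eq.trans ?_ ((congrArg (fun x => (-1 : ℝ) ^ l * x) h3).trans (mul_one _))
    rw [Finset.mul_sum]
    exact Finset.sum_congr rfl fun k _ => by rw [Matrix.transpose_apply]; ring
  · subst h1
    have h3 := congrFun (congrFun (B.gram_mul_transpose hXHY η) i) j
    rw [Matrix.mul_apply, Matrix.one_apply_ne h2] at h3
    simp only [B.form_xv (show l + (η - 1 - l) + 1 = η by omega)]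
    refine Eq.trans ?_ ((congrArg (fun x => (-1 : ℝ) ^ l * x) h3).trans (mul_zero _))
    rw [Finset.mul_sum]
    exact Finset.sum_congr rfl fun k _ => by rw [Matrix.transpose_apply]; ring
  · refine Finset.sum_eq_zero fun k _ => ?_
    rw [B.form_xv_eq_zero hXHY (by omega), mul_zero]

theorem form_partner_partner (hXHY : IsSl2Triple H X Y) {η l l' : ℕ} (hl : l < η / 2)
    (hl' : l' < η / 2) (i j : Fin (mult X H Y η)) :
    form (B.partner η l i) (B.partner η l' j) = 0 := by
  rw [partner, partner, form_sum_left]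
  refine Finset.sum_eq_zero fun k _ => ?_
  rw [form_sum_right]
  refine Finset.sum_eq_zero fun k' _ => ?_
  rw [form_smul_left, form_smul_right, B.form_xv_eq_zero hXHY (by omega), mul_zero, mul_zero]

/-- For fixed `l`, the vectors `X^l v_j` and their partners span two isotropic spaces, dual up to
the factor `(-1)^l`. Half-sums and half-differences with that factor have squares `1` and `-1`. -/
theorem form_wEven (hXHY : IsSl2Triple H X Y) {η l l' : ℕ} (hη : Even η) (hl : l < η / 2)
    (hl' : l' < η / 2) (i j : Fin (mult X H Y η)) :
    (form (B.wEven η i l) (B.wEven η j l') = if l = l' ∧ i = j then 1 else 0) ∧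
    (form (B.wEven η (mult X H Y η + i) l) (B.wEven η (mult X H Y η + j) l') =
      if l = l' ∧ i = j then -1 else 0) ∧
    form (B.wEven η i l) (B.wEven η (mult X H Y η + j) l') = 0 := by
  have hs := inv_sqrt_two_mul_self
  have hxx : form (B.xv η l i) (B.xv η l' j) = 0 := B.form_xv_eq_zero hXHY (by omega)
  have hxy := B.form_xv_partner hXHY hl hl' i j
  have hyx := B.form_xv_partner hXHY hl' hl j i
  rw [form_comm] at hyx
  have hyy := B.form_partner_partner hXHY hl hl' i j
  have hsq : ((-1 : ℝ) ^ l) * (-1) ^ l = 1 := by rw [← mul_pow]; norm_num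
  simp only [B.wEven_lo hXHY hη, B.wEven_hi hXHY hη, form_smul_left, form_smul_right,
    form_add_left, form_add_right, form_sub_left, form_sub_right, hxx, hxy, hyx, hyy]
  by_cases h1 : l = l'
  · subst h1
    by_cases h2 : i = j
    · subst h2
      simp only [if_true, and_self]
      refine ⟨?_, ?_, ?_⟩
      · linear_combination 2 * (√2)⁻¹ * (√2)⁻¹ * hsq + 2 * hs
      · linear_combination -2 * (√2)⁻¹ * (√2)⁻¹ * hsq - 2 * hs
      · ring
    · have h3 : ¬j = i := fun h => h2 h.symm
      simp [h2, h3]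
  · have h3 : ¬l' = l := fun h => h1 h.symm
    simp [h1, h3]

/-- The partners arise from the layer `η - 1 - l` by the change of basis `(B.gram η)ᵀ`. Commuting
with it is what lets `M` act on the partners by the same matrix. -/
theorem act_partner {G : Matrix (Idx p q) (Idx p q) ℝ} {η : ℕ}
    {M : Matrix (Fin (mult X H Y η)) (Fin (mult X H Y η)) ℝ}
    (hM : M * (B.gram η)ᵀ = (B.gram η)ᵀ * M)
    (hG : ∀ l, ∀ j : Fin (mult X H Y η), G *ᵥ B.xv η l j = ∑ i, M i j • B.xv η l i)
    (l : ℕ) (j : Fin (mult X H Y η)) :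
    G *ᵥ B.partner η l j = ∑ i, M i j • B.partner η l i := by
  simp only [partner, Matrix.mulVec_sum, Matrix.mulVec_smul, hG, Finset.smul_sum, smul_smul]
  rw [Finset.sum_comm]
  conv_rhs => rw [Finset.sum_comm]
  refine Finset.sum_congr rfl fun k _ => ?_
  rw [← Finset.sum_smul, ← Finset.sum_smul]
  congr 1
  have := congrFun (congrFun hM k) j
  simp only [Matrix.mul_apply, Matrix.transpose_apply] at this
  rw [Finset.sum_congr rfl fun i _ => mul_comm (B.gram η j i) (M k i), this]
  exact Finset.sum_congr rfl fun i _ => mul_comm _ _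

theorem act_wEven (hXHY : IsSl2Triple H X Y) {G : Matrix (Idx p q) (Idx p q) ℝ} {η : ℕ}
    (hη : Even η) {M : Matrix (Fin (mult X H Y η)) (Fin (mult X H Y η)) ℝ}
    (hM : M * (B.gram η)ᵀ = (B.gram η)ᵀ * M)
    (hG : ∀ l, ∀ j : Fin (mult X H Y η), G *ᵥ B.xv η l j = ∑ i, M i j • B.xv η l i)
    (l : ℕ) (j : Fin (mult X H Y η)) :
    (G *ᵥ B.wEven η j l = ∑ i : Fin (mult X H Y η), M i j • B.wEven η i l) ∧
    G *ᵥ B.wEven η (mult X H Y η + j) l =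
      ∑ i : Fin (mult X H Y η), M i j • B.wEven η (mult X H Y η + i) l := by
  simp only [B.wEven_lo hXHY hη, B.wEven_hi hXHY hη, Matrix.mulVec_smul, Matrix.mulVec_add,
    Matrix.mulVec_sub, hG, B.act_partner hM hG, Finset.smul_sum, ← Finset.sum_add_distrib,
    ← Finset.sum_sub_distrib]
  constructor <;> exact Finset.sum_congr rfl fun i _ => by module

end AdaptedBasis
end SOpq

/-! ### Equality of `K` with the group of orthogonal isometries -/

namespace SOpq
namespace AdaptedBasis

variable {p q : ℕ} {X H Y : so p q} (B : AdaptedBasis X H Y)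

theorem matrixOn_setCsgn (hXHY : IsSl2Triple H X Y) {θ : ℕ} (hθ : Odd θ) {A : Fam X H Y}
    {C : Matrix (Fin (B.pos θ)) (Fin (B.pos θ)) ℝ} {D : Matrix (Fin (B.neg θ)) (Fin (B.neg θ)) ℝ}
    (hA : A θ = toSize _ ⟨_, pairBlock C D⟩) {l : ℕ} (hl : l < θ) :
    MatrixOn (B.act hXHY A) (B.setCsgn (cmpSign θ l) θ l) C ∧
    MatrixOn (B.act hXHY A) (B.setCsgn (-cmpSign θ l) θ l) D := by
  have h1 : ∀ l, (∀ j : Fin (B.pos θ), B.act hXHY A *ᵥ B.xv θ l j =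
      ∑ i : Fin (B.pos θ), C i j • B.xv θ l i) ∧
      ∀ j : Fin (B.neg θ), B.act hXHY A *ᵥ B.xv θ l (B.pos θ + j) =
        ∑ i : Fin (B.neg θ), D i j • B.xv θ l (B.pos θ + i) := fun l =>
    sum_pairBlock (f := fun j => B.xv θ l j) fun j =>
      sum_toSize (B.pos_add_neg hθ) (pairBlock C D) (f := fun j => B.xv θ l j)
        (fun j => by rw [act_xv, hA]) j
  obtain ⟨h2, h3⟩ := B.setCsgn_cmpSign hXHY hθ hl
  rw [h2, h3]
  constructor
  · refine matrixOn_map_range _ fun j => ?_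
    have := B.act_wOdd (G := B.act hXHY A) (b := 0) (M := C) (θ := θ)
      (fun l j => by simpa using (h1 l).1 j) l j
    simpa using this
  · exact matrixOn_map_range (fun j => B.wOdd θ (B.pos θ + j) l)
      fun j => B.act_wOdd (fun l j => (h1 l).2 j) l j

theorem commute_gram_transpose (hXHY : IsSl2Triple H X Y) {d : ℕ}
    {M : Matrix (Fin (mult X H Y d)) (Fin (mult X H Y d)) ℝ} (h : B.gram d * M = M * B.gram d) :
    M * (B.gram d)ᵀ = (B.gram d)ᵀ * M := by
  calc M * (B.gram d)ᵀ = (B.gram d)ᵀ * (B.gram d * M) * (B.gram d)ᵀ := by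
        rw [← Matrix.mul_assoc, B.gram_transpose_mul hXHY, Matrix.one_mul]
    _ = (B.gram d)ᵀ * M * (B.gram d * (B.gram d)ᵀ) := by
        rw [h]; simp only [Matrix.mul_assoc]
    _ = (B.gram d)ᵀ * M := by rw [B.gram_mul_transpose hXHY, Matrix.mul_one]

theorem matrixOn_setD (hXHY : IsSl2Triple H X Y) {η : ℕ} (hη : Even η) {A : Fam X H Y}
    {U : Matrix (Fin (mult X H Y η / 2)) (Fin (mult X H Y η / 2)) ℂ}
    (hA : A η = toSize _ ⟨_, wp U⟩) (l : ℕ) :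
    MatrixOn (B.act hXHY A) (B.setDpos η l) (wp U) ∧
    MatrixOn (B.act hXHY A) (B.setDneg η l) (wp U) := by
  have h2 := B.half_add_half hXHY hη
  have hM : A η * (B.gram η)ᵀ = (B.gram η)ᵀ * A η := by
    apply B.commute_gram_transpose hXHY
    rw [hA, B.gram_even_eq hη]
    exact symplecticMatrix_mul_wp h2 U
  have h1 := B.act_wEven hXHY hη hM (fun l j => B.act_xv hXHY A η l j) l
  rw [hA] at h1
  constructor
  · have h3 := matrixOn_map_range (fun j => B.wEven η j l) (M := wp U)
      (G := B.act hXHY A) (sum_toSize h2 (wp U)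
        (f := fun j => B.wEven η j l) (fun j => (h1 j).1))
    rw [setDpos]
    convert h3 using 3
    exact h2.symm
  · have h3 := matrixOn_map_range (fun j => B.wEven η (mult X H Y η + j) l) (M := wp U)
      (G := B.act hXHY A) (sum_toSize h2 (wp U)
        (f := fun j => B.wEven η (mult X H Y η + j) l) (fun j => (h1 j).2))
    rw [setDneg]
    convert h3 using 3
    exact h2.symm

theorem setD_eq (η l : ℕ) : B.setD η l = B.setDpos η l ++ B.setDneg η l := by
  rw [setD, two_mul, List.range_add, List.map_append, List.map_map]; rfl

theorem map_lowest_stable (hXHY : IsSl2Triple H X Y) (A : Fam X H Y) (d l : ℕ) :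
    ∀ w ∈ (lowest X H Y d).map ((X : Matrix (Idx p q) (Idx p q) ℝ) ^ l).mulVecLin,
      B.act hXHY A *ᵥ w ∈
        (lowest X H Y d).map ((X : Matrix (Idx p q) (Idx p q) ℝ) ^ l).mulVecLin := by
  rintro _ ⟨u, hu, rfl⟩
  obtain ⟨u, rfl⟩ : ∃ w : lowest X H Y d, (w : Vec p q) = u := ⟨⟨u, hu⟩, rfl⟩
  rw [← (B.v d).sum_repr u]
  simp only [Submodule.coe_sum, Submodule.coe_smul, map_sum, map_smul, Matrix.mulVec_sum,
    Matrix.mulVec_smul]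
  refine Submodule.sum_mem _ fun j _ => Submodule.smul_mem _ _ ?_
  have h1 : ((X : Matrix (Idx p q) (Idx p q) ℝ) ^ l).mulVecLin (B.v d j) = B.xv d l j := by
    rw [xv, vec_eq]; rfl
  rw [h1, act_xv]
  refine Submodule.sum_mem _ fun i _ => Submodule.smul_mem _ _ ?_
  exact ⟨B.vec d i, B.vec_mem d i, rfl⟩

theorem mem_odd_union {θ : ℕ} :
    θ ∈ oddParts1 X H Y ∪ oddParts3 X H Y ↔ θ ∈ parts X H Y ∧ Odd θ := by
  rw [Finset.mem_union, mem_oddParts1, mem_oddParts3, Nat.odd_iff, ← and_or_left]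
  exact and_congr_right fun _ => by omega

theorem orthogonalSubgroup_subset_setK (hXHY : IsSl2Triple H X Y) :
    (B.orthogonalSubgroup hXHY : Set (SL p q)) ⊆ B.setK := by
  intro g hg
  obtain ⟨A, hA, hgA⟩ := id hg
  refine ⟨B.orthogonalSubgroup_le hXHY hg, fun θ hθ => ?_, fun η hη => ?_⟩
  · have hodd := (mem_odd_union.mp hθ).2
    have hpos := hodd.pos
    obtain ⟨C, -, D, -, hCD⟩ := exists_pairBlock (B.pos_add_neg hodd) (hA θ).1
      (by rw [← B.gram_odd hodd]; exact (hA θ).2)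
    have key := fun l (hl : l < θ) => B.matrixOn_setCsgn hXHY hodd hCD hl
    rw [← hgA] at key
    have h0 := key 0 hpos
    rw [cmpSign_zero hodd] at h0
    refine ⟨fun l hl => ?_, ⟨C, h0.1, fun l hl => (key l hl).1⟩, ⟨D, h0.2, fun l hl => (key l hl).2⟩⟩
    obtain ⟨h1, h2⟩ := key l hl
    rcases cmpSign_eq_or hodd l with h | h
    · rw [h] at h1 h2
      exact ⟨h1.mulVec_mem, h2.mulVec_mem⟩
    · rw [h] at h1 h2
      rw [neg_neg] at h2
      exact ⟨h2.mulVec_mem, h1.mulVec_mem⟩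
  · have heven := even_of_mem hη
    obtain ⟨U, hU, hAU⟩ := exists_wp (B.half_add_half hXHY heven) (hA η).1
      (by rw [← B.gram_even_eq heven]; exact (hA η).2)
    refine ⟨fun l _ => ?_, U, hU, fun l _ => ?_⟩
    · have h1 : ∀ l, (lowest X H Y η).map ((X : Matrix (Idx p q) (Idx p q) ℝ) ^ l).mulVecLin ≤
          ((lowest X H Y η).map ((X : Matrix (Idx p q) (Idx p q) ℝ) ^ l).mulVecLin).comap
            (g : Matrix (Idx p q) (Idx p q) ℝ).mulVecLin := by
        intro l w hw
        rw [Submodule.mem_comap, Matrix.mulVecLin_apply, hgA]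
        exact B.map_lowest_stable hXHY A η l w hw
      have h2 : spaceW X H Y η l ≤ (spaceW X H Y η l).comap
          (g : Matrix (Idx p q) (Idx p q) ℝ).mulVecLin :=
        sup_le ((h1 l).trans (Submodule.comap_mono le_sup_left))
          ((h1 _).trans (Submodule.comap_mono le_sup_right))
      exact fun w hw => h2 hw
    · obtain ⟨h1, h2⟩ := B.matrixOn_setD hXHY heven hAU l
      rw [hasMatrix_iff, setD_eq, hgA]
      refine MatrixOn.append (S := ⟨_, wp U⟩) h1 ?_
      have := MatrixOn.append (S := ⟨_, wp U⟩) (T := []) h2 matrixOn_nil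
      rwa [List.append_nil] at this

/-- Commuting rewrites the isometry relation as `Mᵀ M J = J`, and `J` is invertible. Thus an
isometry that commutes with `J` is orthogonal. -/
theorem transpose_mul_self_of_commute (hXHY : IsSl2Triple H X Y) {d : ℕ}
    {M : Matrix (Fin (mult X H Y d)) (Fin (mult X H Y d)) ℝ} (h : B.gram d * M = M * B.gram d)
    (hM : Mᵀ * B.gram d * M = B.gram d) : Mᵀ * M = 1 := by
  calc Mᵀ * M = (Mᵀ * (M * B.gram d)) * (B.gram d)ᵀ := by
        simp only [Matrix.mul_assoc]
        rw [B.gram_mul_transpose hXHY, Matrix.mul_one]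
    _ = 1 := by rw [← h, ← Matrix.mul_assoc, hM, B.gram_mul_transpose hXHY]

/-- The `w^θ_{j0}` of one sign are preserved only by matrices commuting with the form. -/
theorem commute_of_preserves (hXHY : IsSl2Triple H X Y) {θ : ℕ} (hθ : Odd θ) {A : Fam X H Y}
    (h1 : ∀ w ∈ spanList (B.setCsgn 1 θ 0), B.act hXHY A *ᵥ w ∈ spanList (B.setCsgn 1 θ 0))
    (h2 : ∀ w ∈ spanList (B.setCsgn (-1) θ 0),
      B.act hXHY A *ᵥ w ∈ spanList (B.setCsgn (-1) θ 0)) :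
    B.gram θ * A θ = A θ * B.gram θ := by
  have hpos := hθ.pos
  have hpn := B.pos_add_neg hθ
  obtain ⟨hC1, hC2⟩ := B.setCsgn_cmpSign hXHY hθ hpos
  rw [cmpSign_zero hθ] at hC1 hC2
  have hform : ∀ i j : Fin (mult X H Y θ), form (B.wOdd θ i 0) (B.wOdd θ j 0) = B.gram θ i j :=
    fun i j => by rw [B.form_wOdd hXHY hθ hpos hpos, if_pos rfl, cmpSign_zero hθ, one_mul]
  have hact : ∀ i j : Fin (mult X H Y θ), form (B.wOdd θ i 0) (B.act hXHY A *ᵥ B.wOdd θ j 0) =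
      (B.gram θ * A θ) i j := by
    intro i j
    have h3 := B.act_wOdd (G := B.act hXHY A) (b := 0) (M := A θ) (θ := θ)
      (fun l j => by simpa using B.act_xv hXHY A θ l j) 0 j
    simp only [zero_add] at h3
    rw [h3, form_sum_right, Matrix.mul_apply]
    exact Finset.sum_congr rfl fun k _ => by rw [form_smul_right, hform, mul_comm]
  have horth : ∀ (L : List (Vec p q)) (w : Vec p q), (∀ x ∈ L, form w x = 0) →
      ∀ x ∈ spanList L, form w x = 0 := by
    intro L w hL x hx
    induction hx using Submodule.span_induction with
    | mem x hx => exact hL x hx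
    | zero => exact form_zero_right _
    | add x y _ _ hx hy => rw [form_add_right, hx, hy, add_zero]
    | smul c x _ hx => rw [form_smul_right, hx, mul_zero]
  -- For indices of opposite sign this entry pairs a vector of one sign with a vector of the
  -- preserved span of the other sign, and the two are orthogonal.
  have hz : ∀ i j : Fin (mult X H Y θ), ¬((i : ℕ) < B.pos θ ↔ (j : ℕ) < B.pos θ) →
      (B.gram θ * A θ) i j = 0 := by
    intro i j hij
    rw [← hact]
    have hne : ∀ k : Fin (mult X H Y θ), ((k : ℕ) < B.pos θ ↔ (j : ℕ) < B.pos θ) →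
        form (B.wOdd θ i 0) (B.wOdd θ k 0) = 0 := by
      intro k hk
      rw [hform, B.gram_odd_apply hθ, if_neg]
      rintro rfl
      exact hij hk
    by_cases hj : (j : ℕ) < B.pos θ
    · refine horth (B.setCsgn 1 θ 0) _ ?_ _ (h1 _ (Submodule.subset_span ?_))
      · intro x hx
        rw [hC1, List.mem_map] at hx
        obtain ⟨k, hk, rfl⟩ := hx
        rw [List.mem_range] at hk
        exact hne ⟨k, by omega⟩ (by simp only; omega)
      · change B.wOdd θ j 0 ∈ B.setCsgn 1 θ 0
        rw [hC1]
        exact List.mem_map.mpr ⟨j, List.mem_range.mpr hj, rfl⟩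
    · refine horth (B.setCsgn (-1) θ 0) _ ?_ _ (h2 _ (Submodule.subset_span ?_))
      · intro x hx
        rw [hC2, List.mem_map] at hx
        obtain ⟨k, hk, rfl⟩ := hx
        rw [List.mem_range] at hk
        exact hne ⟨B.pos θ + k, by omega⟩ (by simp only; omega)
      · change B.wOdd θ j 0 ∈ B.setCsgn (-1) θ 0
        rw [hC2]
        refine List.mem_map.mpr ⟨j - B.pos θ, List.mem_range.mpr (by omega), ?_⟩
        congr 1; omega
  ext i j
  have h3 := hz i j
  rw [B.gram_odd hθ, Matrix.diagonal_mul] at h3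
  rw [B.gram_odd hθ, Matrix.diagonal_mul, Matrix.mul_diagonal]
  -- Where the signs agree, both products scale the entry of `A θ` alike; where they differ, the
  -- entry vanishes.
  by_cases hi : (i : ℕ) < B.pos θ <;> by_cases hj : (j : ℕ) < B.pos θ
  · simp [hi, hj]
  · have := h3 (by tauto)
    simp only [hi, if_true, one_mul] at this
    simp [this]
  · have := h3 (by tauto)
    simp only [hi, if_false, neg_mul, one_mul, neg_eq_zero] at this
    simp [this]
  · simp [hi, hj]

/-- Pairing with the top layer `X^(η-1) L(η-1)` sees only the `X^0` component of `w^η_{j0}`. Hence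
the matrix on these vectors is `A η` itself, and `℘(U)` commutes with the symplectic matrix. -/
theorem commute_of_matrixOn (hXHY : IsSl2Triple H X Y) {η : ℕ} (hη : Even η) (hpos : 0 < η)
    {A : Fam X H Y} {U : Matrix (Fin (mult X H Y η / 2)) (Fin (mult X H Y η / 2)) ℂ}
    (h : MatrixOn (B.act hXHY A) (B.setDpos η 0) (wp U)) :
    B.gram η * A η = A η * B.gram η := by
  have h2 := B.half_add_half hXHY hη
  have hη2 : 2 ≤ η := by obtain ⟨k, hk⟩ := hη; omega
  set W : Matrix (Fin (mult X H Y η)) (Fin (mult X H Y η)) ℝ := toSize _ ⟨_, wp U⟩ with hW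
  have hWact : ∀ j : Fin (mult X H Y η), B.act hXHY A *ᵥ B.wEven η j 0 =
      ∑ i : Fin (mult X H Y η), W i j • B.wEven η i 0 := by
    -- The sizes `t/2 + t/2` and `t` are equal only propositionally; generalising both allows
    -- substitution.
    have aux : ∀ (n t : ℕ) (e : n = t) (M : Matrix (Fin n) (Fin n) ℝ) (w : ℕ → Vec p q),
        MatrixOn (B.act hXHY A) ((List.range t).map w) M → ∀ j : Fin t,
        B.act hXHY A *ᵥ w j = ∑ i : Fin t, toSize t ⟨n, M⟩ i j • w i := by
      intro n t e M w hM j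
      subst e
      obtain ⟨u, hu, hu'⟩ := hM
      rw [← ofFn_eq_map_range] at hu
      obtain rfl := List.ofFn_injective hu
      rw [toSize_self]
      exact hu' j
    exact aux _ _ h2 (wp U) (fun j => B.wEven η j 0) h
  have hpair : ∀ k i : Fin (mult X H Y η), form (B.xv η (η - 1) k) (B.wEven η i 0) =
      (√2)⁻¹ * (-1) ^ (η - 1) * B.gram η k i := by
    intro k i
    have h3 : form (B.xv η (η - 1) k) (B.partner η 0 i) = 0 := by
      rw [partner, form_sum_right]
      refine Finset.sum_eq_zero fun k' _ => ?_
      rw [form_smul_right, B.form_xv_eq_zero hXHY (by omega), mul_zero]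
    rw [B.wEven_lo hXHY hη, form_smul_right, form_add_right, form_smul_right, h3,
      B.form_xv (by omega)]
    ring
  have hpair' : ∀ k j : Fin (mult X H Y η),
      form (B.xv η (η - 1) k) (B.act hXHY A *ᵥ B.wEven η j 0) =
      (√2)⁻¹ * (-1) ^ (η - 1) * (B.gram η * A η) k j := by
    intro k j
    rw [B.wEven_lo hXHY hη, Matrix.mulVec_smul, Matrix.mulVec_add, act_xv, Matrix.mulVec_smul,
      partner, Matrix.mulVec_sum]
    simp only [Matrix.mulVec_smul, act_xv, form_smul_right, form_add_right, form_sum_right]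
    have h3 : ∀ i i' : ℕ, form (B.xv η (η - 1) i) (B.xv η (η - 1 - 0) i') = 0 := fun i i' =>
      B.form_xv_eq_zero hXHY (by omega)
    have h4 : ∀ i : Fin (mult X H Y η), form (B.xv η (η - 1) k) (B.xv η 0 i) =
        (-1) ^ (η - 1) * B.gram η k i := fun i => B.form_xv (by omega) k i
    simp only [h3, h4, mul_zero, Finset.sum_const_zero, add_zero, Matrix.mul_apply,
      Finset.mul_sum]
    exact Finset.sum_congr rfl fun i _ => by ring
  have hc : (√2 : ℝ)⁻¹ * (-1) ^ (η - 1) ≠ 0 := by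
    refine mul_ne_zero (inv_ne_zero (by positivity)) (pow_ne_zero _ (by norm_num))
  have hGW : B.gram η * A η = B.gram η * W := by
    ext k j
    apply mul_left_cancel₀ hc
    rw [← hpair', hWact, form_sum_right, Matrix.mul_apply, Finset.mul_sum]
    exact Finset.sum_congr rfl fun i _ => by rw [form_smul_right, hpair]; ring
  have hAW : A η = W := by
    have := congrArg (fun M => (B.gram η)ᵀ * M) hGW
    simpa only [← Matrix.mul_assoc, B.gram_transpose_mul hXHY, Matrix.one_mul] using this
  rw [hAW, hW, B.gram_even_eq hη]
  exact symplecticMatrix_mul_wp h2 U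

/-- The conditions at `l = 0` make every `A d` commute with its Gram matrix. Orthogonality then
follows from invariance of the form. -/
theorem setK_subset_orthogonalSubgroup (hXHY : IsSl2Triple H X Y) :
    B.setK ⊆ B.orthogonalSubgroup hXHY := by
  rintro g ⟨hg, hodd, heven⟩
  obtain ⟨A, hA, hgA⟩ := (B.mem_centralizer_iff hXHY g).mp hg
  refine ⟨A, fun d => ⟨?_, hA d⟩, hgA⟩
  by_cases hd : d ∈ parts X H Y
  · refine B.transpose_mul_self_of_commute hXHY ?_ (hA d)
    rcases Nat.even_or_odd d with he | ho
    · obtain ⟨-, U, -, hU⟩ := heven d (mem_evenParts.mpr ⟨hd, Nat.even_iff.mp he⟩)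
      have hpos := pos_of_mem_parts hXHY hd
      have h0 := (hU 0 (by obtain ⟨k, hk⟩ := he; omega))
      rw [hasMatrix_iff, hgA] at h0
      have h1 := h0.take
      have h2 := B.half_add_half hXHY he
      rw [setD_eq, List.take_left'] at h1
      · exact B.commute_of_matrixOn hXHY he hpos h1
      · simp [setDpos, h2]
    · obtain ⟨h1, -, -⟩ := hodd d (mem_odd_union.mpr ⟨hd, ho⟩)
      have h2 := h1 0 ho.pos
      rw [Preserves, Preserves, hgA] at h2
      exact B.commute_of_preserves hXHY ho h2.1 h2.2
  · have := mult_eq_zero hXHY hd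
    ext i
    exact absurd i.2 (by omega)

theorem coe_orthogonalSubgroup (hXHY : IsSl2Triple H X Y) :
    (B.orthogonalSubgroup hXHY : Set (SL p q)) = B.setK :=
  (B.orthogonalSubgroup_subset_setK hXHY).antisymm (B.setK_subset_orthogonalSubgroup hXHY)

end AdaptedBasis
end SOpq

/-! ### Block lists matching the order of the basis -/

namespace SOpq
section ListBlocks

variable {p q : ℕ} {G : Matrix (Idx p q) (Idx p q) ℝ}

theorem MatrixOn.append_list {L L' : List (Vec p q)} {S S' : List SqBlock}
    (h : MatrixOn G L (directSum S).2) (h' : MatrixOn G L' (directSum S').2) :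
    MatrixOn G (L ++ L') (directSum (S ++ S')).2 := by
  induction S generalizing L with
  | nil =>
    have h0 : L = [] := List.eq_nil_of_length_eq_zero h.length_eq.symm
    rwa [h0]
  | cons A S ih =>
    obtain ⟨m, A⟩ := A
    have h1 := h.take
    have h2 : MatrixOn G (L.drop m) (directSum S).2 := by
      obtain ⟨u, rfl, hu⟩ := h
      refine ⟨fun i => u (Fin.natAdd m i), ?_, fun j => ?_⟩
      · apply List.ext_getElem
        · rw [List.length_ofFn, List.length_drop, List.length_ofFn]
          exact (Nat.add_sub_cancel_left m _).symm
        · intro i h1 h2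
          simp
          rfl
      · have h1 := hu (Fin.natAdd m j)
        rw [h1]
        change ∑ i : Fin (m + (directSum S).1), _ = _
        rw [Fin.sum_univ_add]
        simp [directSum]
    rw [← List.take_append_drop m L, List.append_assoc, List.cons_append]
    exact MatrixOn.append (S := ⟨m, A⟩) h1 (ih h2)

theorem MatrixOn.singleton {L : List (Vec p q)} {S : SqBlock} (h : MatrixOn G L S.2) :
    MatrixOn G L (directSum [S]).2 := by
  rw [← List.append_nil L]
  exact h.append matrixOn_nil

theorem matrixOn_flatMap_list {β : Type*} (bs : List β) (f : β → List (Vec p q))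
    (M : β → List SqBlock) (h : ∀ b ∈ bs, MatrixOn G (f b) (directSum (M b)).2) :
    MatrixOn G (bs.flatMap f) (directSum (bs.flatMap M)).2 := by
  induction bs with
  | nil => exact matrixOn_nil
  | cons b bs ih =>
    rw [List.flatMap_cons, List.flatMap_cons]
    exact (h b (by simp)).append_list (ih fun b' hb' => h b' (by simp [hb']))

theorem AdaptedBasis.rep_succ (m : ℕ) (L : List SqBlock) : rep (m + 1) L = rep m L ++ L := by
  simp [rep, List.replicate_succ']

open AdaptedBasis

theorem matrixOn_rep_one {m : ℕ} {f : ℕ → List (Vec p q)} {S : SqBlock}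
    (h : ∀ i < m, MatrixOn G (f i) S.2) :
    MatrixOn G ((List.range m).flatMap f) (directSum (rep m [S])).2 := by
  induction m with
  | zero => exact matrixOn_nil
  | succ m ih =>
    rw [List.range_succ, List.flatMap_append, rep_succ]
    refine (ih fun i hi => h i (by omega)).append_list ?_
    simpa using (h m (by omega)).singleton

theorem matrixOn_rep_two {m : ℕ} {f : ℕ → List (Vec p q)} {S T : SqBlock}
    (h : ∀ i < m, MatrixOn G (f (2 * i)) S.2 ∧ MatrixOn G (f (2 * i + 1)) T.2) :
    MatrixOn G ((List.range (2 * m)).flatMap f) (directSum (rep m [S, T])).2 := by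
  induction m with
  | zero => exact matrixOn_nil
  | succ m ih =>
    have h1 : List.range (2 * (m + 1)) = List.range (2 * m) ++ [2 * m, 2 * m + 1] := by
      rw [mul_add, mul_one, List.range_succ, List.range_succ, List.append_assoc]; rfl
    rw [h1, List.flatMap_append, rep_succ]
    refine (ih fun i hi => h i (by omega)).append_list ?_
    obtain ⟨h2, h3⟩ := h m (by omega)
    simpa using h2.append h3.singleton

theorem flatMap_range_add {α : Type*} (m n : ℕ) (f : ℕ → List α) :
    (List.range (m + n)).flatMap f =
      (List.range m).flatMap f ++ (List.range n).flatMap fun i => f (m + i) := by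
  rw [List.range_add, List.flatMap_append, List.flatMap_map]

/-- For `θ = 4m + 1` the signs up to the middle index `2m` are `+ - … + - +`. After the middle the
parity is shifted, so the sequence starts again with `+` and gives `m` pairs `+ -`. -/
theorem matrixOn_mod_one {θ : ℕ} (hθ : θ % 4 = 1) {f : ℕ → List (Vec p q)} {S T : SqBlock}
    (hS : ∀ l < θ, cmpSign θ l = 1 → MatrixOn G (f l) S.2)
    (hT : ∀ l < θ, cmpSign θ l = -1 → MatrixOn G (f l) T.2) :
    MatrixOn G ((List.range θ).flatMap f)
      (directSum (rep ((θ - 1) / 4) [S, T] ++ [S] ++ rep ((θ - 1) / 4) [S, T])).2 := by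
  obtain ⟨m, rfl⟩ : ∃ m, θ = 4 * m + 1 := ⟨θ / 4, by omega⟩
  have hc : ∀ l, cmpSign (4 * m + 1) l = if l ≤ 2 * m then (-1) ^ l else (-1) ^ (l + 1) :=
    fun l => cmpSign_eq (by omega)
  have hm : (4 * m + 1 - 1) / 4 = m := by omega
  rw [hm, show List.range (4 * m + 1) = List.range (2 * m + 1 + 2 * m) by congr 1; omega,
    flatMap_range_add, flatMap_range_add]
  refine ((matrixOn_rep_two fun i hi => ⟨?_, ?_⟩).append_list ?_).append_list
    (matrixOn_rep_two fun i hi => ⟨?_, ?_⟩)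
  · exact hS _ (by omega) (by rw [hc, if_pos (by omega), pow_mul]; simp)
  · exact hT _ (by omega) (by rw [hc, if_pos (by omega), pow_succ, pow_mul]; simp)
  · have : MatrixOn G (f (2 * m)) S.2 :=
      hS _ (by omega) (by rw [hc, if_pos (by omega), pow_mul]; simp)
    simpa using this.singleton
  · refine hS _ (by omega) ?_
    rw [hc, if_neg (by omega), show 2 * m + 1 + 2 * i + 1 = 2 * (m + i + 1) by ring, pow_mul]
    simp
  · refine hT _ (by omega) ?_
    rw [hc, if_neg (by omega), show 2 * m + 1 + (2 * i + 1) + 1 = 2 * (m + i + 1) + 1 by ring,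
      pow_succ, pow_mul]
    simp

/-- For `ζ = 4m + 3` the middle index `2m + 1` is odd, so the first half consists of `m + 1` pairs
`+ -`. The shifted second half starts with `-`: `m` pairs `- +` and a final `-`. -/
theorem matrixOn_mod_three {ζ : ℕ} (hζ : ζ % 4 = 3) {f : ℕ → List (Vec p q)} {S T : SqBlock}
    (hS : ∀ l < ζ, cmpSign ζ l = 1 → MatrixOn G (f l) S.2)
    (hT : ∀ l < ζ, cmpSign ζ l = -1 → MatrixOn G (f l) T.2) :
    MatrixOn G ((List.range ζ).flatMap f)
      (directSum (rep ((ζ + 1) / 4) [S, T] ++ rep ((ζ - 3) / 4) [T, S] ++ [T])).2 := by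
  obtain ⟨m, rfl⟩ : ∃ m, ζ = 4 * m + 3 := ⟨ζ / 4, by omega⟩
  have hc : ∀ l, cmpSign (4 * m + 3) l = if l ≤ 2 * m + 1 then (-1) ^ l else (-1) ^ (l + 1) :=
    fun l => cmpSign_eq (by omega)
  have h1 : (4 * m + 3 + 1) / 4 = m + 1 := by omega
  have h2 : (4 * m + 3 - 3) / 4 = m := by omega
  rw [h1, h2, show List.range (4 * m + 3) = List.range (2 * (m + 1) + 2 * m + 1) by
    congr 1; omega, flatMap_range_add, flatMap_range_add]
  refine ((matrixOn_rep_two fun i hi => ⟨?_, ?_⟩).append_list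
    (matrixOn_rep_two fun i hi => ⟨?_, ?_⟩)).append_list ?_
  · exact hS _ (by omega) (by rw [hc, if_pos (by omega), pow_mul]; simp)
  · exact hT _ (by omega) (by rw [hc, if_pos (by omega), pow_succ, pow_mul]; simp)
  · refine hT _ (by omega) ?_
    rw [hc, if_neg (by omega), show 2 * (m + 1) + 2 * i + 1 = 2 * (m + 1 + i) + 1 by ring,
      pow_succ, pow_mul]
    simp
  · refine hS _ (by omega) ?_
    rw [hc, if_neg (by omega), show 2 * (m + 1) + (2 * i + 1) + 1 = 2 * (m + 1 + i + 1) by ring,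
      pow_mul]
    simp
  · have : MatrixOn G (f (2 * (m + 1) + 2 * m)) T.2 := by
      refine hT _ (by omega) ?_
      rw [hc, if_neg (by omega), show 2 * (m + 1) + 2 * m = 2 * (m + 1 + m) by ring,
        pow_succ, pow_mul]
      simp
    simpa using this.singleton

/-- The basis runs over integers and the block sums over elements of a subtype; both are sorted, so
the orders agree. -/
theorem map_val_sort_univ (s : Finset ℕ) :
    (Finset.univ : Finset s).sort.map Subtype.val = s.sort := by
  apply List.Perm.eq_of_pairwise (le := (· ≤ ·))
  · exact fun a b _ _ h1 h2 => le_antisymm h1 h2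
  · rw [List.pairwise_map]
    exact Finset.pairwise_sort (Finset.univ : Finset s) (· ≤ ·)
  · exact Finset.pairwise_sort s (· ≤ ·)
  · rw [List.perm_ext_iff_of_nodup]
    · intro a; simp
    · exact (Finset.sort_nodup _ _).map Subtype.val_injective
    · exact Finset.sort_nodup _ _

end ListBlocks

namespace AdaptedBasis

variable {p q : ℕ} {X H Y : so p q} (B : AdaptedBasis X H Y)

theorem flatMap_sort {s : Finset ℕ} {α : Type*} (f : ℕ → List α) :
    s.sort.flatMap f = (Finset.univ : Finset s).sort.flatMap fun d : s => f d := by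
  rw [← map_val_sort_univ s, List.flatMap_map]

variable {B}

theorem BlockData.matrixOn_basisPos (hXHY : IsSl2Triple H X Y) (g : B.BlockData) :
    MatrixOn (B.act hXHY g.fam) B.basisPos g.sumP.2 := by
  rw [basisPos, flatMap_sort, flatMap_sort, flatMap_sort, sumP]
  refine ((matrixOn_flatMap_list _ _ _ fun η _ => ?_).append_list
    (matrixOn_flatMap_list _ _ _ fun θ _ => ?_)).append_list
    (matrixOn_flatMap_list _ _ _ fun ζ _ => ?_)
  · exact matrixOn_rep_one (S := ⟨_, wp (g.A η)⟩) fun l _ =>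
      (B.matrixOn_setD hXHY (even_of_mem η.2) (g.fam_even η) l).1
  · refine matrixOn_mod_one (mem_oddParts1.mp θ.2).2 (S := ⟨_, g.C θ⟩) (T := ⟨_, g.D θ⟩)
      (fun l hl h => ?_) fun l hl h => ?_
    all_goals
      have := B.matrixOn_setCsgn hXHY (odd_of_mem1 θ.2) (g.fam_odd1 θ) hl
      rw [h] at this
    · exact this.1
    · rw [neg_neg] at this
      exact this.2
  · refine matrixOn_mod_three (mem_oddParts3.mp ζ.2).2 (S := ⟨_, g.E ζ⟩) (T := ⟨_, g.F ζ⟩)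
      (fun l hl h => ?_) fun l hl h => ?_
    all_goals
      have := B.matrixOn_setCsgn hXHY (odd_of_mem3 ζ.2) (g.fam_odd3 ζ) hl
      rw [h] at this
    · exact this.1
    · rw [neg_neg] at this
      exact this.2

theorem BlockData.matrixOn_basisNeg (hXHY : IsSl2Triple H X Y) (g : B.BlockData) :
    MatrixOn (B.act hXHY g.fam) B.basisNeg g.sumQ.2 := by
  rw [basisNeg, flatMap_sort, flatMap_sort, flatMap_sort, sumQ]
  refine ((matrixOn_flatMap_list _ _ _ fun η _ => ?_).append_list
    (matrixOn_flatMap_list _ _ _ fun θ _ => ?_)).append_list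
    (matrixOn_flatMap_list _ _ _ fun ζ _ => ?_)
  · exact matrixOn_rep_one (S := ⟨_, wp (g.A η)⟩) fun l _ =>
      (B.matrixOn_setD hXHY (even_of_mem η.2) (g.fam_even η) l).2
  · refine matrixOn_mod_one (mem_oddParts1.mp θ.2).2 (S := ⟨_, g.D θ⟩) (T := ⟨_, g.C θ⟩)
      (fun l hl h => ?_) fun l hl h => ?_
    all_goals
      have := B.matrixOn_setCsgn hXHY (odd_of_mem1 θ.2) (g.fam_odd1 θ) hl
      rw [h] at this
    · exact this.2
    · exact this.1
  · refine matrixOn_mod_three (mem_oddParts3.mp ζ.2).2 (S := ⟨_, g.F ζ⟩) (T := ⟨_, g.E ζ⟩)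
      (fun l hl h => ?_) fun l hl h => ?_
    all_goals
      have := B.matrixOn_setCsgn hXHY (odd_of_mem3 ζ.2) (g.fam_odd3 ζ) hl
      rw [h] at this
    · exact this.2
    · exact this.1

end AdaptedBasis
end SOpq

/-! ### Orthogonal lists and the bounds by signature -/

namespace SOpq
section Sylvester

variable {p q : ℕ}

theorem form_self (x : Vec p q) :
    form x x = ∑ i, x (Sum.inl i) ^ 2 - ∑ j, x (Sum.inr j) ^ 2 := by
  rw [form, Ipq_eq, dotProduct, Fintype.sum_sum_type]
  simp only [Matrix.mulVec_diagonal, Sum.elim_inl, Sum.elim_inr]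
  rw [sub_eq_add_neg, ← Finset.sum_neg_distrib]
  congr 1 <;> exact Finset.sum_congr rfl fun i _ => by ring

theorem form_sum_smul {ι : Type*} [Fintype ι] [DecidableEq ι] {ε : ι → ℝ} {u : ι → Vec p q}
    (hu : ∀ i j, form (u i) (u j) = if i = j then ε i else 0) (c : ι → ℝ) (j : ι) :
    form (u j) (∑ i, c i • u i) = ε j * c j := by
  simp only [form_sum_right, form_smul_right, hu]
  simp [mul_comm]

theorem form_sum_smul_self {ι : Type*} [Fintype ι] [DecidableEq ι] {ε : ι → ℝ} {u : ι → Vec p q}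
    (hu : ∀ i j, form (u i) (u j) = if i = j then ε i else 0) (c : ι → ℝ) :
    form (∑ i, c i • u i) (∑ i, c i • u i) = ∑ i, ε i * c i ^ 2 := by
  rw [form_sum_left]
  refine Finset.sum_congr rfl fun i _ => ?_
  rw [form_smul_left, form_sum_smul hu]
  ring

theorem linearIndependent_of_form {ι : Type*} [Fintype ι] [DecidableEq ι] {ε : ι → ℝ}
    {u : ι → Vec p q} (hε : ∀ i, ε i ≠ 0)
    (hu : ∀ i j, form (u i) (u j) = if i = j then ε i else 0) : LinearIndependent ℝ u := by
  rw [Fintype.linearIndependent_iff]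
  intro c hc j
  have h := form_sum_smul hu c j
  rw [hc, form_zero_right] at h
  exact (mul_eq_zero.mp h.symm).resolve_left (hε j)

/-- The form is positive definite on the span of `u`, but nonpositive on vectors whose first `p`
coordinates vanish. So projection to those coordinates is injective on the span. -/
theorem card_le_of_form_pos {m : ℕ} {u : Fin m → Vec p q}
    (hu : ∀ i j, form (u i) (u j) = if i = j then 1 else 0) : m ≤ p := by
  let f : (Fin m → ℝ) →ₗ[ℝ] (Fin p → ℝ) :=
    (LinearMap.funLeft ℝ ℝ Sum.inl).comp (Fintype.linearCombination ℝ u)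
  have hf : Function.Injective f := by
    rw [injective_iff_map_eq_zero]
    intro c hc
    have h1 := form_sum_smul_self (ε := fun _ => 1) hu c
    rw [form_self, Finset.sum_eq_zero (s := (Finset.univ : Finset (Fin p)))] at h1
    · have h2 : ∑ i, 1 * c i ^ 2 ≤ 0 := by
        rw [← h1, zero_sub, neg_nonpos]
        exact Finset.sum_nonneg fun _ _ => sq_nonneg _
      have h3 := (Finset.sum_eq_zero_iff_of_nonneg fun i _ => by positivity).mp
        (h2.antisymm (Finset.sum_nonneg fun i _ => by positivity))
      ext i
      simpa using h3 i (Finset.mem_univ i)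
    · intro i _
      have h2 : (∑ k, c k • u k) (Sum.inl i) = 0 := congrFun hc i
      rw [h2]; norm_num
  simpa using LinearMap.finrank_le_finrank_of_injective hf

theorem card_le_of_form_neg {m : ℕ} {u : Fin m → Vec p q}
    (hu : ∀ i j, form (u i) (u j) = if i = j then -1 else 0) : m ≤ q := by
  let f : (Fin m → ℝ) →ₗ[ℝ] (Fin q → ℝ) :=
    (LinearMap.funLeft ℝ ℝ Sum.inr).comp (Fintype.linearCombination ℝ u)
  have hf : Function.Injective f := by
    rw [injective_iff_map_eq_zero]
    intro c hc
    have h1 := form_sum_smul_self (ε := fun _ => -1) hu c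
    rw [form_self, Finset.sum_eq_zero (s := (Finset.univ : Finset (Fin q)))] at h1
    · have h2 : ∑ i, c i ^ 2 ≤ 0 := by
        have h4 : ∑ i, c i ^ 2 = -∑ i, -1 * c i ^ 2 := by
          rw [← Finset.sum_neg_distrib]
          exact Finset.sum_congr rfl fun i _ => by ring
        rw [h4, ← h1, sub_zero, neg_nonpos]
        exact Finset.sum_nonneg fun _ _ => sq_nonneg _
      have h3 := (Finset.sum_eq_zero_iff_of_nonneg fun i _ => by positivity).mp
        (h2.antisymm (Finset.sum_nonneg fun i _ => by positivity))
      ext i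
      simpa using h3 i (Finset.mem_univ i)
    · intro i _
      have h2 : (∑ k, c k • u k) (Sum.inr i) = 0 := congrFun hc i
      rw [h2]; norm_num
  simpa using LinearMap.finrank_le_finrank_of_injective hf

/-- The members of `L` are pairwise orthogonal and have square `ε`. -/
def IsOrthoList (ε : ℝ) (L : List (Vec p q)) : Prop :=
  L.Pairwise (fun x y => form x y = 0) ∧ ∀ x ∈ L, form x x = ε

theorem IsOrthoList.form_get {ε : ℝ} {L : List (Vec p q)} (h : IsOrthoList ε L)
    (i j : Fin L.length) : form (L.get i) (L.get j) = if i = j then ε else 0 := by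
  have h1 := List.pairwise_iff_get.mp h.1
  rcases lt_trichotomy i j with hij | hij | hij
  · rw [if_neg hij.ne, h1 i j hij]
  · rw [if_pos hij, hij, h.2 _ (List.get_mem L j)]
  · rw [if_neg hij.ne', form_comm, h1 j i hij]

theorem IsOrthoList.flatMap {β : Type*} {ε : ℝ} {bs : List β} {f : β → List (Vec p q)}
    (h : ∀ b ∈ bs, IsOrthoList ε (f b))
    (h' : bs.Pairwise fun b b' => ∀ x ∈ f b, ∀ y ∈ f b', form x y = 0) :
    IsOrthoList ε (bs.flatMap f) := by
  refine ⟨List.pairwise_flatMap.mpr ⟨fun b hb => (h b hb).1, h'⟩, fun x hx => ?_⟩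
  obtain ⟨b, hb, hx⟩ := List.mem_flatMap.mp hx
  exact (h b hb).2 x hx

theorem IsOrthoList.map_range {ε : ℝ} {n : ℕ} {f : ℕ → Vec p q}
    (h : ∀ i j : Fin n, form (f i) (f j) = if i = j then ε else 0) :
    IsOrthoList ε ((List.range n).map f) := by
  constructor
  · rw [List.pairwise_map]
    refine List.pairwise_lt_range.imp_of_mem fun {a b} ha hb hab => ?_
    rw [List.mem_range] at ha hb
    exact (h ⟨a, ha⟩ ⟨b, hb⟩).trans (if_neg fun e => hab.ne (congrArg Fin.val e))
  · intro x hx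
    obtain ⟨i, hi, rfl⟩ := List.mem_map.mp hx
    exact (h ⟨i, List.mem_range.mp hi⟩ ⟨i, List.mem_range.mp hi⟩).trans (if_pos rfl)

end Sylvester

/-! ### The ordered basis and the matrices of `K` -/

namespace AdaptedBasis

variable {p q : ℕ} {X H Y : so p q} (B : AdaptedBasis X H Y)

/-- The dimensions of the irreducible submodules, in the order used for `ℋ`. -/
def partsList (X H Y : so p q) : List ℕ :=
  (evenParts X H Y).sort ++ (oddParts1 X H Y).sort ++ (oddParts3 X H Y).sort

theorem mem_partsList {d : ℕ} : d ∈ partsList X H Y ↔ d ∈ parts X H Y := by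
  simp only [partsList, List.mem_append, Finset.mem_sort, mem_evenParts, mem_oddParts1,
    mem_oddParts3]
  have : d % 2 = 0 ∨ d % 4 = 1 ∨ d % 4 = 3 := by omega
  tauto

theorem nodup_partsList : (partsList X H Y).Nodup := by
  have h1 : ((evenParts X H Y).sort ++ (oddParts1 X H Y).sort).Nodup := by
    refine List.Nodup.append (Finset.sort_nodup _ _) (Finset.sort_nodup _ _) fun d h h' => ?_
    rw [Finset.mem_sort, mem_evenParts] at h
    rw [Finset.mem_sort, mem_oddParts1] at h'
    omega
  refine h1.append (Finset.sort_nodup _ _) fun d h h' => ?_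
  rw [List.mem_append, Finset.mem_sort, Finset.mem_sort, mem_evenParts, mem_oddParts1] at h
  rw [Finset.mem_sort, mem_oddParts3] at h'
  omega

/-- The part of `ℋ_+` lying in the isotypic component of dimension `d`. -/
def layerPos (d : ℕ) : List (Vec p q) :=
  if Even d then (List.range (d / 2)).flatMap (B.setDpos d)
  else (List.range d).flatMap (B.setCsgn 1 d)

/-- The part of `ℋ_-` lying in the isotypic component of dimension `d`. -/
def layerNeg (d : ℕ) : List (Vec p q) :=
  if Even d then (List.range (d / 2)).flatMap (B.setDneg d)
  else (List.range d).flatMap (B.setCsgn (-1) d)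

theorem flatMap_congr' {α β : Type*} {L : List α} {f g : α → List β} (h : ∀ a ∈ L, f a = g a) :
    L.flatMap f = L.flatMap g := by
  rw [List.flatMap_def, List.flatMap_def, List.map_congr_left h]

theorem basisPos_eq : B.basisPos = (partsList X H Y).flatMap B.layerPos := by
  rw [basisPos, partsList, List.flatMap_append, List.flatMap_append]
  congr 1
  · congr 1
    · refine flatMap_congr' fun d hd => ?_
      rw [layerPos, if_pos (even_of_mem ((Finset.mem_sort _).mp hd))]
    · refine flatMap_congr' fun d hd => ?_
      rw [layerPos, if_neg (Nat.not_even_iff_odd.mpr (odd_of_mem1 ((Finset.mem_sort _).mp hd)))]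
  · refine flatMap_congr' fun d hd => ?_
    rw [layerPos, if_neg (Nat.not_even_iff_odd.mpr (odd_of_mem3 ((Finset.mem_sort _).mp hd)))]

theorem basisNeg_eq : B.basisNeg = (partsList X H Y).flatMap B.layerNeg := by
  rw [basisNeg, partsList, List.flatMap_append, List.flatMap_append]
  congr 1
  · congr 1
    · refine flatMap_congr' fun d hd => ?_
      rw [layerNeg, if_pos (even_of_mem ((Finset.mem_sort _).mp hd))]
    · refine flatMap_congr' fun d hd => ?_
      rw [layerNeg, if_neg (Nat.not_even_iff_odd.mpr (odd_of_mem1 ((Finset.mem_sort _).mp hd)))]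
  · refine flatMap_congr' fun d hd => ?_
    rw [layerNeg, if_neg (Nat.not_even_iff_odd.mpr (odd_of_mem3 ((Finset.mem_sort _).mp hd)))]

/-- The span of the vectors `X^l v^d_j` for fixed `d`. -/
def layerSpace (d : ℕ) : Submodule ℝ (Vec p q) :=
  Submodule.span ℝ {x | ∃ l j, x = B.xv d l j}

theorem xv_mem_layerSpace (d l j : ℕ) : B.xv d l j ∈ B.layerSpace d :=
  Submodule.subset_span ⟨l, j, rfl⟩

theorem form_layerSpace (hXHY : IsSl2Triple H X Y) {d d' : ℕ} (hd : d ≠ d') {x y : Vec p q}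
    (hx : x ∈ B.layerSpace d) (hy : y ∈ B.layerSpace d') : form x y = 0 := by
  induction hx using Submodule.span_induction with
  | mem x hx =>
    obtain ⟨l, j, rfl⟩ := hx
    induction hy using Submodule.span_induction with
    | mem y hy =>
      obtain ⟨l', j', rfl⟩ := hy
      exact B.form_xv_eq_zero hXHY fun h => hd h.1
    | zero => exact form_zero_right _
    | add x y _ _ hx hy => rw [form_add_right, hx, hy, add_zero]
    | smul c x _ hx => rw [form_smul_right, hx, mul_zero]
  | zero => exact form_zero_left _
  | add x y _ _ hx hy => rw [form_add_left, hx, hy, add_zero]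
  | smul c x _ hx => rw [form_smul_left, hx, mul_zero]

theorem wOdd_mem (θ j l : ℕ) : B.wOdd θ j l ∈ B.layerSpace θ := by
  have h := B.xv_mem_layerSpace θ
  rw [wOdd]
  split_ifs
  · exact Submodule.smul_mem _ _ (Submodule.add_mem _ (h _ _) (h _ _))
  · exact h _ _
  · exact Submodule.smul_mem _ _ (Submodule.sub_mem _ (h _ _) (h _ _))

theorem wEven_mem (η j l : ℕ) : B.wEven η j l ∈ B.layerSpace η := by
  have h := B.xv_mem_layerSpace η
  have h' : ∀ (c : ℝ) l j, c • B.xv η l j ∈ B.layerSpace η := fun c l j =>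
    Submodule.smul_mem _ _ (h l j)
  simp only [wEven]
  refine Submodule.smul_mem _ _ ?_
  split_ifs
  · exact Submodule.add_mem _ (h _ _) (h' _ _ _)
  · exact Submodule.sub_mem _ (h _ _) (h' _ _ _)
  · exact Submodule.sub_mem _ (h _ _) (h' _ _ _)
  · exact Submodule.add_mem _ (h _ _) (h' _ _ _)

theorem layerPos_mem {d : ℕ} {x : Vec p q} (hx : x ∈ B.layerPos d) : x ∈ B.layerSpace d := by
  rw [layerPos] at hx
  split_ifs at hx
  · obtain ⟨l, -, hx⟩ := List.mem_flatMap.mp hx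
    obtain ⟨j, -, rfl⟩ := List.mem_map.mp hx
    exact B.wEven_mem _ _ _
  · obtain ⟨l, -, hx⟩ := List.mem_flatMap.mp hx
    obtain ⟨j, -, rfl⟩ := List.mem_map.mp (List.mem_filter.mp hx).1
    exact B.wOdd_mem _ _ _

theorem layerNeg_mem {d : ℕ} {x : Vec p q} (hx : x ∈ B.layerNeg d) : x ∈ B.layerSpace d := by
  rw [layerNeg] at hx
  split_ifs at hx
  · obtain ⟨l, -, hx⟩ := List.mem_flatMap.mp hx
    obtain ⟨j, -, rfl⟩ := List.mem_map.mp hx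
    exact B.wEven_mem _ _ _
  · obtain ⟨l, -, hx⟩ := List.mem_flatMap.mp hx
    obtain ⟨j, -, rfl⟩ := List.mem_map.mp (List.mem_filter.mp hx).1
    exact B.wOdd_mem _ _ _

theorem gram_odd_eq_zero {d : ℕ} (hd : Odd d) {i j : Fin (mult X H Y d)} (h : i ≠ j) :
    B.gram d i j = 0 := by
  rw [B.gram_odd_apply hd, if_neg h]

theorem mem_setCsgn (hXHY : IsSl2Triple H X Y) {θ l : ℕ} (hθ : Odd θ) (hl : l < θ) {ε : ℝ}
    (hε : ε = 1 ∨ ε = -1) {x : Vec p q} (hx : x ∈ B.setCsgn ε θ l) :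
    ∃ j : Fin (mult X H Y θ), x = B.wOdd θ j l ∧ cmpSign θ l * B.gram θ j j = ε := by
  obtain ⟨h1, h2⟩ := List.mem_filter.mp hx
  obtain ⟨j, hj, rfl⟩ := List.mem_map.mp h1
  rw [List.mem_range] at hj
  refine ⟨⟨j, hj⟩, rfl, ?_⟩
  have h3 := B.form_wOdd hXHY hθ hl hl ⟨j, hj⟩ ⟨j, hj⟩
  rw [if_pos rfl] at h3
  rw [decide_eq_true_eq, h3] at h2
  have h4 : B.gram θ ⟨j, hj⟩ ⟨j, hj⟩ = 1 ∨ B.gram θ ⟨j, hj⟩ ⟨j, hj⟩ = -1 := by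
    rw [B.gram_odd_apply hθ, if_pos rfl]
    split_ifs <;> simp
  rcases cmpSign_eq_or hθ l with h | h <;> rcases hε with rfl | rfl <;>
    rcases h4 with h4 | h4 <;> rw [h, h4] at h2 <;> rw [h, h4] <;>
    first | (norm_num; done) | norm_num at h2

theorem isOrthoList_setCsgn (hXHY : IsSl2Triple H X Y) {θ : ℕ} (hθ : Odd θ) {ε : ℝ}
    (hε : ε = 1 ∨ ε = -1) : IsOrthoList ε ((List.range θ).flatMap (B.setCsgn ε θ)) := by
  refine IsOrthoList.flatMap (fun l hl => ⟨?_, fun x hx => ?_⟩) ?_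
  · rw [List.mem_range] at hl
    refine List.Pairwise.filter _ ?_
    rw [setC, List.pairwise_map]
    refine List.pairwise_lt_range.imp_of_mem fun {a b} ha hb hab => ?_
    rw [List.mem_range] at ha hb
    have := B.form_wOdd hXHY hθ hl hl ⟨a, ha⟩ ⟨b, hb⟩
    rwa [if_pos rfl, B.gram_odd_eq_zero hθ fun e => hab.ne (congrArg Fin.val e), mul_zero] at this
  · rw [List.mem_range] at hl
    obtain ⟨j, rfl, hj⟩ := B.mem_setCsgn hXHY hθ hl hε hx
    rw [B.form_wOdd hXHY hθ hl hl, if_pos rfl, hj]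
  · refine List.pairwise_lt_range.imp_of_mem fun {l l'} hl hl' hll x hx y hy => ?_
    rw [List.mem_range] at hl hl'
    obtain ⟨i, rfl, -⟩ := B.mem_setCsgn hXHY hθ hl hε hx
    obtain ⟨j, rfl, -⟩ := B.mem_setCsgn hXHY hθ hl' hε hy
    rw [B.form_wOdd hXHY hθ hl hl', if_neg hll.ne]

theorem isOrthoList_layerPos (hXHY : IsSl2Triple H X Y) (d : ℕ) :
    IsOrthoList 1 (B.layerPos d) := by
  rw [layerPos]
  split_ifs with hd
  · refine IsOrthoList.flatMap (fun l hl => ?_) ?_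
    · rw [List.mem_range] at hl
      refine IsOrthoList.map_range fun i j => ?_
      rw [(B.form_wEven hXHY hd hl hl i j).1]
      simp
    · refine List.pairwise_lt_range.imp_of_mem fun {l l'} hl hl' hll x hx y hy => ?_
      rw [List.mem_range] at hl hl'
      obtain ⟨i, hi, rfl⟩ := List.mem_map.mp hx
      obtain ⟨j, hj, rfl⟩ := List.mem_map.mp hy
      rw [List.mem_range] at hi hj
      exact (B.form_wEven hXHY hd hl hl' ⟨i, hi⟩ ⟨j, hj⟩).1.trans (if_neg fun h => hll.ne h.1)
  · exact B.isOrthoList_setCsgn hXHY (Nat.not_even_iff_odd.mp hd) (Or.inl rfl)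

theorem isOrthoList_layerNeg (hXHY : IsSl2Triple H X Y) (d : ℕ) :
    IsOrthoList (-1) (B.layerNeg d) := by
  rw [layerNeg]
  split_ifs with hd
  · refine IsOrthoList.flatMap (fun l hl => ?_) ?_
    · rw [List.mem_range] at hl
      refine IsOrthoList.map_range fun i j => ?_
      rw [(B.form_wEven hXHY hd hl hl i j).2.1]
      simp
    · refine List.pairwise_lt_range.imp_of_mem fun {l l'} hl hl' hll x hx y hy => ?_
      rw [List.mem_range] at hl hl'
      obtain ⟨i, hi, rfl⟩ := List.mem_map.mp hx
      obtain ⟨j, hj, rfl⟩ := List.mem_map.mp hy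
      rw [List.mem_range] at hi hj
      exact (B.form_wEven hXHY hd hl hl' ⟨i, hi⟩ ⟨j, hj⟩).2.1.trans (if_neg fun h => hll.ne h.1)
  · exact B.isOrthoList_setCsgn hXHY (Nat.not_even_iff_odd.mp hd) (Or.inr rfl)

theorem form_layerPos_layerNeg (hXHY : IsSl2Triple H X Y) {d : ℕ} {x y : Vec p q}
    (hx : x ∈ B.layerPos d) (hy : y ∈ B.layerNeg d) : form x y = 0 := by
  rw [layerPos] at hx
  rw [layerNeg] at hy
  split_ifs at hx hy with hd
  · obtain ⟨l, hl, hx⟩ := List.mem_flatMap.mp hx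
    obtain ⟨l', hl', hy⟩ := List.mem_flatMap.mp hy
    obtain ⟨i, hi, rfl⟩ := List.mem_map.mp hx
    obtain ⟨j, hj, rfl⟩ := List.mem_map.mp hy
    rw [List.mem_range] at hi hj hl hl'
    exact (B.form_wEven hXHY hd hl hl' ⟨i, hi⟩ ⟨j, hj⟩).2.2
  · obtain ⟨l, hl, hx⟩ := List.mem_flatMap.mp hx
    obtain ⟨l', hl', hy⟩ := List.mem_flatMap.mp hy
    rw [List.mem_range] at hl hl'
    have hθ := Nat.not_even_iff_odd.mp hd
    obtain ⟨i, rfl, hi⟩ := B.mem_setCsgn hXHY hθ hl (Or.inl rfl) hx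
    obtain ⟨j, rfl, hj⟩ := B.mem_setCsgn hXHY hθ hl' (Or.inr rfl) hy
    rw [B.form_wOdd hXHY hθ hl hl']
    split_ifs with h
    · subst h
      rw [B.gram_odd_eq_zero hθ, mul_zero]
      rintro rfl
      rw [hi] at hj
      norm_num at hj
    · rfl

theorem isOrthoList_basisPos (hXHY : IsSl2Triple H X Y) : IsOrthoList 1 B.basisPos := by
  rw [basisPos_eq]
  refine IsOrthoList.flatMap (fun d _ => B.isOrthoList_layerPos hXHY d) ?_
  exact nodup_partsList.imp fun hd x hx y hy =>
    B.form_layerSpace hXHY hd (B.layerPos_mem hx) (B.layerPos_mem hy)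

theorem isOrthoList_basisNeg (hXHY : IsSl2Triple H X Y) : IsOrthoList (-1) B.basisNeg := by
  rw [basisNeg_eq]
  refine IsOrthoList.flatMap (fun d _ => B.isOrthoList_layerNeg hXHY d) ?_
  exact nodup_partsList.imp fun hd x hx y hy =>
    B.form_layerSpace hXHY hd (B.layerNeg_mem hx) (B.layerNeg_mem hy)

theorem form_basisPos_basisNeg (hXHY : IsSl2Triple H X Y) {x y : Vec p q}
    (hx : x ∈ B.basisPos) (hy : y ∈ B.basisNeg) : form x y = 0 := by
  rw [basisPos_eq] at hx
  rw [basisNeg_eq] at hy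
  obtain ⟨d, -, hx⟩ := List.mem_flatMap.mp hx
  obtain ⟨d', -, hy⟩ := List.mem_flatMap.mp hy
  by_cases h : d = d'
  · subst h
    exact B.form_layerPos_layerNeg hXHY hx hy
  · exact B.form_layerSpace hXHY h (B.layerPos_mem hx) (B.layerNeg_mem hy)

theorem length_setCsgn (hXHY : IsSl2Triple H X Y) {θ l : ℕ} (hθ : Odd θ) (hl : l < θ) :
    (B.setCsgn 1 θ l).length + (B.setCsgn (-1) θ l).length = mult X H Y θ := by
  obtain ⟨h1, h2⟩ := B.setCsgn_cmpSign hXHY hθ hl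
  have h3 := B.pos_add_neg hθ
  rcases cmpSign_eq_or hθ l with h | h
  · rw [h] at h1 h2
    rw [h1, h2]; simpa using h3
  · rw [h] at h1 h2
    rw [neg_neg] at h2
    rw [h1, h2]; simpa [add_comm] using h3

theorem length_layer (hXHY : IsSl2Triple H X Y) (d : ℕ) :
    (B.layerPos d).length + (B.layerNeg d).length = d * mult X H Y d := by
  rw [layerPos, layerNeg]
  split_ifs with hd
  · obtain ⟨k, rfl⟩ := hd
    have : (k + k) / 2 = k := by omega
    simp only [List.length_flatMap, setDpos, setDneg, List.length_map, List.length_range,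
      List.map_const', List.sum_replicate, this]
    simp only [smul_eq_mul]
    ring
  · have hθ := Nat.not_even_iff_odd.mp hd
    rw [List.length_flatMap, List.length_flatMap, ← List.sum_map_add,
      List.map_congr_left fun l hl => B.length_setCsgn hXHY hθ (List.mem_range.mp hl)]
    simp

/-- This counts the string basis: `d` layers of dimension `t_d` for each `d`. -/
theorem sum_mul_mult (B : AdaptedBasis X H Y) (hXHY : IsSl2Triple H X Y) :
    ∑ d ∈ parts X H Y, d * mult X H Y d = p + q := by
  have h1 := Module.finrank_eq_card_basis (B.strBasis hXHY)
  rw [Module.finrank_fintype_fun_eq_card, Fintype.card_sum, Fintype.card_fin, Fintype.card_fin,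
    Fintype.card_sigma, Fintype.sum_sigma] at h1
  rw [h1, ← Finset.sum_coe_sort (parts X H Y)]
  simp

theorem length_basis (hXHY : IsSl2Triple H X Y) :
    B.basisPos.length + B.basisNeg.length = p + q := by
  rw [basisPos_eq, basisNeg_eq, List.length_flatMap, List.length_flatMap, ← List.sum_map_add]
  simp only [B.length_layer hXHY]
  rw [← List.sum_toFinset _ nodup_partsList, ← B.sum_mul_mult hXHY]
  refine Finset.sum_congr ?_ fun _ _ => rfl
  ext d
  rw [List.mem_toFinset, mem_partsList]

/-- Orthogonality bounds the halves of `ℋ` by `p` and `q`, and the total is `p + q`; so both bounds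
are attained, with no computation of signatures. -/
theorem length_basisPos (hXHY : IsSl2Triple H X Y) : B.basisPos.length = p := by
  have h1 := card_le_of_form_pos (B.isOrthoList_basisPos hXHY).form_get
  have h2 := card_le_of_form_neg (B.isOrthoList_basisNeg hXHY).form_get
  have h3 := B.length_basis hXHY
  omega

theorem length_basisNeg (hXHY : IsSl2Triple H X Y) : B.basisNeg.length = q := by
  have h1 := B.length_basisPos hXHY
  have h3 := B.length_basis hXHY
  omega

/-- The members of `ℋ = ℋ_+ ∨ ℋ_-`. -/
def basisVec (hXHY : IsSl2Triple H X Y) : Idx p q → Vec p q :=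
  Sum.elim (fun i => B.basisPos.get (Fin.cast (B.length_basisPos hXHY).symm i))
    fun j => B.basisNeg.get (Fin.cast (B.length_basisNeg hXHY).symm j)

theorem form_basisVec (hXHY : IsSl2Triple H X Y) (i j : Idx p q) :
    form (B.basisVec hXHY i) (B.basisVec hXHY j) =
      if i = j then Sum.elim (fun _ => 1) (fun _ => -1) i else 0 := by
  rcases i with i | i <;> rcases j with j | j
  · exact ((B.isOrthoList_basisPos hXHY).form_get _ _).trans (by simp)
  · exact (B.form_basisPos_basisNeg hXHY (List.get_mem _ _) (List.get_mem _ _)).trans (by simp)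
  · rw [form_comm]
    exact (B.form_basisPos_basisNeg hXHY (List.get_mem _ _) (List.get_mem _ _)).trans (by simp)
  · exact ((B.isOrthoList_basisNeg hXHY).form_get _ _).trans (by simp)

theorem linearIndependent_basisVec (hXHY : IsSl2Triple H X Y) :
    LinearIndependent ℝ (B.basisVec hXHY) :=
  linearIndependent_of_form (fun i => by rcases i with i | i <;> simp) (B.form_basisVec hXHY)

/-- The ordered basis `ℋ`. -/
def basisH (hXHY : IsSl2Triple H X Y) : Module.Basis (Idx p q) ℝ (Vec p q) :=
  basisOfLinearIndependentOfCardEqFinrank' _ (B.linearIndependent_basisVec hXHY)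
    (Module.finrank_fintype_fun_eq_card ℝ).symm

theorem basisH_apply (hXHY : IsSl2Triple H X Y) (i : Idx p q) :
    B.basisH hXHY i = B.basisVec hXHY i := by
  rw [basisH, coe_basisOfLinearIndependentOfCardEqFinrank']

theorem ofFn_basisH_inl (hXHY : IsSl2Triple H X Y) :
    List.ofFn (fun i : Fin p => B.basisH hXHY (Sum.inl i)) = B.basisPos := by
  simp only [basisH_apply, basisVec, Sum.elim_inl]
  apply List.ext_getElem
  · rw [List.length_ofFn, B.length_basisPos hXHY]
  · simp

theorem ofFn_basisH_inr (hXHY : IsSl2Triple H X Y) :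
    List.ofFn (fun j : Fin q => B.basisH hXHY (Sum.inr j)) = B.basisNeg := by
  simp only [basisH_apply, basisVec, Sum.elim_inr]
  apply List.ext_getElem
  · rw [List.length_ofFn, B.length_basisNeg hXHY]
  · simp

theorem _root_.SOpq.MatrixOn.mulVec_ofFn {G : Matrix (Idx p q) (Idx p q) ℝ} {S : SqBlock} {n : ℕ}
    {u : Fin n → Vec p q} (h : MatrixOn G (List.ofFn u) S.2) (j : Fin n) :
    G *ᵥ u j = ∑ i, toSize n S i j • u i := by
  obtain ⟨m, M⟩ := S
  obtain rfl : m = n := by simpa using h.length_eq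
  obtain ⟨u', hu, hu'⟩ := h
  obtain rfl := List.ofFn_injective hu
  rw [toSize_self]
  exact hu' j

variable {B}

theorem BlockData.size_sumP (hXHY : IsSl2Triple H X Y) (g : B.BlockData) : g.sumP.1 = p :=
  (g.matrixOn_basisPos hXHY).length_eq.trans (B.length_basisPos hXHY)

theorem BlockData.size_sumQ (hXHY : IsSl2Triple H X Y) (g : B.BlockData) : g.sumQ.1 = q :=
  (g.matrixOn_basisNeg hXHY).length_eq.trans (B.length_basisNeg hXHY)

theorem BlockData.toMatrix_act (hXHY : IsSl2Triple H X Y) (g : B.BlockData) :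
    LinearMap.toMatrix (B.basisH hXHY) (B.basisH hXHY) (B.act hXHY g.fam).mulVecLin =
      Matrix.fromBlocks g.Dp 0 0 g.Dq := by
  have h1 := g.matrixOn_basisPos hXHY
  have h2 := g.matrixOn_basisNeg hXHY
  rw [← B.ofFn_basisH_inl hXHY] at h1
  rw [← B.ofFn_basisH_inr hXHY] at h2
  ext i j
  rw [LinearMap.toMatrix_apply, Matrix.mulVecLin_apply]
  rcases j with j | j
  · rw [h1.mulVec_ofFn, map_sum, Finsupp.finsetSum_apply]
    rcases i with i | i <;> simp [Dp, Finsupp.single_apply]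
  · rw [h2.mulVec_ofFn, map_sum, Finsupp.finsetSum_apply]
    rcases i with i | i <;> simp [Dq, Finsupp.single_apply]

theorem exists_of_mem_setK (hXHY : IsSl2Triple H X Y) {g : SL p q} (hg : g ∈ B.setK) :
    ∃ β : B.BlockData, β.IsCompactType ∧ β.chiP * β.chiQ = 1 ∧
      (g : Matrix (Idx p q) (Idx p q) ℝ) = B.act hXHY β.fam := by
  rw [← B.coe_orthogonalSubgroup hXHY] at hg
  obtain ⟨A, hA, hgA⟩ := hg
  obtain ⟨β, hβ, rfl⟩ := exists_blockData hXHY hA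
  refine ⟨β, hβ, ?_, hgA⟩
  rw [← β.det_act hXHY hβ, ← hgA, g.det_coe]

theorem BlockData.exists_mem_setK (hXHY : IsSl2Triple H X Y) {β : B.BlockData}
    (hβ : β.IsCompactType) (h : β.chiP * β.chiQ = 1) :
    ∃ g ∈ B.setK, (g : Matrix (Idx p q) (Idx p q) ℝ) = B.act hXHY β.fam := by
  refine ⟨⟨B.act hXHY β.fam, by rw [β.det_act hXHY hβ, h]⟩, ?_, rfl⟩
  rw [← B.coe_orthogonalSubgroup hXHY]
  exact ⟨β.fam, β.fam_isometry hXHY hβ, rfl⟩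

theorem Lam_image_setK (hXHY : IsSl2Triple H X Y) :
    Lam (B.basisH hXHY) '' B.setK =
      {M | ∃ g : B.BlockData, g.IsCompactType ∧ g.chiP * g.chiQ = 1 ∧
          M = Matrix.fromBlocks g.Dp 0 0 g.Dq} := by
  ext M
  constructor
  · rintro ⟨g, hg, rfl⟩
    obtain ⟨β, hβ, h, hgβ⟩ := exists_of_mem_setK hXHY hg
    exact ⟨β, hβ, h, by rw [Lam, hgβ, β.toMatrix_act hXHY]⟩
  · rintro ⟨β, hβ, h, rfl⟩
    obtain ⟨g, hg, hgβ⟩ := β.exists_mem_setK hXHY hβ h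
    exact ⟨g, hg, by rw [Lam, hgβ, β.toMatrix_act hXHY]⟩

theorem Lam_image_setK_subset (hXHY : IsSl2Triple H X Y) :
    Lam (B.basisH hXHY) '' B.setK ⊆ SOxO p q := by
  rintro _ ⟨g, hg, rfl⟩
  obtain ⟨β, -, -, hgβ⟩ := exists_of_mem_setK hXHY hg
  have hM : Lam (B.basisH hXHY) g = Matrix.fromBlocks β.Dp 0 0 β.Dq := by
    rw [Lam, hgβ, β.toMatrix_act hXHY]
  have hSO := (mem_SO_iff g).mp hg.1.1
  have h1 := β.matrixOn_basisPos hXHY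
  have h2 := β.matrixOn_basisNeg hXHY
  rw [← B.ofFn_basisH_inl hXHY, ← hgβ] at h1
  rw [← B.ofFn_basisH_inr hXHY, ← hgβ] at h2
  have hform := B.form_basisVec hXHY
  simp only [← B.basisH_apply hXHY] at hform
  refine ⟨β.Dp, ?_, β.Dq, ?_, ?_, hM⟩
  -- Invariance of the form, evaluated on the orthonormal vectors of `ℋ_+`, is orthogonality of the
  -- columns of `𝐃_p`; on `ℋ_-` both sides only change sign.
  · rw [Matrix.mem_orthogonalGroup_iff']
    ext i j
    have h := hSO (B.basisH hXHY (Sum.inl i)) (B.basisH hXHY (Sum.inl j))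
    rw [h1.mulVec_ofFn, h1.mulVec_ofFn, form_sum_left] at h
    simp only [form_sum_right, form_smul_left, form_smul_right, hform] at h
    simpa [Matrix.mul_apply, Matrix.one_apply, BlockData.Dp, mul_comm] using h
  · rw [Matrix.mem_orthogonalGroup_iff']
    ext i j
    have h := hSO (B.basisH hXHY (Sum.inr i)) (B.basisH hXHY (Sum.inr j))
    rw [h2.mulVec_ofFn, h2.mulVec_ofFn, form_sum_left] at h
    simp only [form_sum_right, form_smul_left, form_smul_right, hform] at h
    rcases eq_or_ne i j with rfl | hij
    · simpa [Matrix.mul_apply, BlockData.Dq] using h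
    · simpa [Matrix.mul_apply, BlockData.Dq, hij, mul_comm] using h
  · rw [← Matrix.det_fromBlocks_zero₂₁ β.Dp 0 β.Dq, ← hM, Lam, LinearMap.det_toMatrix,
      ← Matrix.toLin'_apply', LinearMap.det_toLin', g.det_coe]

end AdaptedBasis
end SOpq

end

open SOpq in
theorem mainTheorem6 (p q : ℕ) (X H Y : so p q)
    (hX : IsNilpotent (LieAlgebra.ad ℝ (so p q) X)) (hXHY : IsSl2Triple H X Y)
    (B : AdaptedBasis X H Y) :
    -- `K` is a maximal compact subgroup of the centralizer of the triple in `SO(p,q)`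
    (∃ K : Subgroup (SL p q), (K : Set (SL p q)) = B.setK ∧
      Maximal (fun S : Subgroup (SL p q) =>
        S ≤ centralizer X H Y ∧ IsCompact (S : Set (SL p q))) K) ∧
    -- the matrices `𝐃_p(g)`, `𝐃_q(g)` have sizes `p`, `q`
    (∀ g : B.BlockData, g.sumP.1 = p ∧ g.sumQ.1 = q) ∧
    -- `ℋ = ℋ_+ ∨ ℋ_-` is an ordered basis of `V`, with `p` vectors in `ℋ_+` and `q` in `ℋ_-`
    ∃ b : Module.Basis (Idx p q) ℝ (Vec p q),
      List.ofFn (fun i : Fin p => b (Sum.inl i)) = B.basisPos ∧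
      List.ofFn (fun j : Fin q => b (Sum.inr j)) = B.basisNeg ∧
      -- `Λ_ℋ(K)` lies in `S(O(p) × O(q))` and is the given group
      Lam b '' B.setK ⊆ SOxO p q ∧
      Lam b '' B.setK =
        {M | ∃ g : B.BlockData, g.IsCompactType ∧ g.chiP * g.chiQ = 1 ∧
          M = Matrix.fromBlocks g.Dp 0 0 g.Dq} := by
  exact ⟨⟨B.orthogonalSubgroup hXHY, B.coe_orthogonalSubgroup hXHY,
      B.maximal_orthogonalSubgroup hXHY⟩,
    fun g => ⟨g.size_sumP hXHY, g.size_sumQ hXHY⟩, B.basisH hXHY, B.ofFn_basisH_inl hXHY,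
    B.ofFn_basisH_inr hXHY, AdaptedBasis.Lam_image_setK_subset hXHY,
    AdaptedBasis.Lam_image_setK hXHY⟩
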